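/- Let $M$ be a smooth (Hausdorff, second countable) manifold of dimension $4n+3$. An almost hyper CR structure on $M$ is a pair of almost CR structures $(Q_1,I)$, $(Q_2,J)$ (corank one subbundles of $TM$ with complex structures) such that $Q_1,Q_2$ are transversal and $IJ=-JI$ on $I(Q_1\cap Q_2)\cap J(Q_1\cap Q_2)$. Put $Q_3=I(Q_1\cap Q_2)+J(Q_1\cap Q_2)$, with $K=-JI$ on $I(Q_1\cap Q_2)$ and $K=IJ$ on $J(Q_1\cap Q_2)$; write $(I_1,I_2,I_3)=(I,J,K)$ and $Q=Q_1\cap Q_2\cap Q_3$. It is a hyper CR structure if for $a=1,2,3$ and all $X,Y\in\Gamma(Q)$ $$[X,Y]-[I_aX,I_aY]\in\Gamma(Q_a),\qquad I_a([X,Y]-[I_aX,I_aY])-[X,I_aY]-[I_aX,Y]\in\Gamma(Q).$$ An $\mathbb R^3$-valued one-form $\theta=(\theta_1,\theta_2,\theta_3)$ is compatible if $\ker\theta_a=Q_a$ and $\theta_3\circ I=\theta_2$ on $Q_1$, $\theta_1\circ J=\theta_3$ on $Q_2$, $\theta_2\circ K=\theta_1$ on $Q_3$. Its Levi form on $Q$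 is $\mathrm{Levi}_\theta(X,Y)=\frac12\bigl(d\theta_1(X,IY)+d\theta_1(JX,KY)\bigr)$, where $d\theta_a(X,Y)=X\theta_a(Y)-Y\theta_a(X)-\theta_a([X,Y])$. A hyper pseudohermitian manifold $(M,\theta)$ is a hyper CR manifold with a compatible $\theta$ for which $g:=\mathrm{Levi}_\theta$ is positive definite; it is ultra-pseudoconvex if $$h(X,Y)=(2n+4)\,\mathrm{Levi}_\theta(X,Y)-\sum_{a=1}^3 d\theta_a(X,I_aY),\qquad X,Y\in Q,$$ is positive or negative definite. An admissible triple is a triple of smooth vector fields $T_1,T_2,T_3$ transverse to $Q$ with $T_a\in\Gamma(Q_b\cap Q_c)$ and $I_aT_b=T_c$ for every cyclic permutation $(a,b,c)$ of $(1,2,3)$; its span $Q^\perp=\bigoplus_a\mathbb RT_a$ is called an admissible three-plane field, and $TM=Q\oplus Q^\perp$. Put $g^\perp=\theta_1^2+\theta_2^2+\theta_3^2$. A connection $\nabla$ on $TM$ with torsion $\mathrm{Tor}$ is said to be associated with an admissible $Q^\perp$ if (i) $\nabla$ preserves $Q$ and $Q^\perp$; (ii) $g$ (on $Q$) and $g^\perp$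 (on $Q^\perp$) are $\nabla$-parallel; (iii) for $X,Y\in Q$ and $U,V\in Q^\perp$: $\mathrm{Tor}(X,Y)_Q=0$, $\mathrm{Tor}(U,V)_{Q^\perp}=0$, the map $X\mapsto\mathrm{Tor}(U,X)_Q$ is $g$-symmetric on $Q$, and the map $U\mapsto\mathrm{Tor}(U,X)_{Q^\perp}$ is $g^\perp$-symmetric on $Q^\perp$. In a local $g$-orthonormal frame of $Q$ adapted to $I,J,K$ (that is, made of quadruples $\varepsilon,I\varepsilon,J\varepsilon,K\varepsilon$) let $\omega$ be the $so(4n)$-valued matrix of connection forms of $\nabla|_Q$, restricted to $Q$, and let $\omega^{\rm obs}\in Q^*\otimes(sp(n)+sp(1))^\perp$ be its component in the orthogonal complement of $sp(n)+sp(1)$ in $so(4n)$ with respect to the Killing inner product. Let $\omega^{E\otimes H}$ be the component of $\omega^{\rm obs}$ in the summand $E\otimes H$ of the $Sp(n)\times Sp(1)$-module $(\mathbb H^n)^*\otimes(sp(n)+sp(1))^\perp$, where $E=\mathbb C^{2n}$ and $H=\mathbb C^2$ are the standard modules and $\mathbb H^n\otimes\mathbb C\cong E\otimes H$; this summand is the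 image of $\mathbb H^n$ under $w\mapsto\bigl(X\mapsto(X\wedge w)^{\rm obs}\bigr)$. Theorem. Let $(M,\theta)$ be an ultra-pseudoconvex hyper pseudohermitian manifold of dimension $4n+3>7$. Then every admissible three-plane field has exactly one associated connection, and there is a unique admissible three-plane field $Q^\perp$ whose associated connection satisfies $\omega^{E\otimes H}=0$. Correspondingly, there is a unique admissible triple $(T_1,T_2,T_3)$ (the canonical triple) with $\theta_a(T_a)=1$ for $a=1,2,3$ such that the connection associated with its span (the canonical connection) satisfies $\omega^{E\otimes H}=0$. -/

import Mathlib

open scoped Manifold ContDiff Topology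

noncomputable section

namespace HyperCR

/-! ### Vector fields, distributions, one-forms on a manifold of dimension `4n+3` -/

/-- The model space of a manifold of dimension `4n+3`. -/
abbrev ModelE (n : ℕ) : Type := EuclideanSpace ℝ (Fin (4 * n + 3))

/-- The tangent space at `x` of a manifold of dimension `4n+3`. -/
abbrev Tan (n : ℕ) {M : Type*} [TopologicalSpace M] [ChartedSpace (ModelE n) M] (x : M) : Type :=
  TangentSpace (𝓡 (4 * n + 3)) x

/-- Connections (covariant derivatives) on `TM`; `∇ Y x v` is `∇_v Y` at `x`. -/
abbrev Connection (n : ℕ) (M : Type*) [TopologicalSpace M] [ChartedSpace (ModelE n) M]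
    [IsManifold (𝓡 (4 * n + 3)) ∞ M] : Type _ :=
  CovariantDerivative (𝓡 (4 * n + 3)) (ModelE n) (TangentSpace (𝓡 (4 * n + 3)) : M → Type _)

section Basic

variable {n : ℕ} {M : Type*} [TopologicalSpace M] [ChartedSpace (ModelE n) M]
  [IsManifold (𝓡 (4 * n + 3)) ∞ M]

/-- `X` is a smooth vector field on the set `U`. -/
def SmoothOn (X : ∀ x : M, Tan n x) (U : Set M) : Prop :=
  ContMDiffOn (𝓡 (4 * n + 3)) (𝓡 (4 * n + 3)).tangent ∞
    (fun x => (⟨x, X x⟩ : TangentBundle (𝓡 (4 * n + 3)) M)) U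

/-- `X ∈ Γ(Q)`: a global smooth vector field with values in the distribution `Q`. -/
def IsSection (Q : ∀ x : M, Submodule ℝ (Tan n x)) (X : ∀ x : M, Tan n x) : Prop :=
  SmoothOn X Set.univ ∧ ∀ x, X x ∈ Q x

/-- `Q` is a smooth subbundle of `TM` of rank `r`: it has constant rank, and each of its vectors
extends to a smooth section. -/
def IsSubbundle (Q : ∀ x : M, Submodule ℝ (Tan n x)) (r : ℕ) : Prop :=
  (∀ x, Module.finrank ℝ (Q x) = r) ∧
    ∀ x, ∀ v ∈ Q x, ∃ X : ∀ x : M, Tan n x, IsSection Q X ∧ X x = v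

/-- `θ` is a smooth one-form. -/
def IsSmoothOneForm (θ : ∀ x : M, Tan n x →L[ℝ] ℝ) : Prop :=
  ContMDiff (𝓡 (4 * n + 3)) ((𝓡 (4 * n + 3)).prod 𝓘(ℝ, ModelE n →L[ℝ] ℝ)) ∞
    (fun x => Bundle.TotalSpace.mk' (ModelE n →L[ℝ] ℝ)
      (E := fun x : M => (TangentSpace (𝓡 (4 * n + 3)) x →L[ℝ] ℝ)) x (θ x))

/-- The expression `X(θ(Y)) - Y(θ(X)) - θ([X, Y])` at the point `x`. -/
def cartan (θ : ∀ x : M, Tan n x →L[ℝ] ℝ) (X Y : ∀ x : M, Tan n x) (x : M) : ℝ :=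
  mvfderiv (𝓡 (4 * n + 3)) (fun y => θ y (Y y)) x (X x)
    - mvfderiv (𝓡 (4 * n + 3)) (fun y => θ y (X y)) x (Y x)
    - θ x (VectorField.mlieBracket (𝓡 (4 * n + 3)) X Y x)

/-- The exterior derivative of a one-form,
`dθ(v, w) = X(θ(Y)) - Y(θ(X)) - θ([X, Y])`, where `X`, `Y` are vector fields extending `v`, `w`.
The extension used is immaterial, see `dform_apply`. -/
def dform (θ : ∀ x : M, Tan n x →L[ℝ] ℝ) (x : M) (v w : Tan n x) : ℝ :=
  cartan θ (FiberBundle.extend (ModelE n) v) (FiberBundle.extend (ModelE n) w) x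

/-- A smooth one-form pairs with a differentiable vector field to a differentiable function. -/
theorem mdifferentiableAt_pairing {θ : ∀ x : M, Tan n x →L[ℝ] ℝ} (hθ : IsSmoothOneForm θ)
    {X : ∀ x : M, Tan n x} {x : M}
    (hX : MDifferentiableAt (𝓡 (4 * n + 3)) (𝓡 (4 * n + 3)).tangent
      (fun y => (⟨y, X y⟩ : TangentBundle (𝓡 (4 * n + 3)) M)) x) :
    MDifferentiableAt (𝓡 (4 * n + 3)) 𝓘(ℝ, ℝ) (fun y => θ y (X y)) x := by
  have h1 := (hθ x).mdifferentiableAt (by simp)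
  have h2 := MDifferentiableAt.clm_bundle_apply (b := fun y : M => y) (F₂ := ℝ)
    (E₂ := Bundle.Trivial M ℝ) (ϕ := θ) (v := X) h1 hX
  exact ((mdifferentiableAt_totalSpace _ _).1 h2).2

/-- The expression `cartan θ X Y` is tensorial in `X`. -/
theorem tensorialAt_cartan {θ : ∀ x : M, Tan n x →L[ℝ] ℝ} (hθ : IsSmoothOneForm θ)
    (Y : ∀ x : M, Tan n x) (x : M) :
    TensorialAt (𝓡 (4 * n + 3)) (ModelE n) (fun X : ∀ x : M, Tan n x => cartan θ X Y x) x where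
  smul {f X} hf hX := by
    have h : (fun y => θ y ((f • X) y)) = fun y => f y * θ y (X y) := by
      funext y; simp
    simp only [cartan]
    rw [h, mvfderiv_fun_mul hf (mdifferentiableAt_pairing hθ hX),
      VectorField.mlieBracket_smul_left hf hX]
    simp
    ring
  add {X X'} hX hX' := by
    have h : (fun y => θ y ((X + X') y)) = fun y => θ y (X y) + θ y (X' y) := by
      funext y; simp
    simp only [cartan]
    rw [h, mvfderiv_fun_add (mdifferentiableAt_pairing hθ hX) (mdifferentiableAt_pairing hθ hX'),
      VectorField.mlieBracket_add_left hX hX']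
    simp
    ring

theorem cartan_swap (θ : ∀ x : M, Tan n x →L[ℝ] ℝ) (X Y : ∀ x : M, Tan n x) (x : M) :
    cartan θ X Y x = -cartan θ Y X x := by
  simp only [cartan]
  rw [VectorField.mlieBracket_swap]
  simp
  ring

/-- `dθ(X, Y) = X(θ(Y)) - Y(θ(X)) - θ([X, Y])` for all vector fields `X`, `Y`. -/
theorem dform_apply {θ : ∀ x : M, Tan n x →L[ℝ] ℝ} (hθ : IsSmoothOneForm θ)
    {X Y : ∀ x : M, Tan n x} {x : M}
    (hX : MDifferentiableAt (𝓡 (4 * n + 3)) (𝓡 (4 * n + 3)).tangent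
      (fun y => (⟨y, X y⟩ : TangentBundle (𝓡 (4 * n + 3)) M)) x)
    (hY : MDifferentiableAt (𝓡 (4 * n + 3)) (𝓡 (4 * n + 3)).tangent
      (fun y => (⟨y, Y y⟩ : TangentBundle (𝓡 (4 * n + 3)) M)) x) :
    dform θ x (X x) (Y x) = cartan θ X Y x := by
  refine TensorialAt.pointwise₂ (I := 𝓡 (4 * n + 3)) (F := ModelE n) (F' := ModelE n)
    (Φ := fun X Y => cartan θ X Y x)
    (fun Y _ => tensorialAt_cartan hθ Y x) (fun X _ => ?_)
    (FiberBundle.mdifferentiableAt_extend ..) hX (FiberBundle.mdifferentiableAt_extend ..) hY (by simp) (by simp)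
  have h := tensorialAt_cartan hθ X x
  refine ⟨fun {f Y} hf hY => ?_, fun {Y Y'} hY hY' => ?_⟩
  · rw [cartan_swap, cartan_swap θ X Y, h.smul hf hY, smul_neg]
  · rw [cartan_swap, cartan_swap θ X Y, cartan_swap θ X Y', h.add hY hY', neg_add]

/-- The component in `p` of a vector `v`, with respect to a splitting `p ⊕ q`. -/
def component {V : Type*} [AddCommGroup V] [Module ℝ V] (p q : Submodule ℝ V) (v : V) : V :=
  open Classical in if h : IsCompl p q then (p.projectionOnto q h v : V) else 0

end Basic

/-! ### Hyper CR and hyper pseudohermitian structures -/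

section Structures

variable (n : ℕ) (M : Type*) [TopologicalSpace M] [ChartedSpace (ModelE n) M]
  [IsManifold (𝓡 (4 * n + 3)) ∞ M]

/-- `(Q, J)` is an almost CR structure: `Q` is a corank one subbundle of `TM` and `J` is a smooth
complex structure on `Q`. Only the restriction of `J` to `Q` carries information: the values of
the endomorphism `J x` outside of `Q x` are arbitrary. -/
structure IsAlmostCR {n : ℕ} {M : Type*} [TopologicalSpace M] [ChartedSpace (ModelE n) M]
    [IsManifold (𝓡 (4 * n + 3)) ∞ M]
    (Q : ∀ x : M, Submodule ℝ (Tan n x)) (J : ∀ x : M, Tan n x →ₗ[ℝ] Tan n x) : Prop where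
  subbundle : IsSubbundle Q (4 * n + 2)
  mapsTo : ∀ x, ∀ v ∈ Q x, J x v ∈ Q x
  sq : ∀ x, ∀ v ∈ Q x, J x (J x v) = -v
  smooth : ∀ X, IsSection Q X → IsSection Q (fun x => J x (X x))

/-- An almost hyper CR structure: a pair of almost CR structures `(Q₁, I)`, `(Q₂, J)` (indices
`0`, `1`) such that `Q₁`, `Q₂` are transversal and `IJ = -JI` on `I(Q₁ ∩ Q₂) ∩ J(Q₁ ∩ Q₂)`.
The pair `(Q₃, K)` (index `2`) is determined by the first two through
`Q₃ = I(Q₁ ∩ Q₂) + J(Q₁ ∩ Q₂)`, `K = -JI` on `I(Q₁ ∩ Q₂)` and `K = IJ` on `J(Q₁ ∩ Q₂)`.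
The values of `I a x` outside of `Qa a x` are arbitrary and are never used. -/
structure AlmostHyperCR where
  Qa : Fin 3 → ∀ x : M, Submodule ℝ (Tan n x)
  I : Fin 3 → ∀ x : M, Tan n x →ₗ[ℝ] Tan n x
  almostCR_one : IsAlmostCR (Qa 0) (I 0)
  almostCR_two : IsAlmostCR (Qa 1) (I 1)
  transversal : ∀ x, Qa 0 x ⊔ Qa 1 x = ⊤
  anticomm : ∀ x, ∀ v ∈ (Qa 0 x ⊓ Qa 1 x).map (I 0 x) ⊓ (Qa 0 x ⊓ Qa 1 x).map (I 1 x),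
    I 0 x (I 1 x v) = -I 1 x (I 0 x v)
  third_eq : ∀ x, Qa 2 x = (Qa 0 x ⊓ Qa 1 x).map (I 0 x) ⊔ (Qa 0 x ⊓ Qa 1 x).map (I 1 x)
  third_left : ∀ x, ∀ v ∈ (Qa 0 x ⊓ Qa 1 x).map (I 0 x), I 2 x v = -I 1 x (I 0 x v)
  third_right : ∀ x, ∀ v ∈ (Qa 0 x ⊓ Qa 1 x).map (I 1 x), I 2 x v = I 0 x (I 1 x v)

variable {n M}

namespace AlmostHyperCR

variable (S : AlmostHyperCR n M)

/-- The corank three bundle `Q = Q₁ ∩ Q₂ ∩ Q₃`. -/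
def Q (x : M) : Submodule ℝ (Tan n x) := S.Qa 0 x ⊓ S.Qa 1 x ⊓ S.Qa 2 x

/-- Integrability of an almost hyper CR structure: for all `X, Y ∈ Γ(Q)`,
`[X, Y] - [I_a X, I_a Y] ∈ Γ(Q_a)` and
`I_a([X, Y] - [I_a X, I_a Y]) - [X, I_a Y] - [I_a X, Y] ∈ Γ(Q)`. -/
def Integrable : Prop :=
  ∀ a : Fin 3, ∀ X Y : ∀ x : M, Tan n x, IsSection S.Q X → IsSection S.Q Y → ∀ x : M,
    (VectorField.mlieBracket (𝓡 (4 * n + 3)) X Y x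
      - VectorField.mlieBracket (𝓡 (4 * n + 3))
          (fun y => S.I a y (X y)) (fun y => S.I a y (Y y)) x ∈ S.Qa a x) ∧
    (S.I a x (VectorField.mlieBracket (𝓡 (4 * n + 3)) X Y x
        - VectorField.mlieBracket (𝓡 (4 * n + 3))
            (fun y => S.I a y (X y)) (fun y => S.I a y (Y y)) x)
      - VectorField.mlieBracket (𝓡 (4 * n + 3)) X (fun y => S.I a y (Y y)) x
      - VectorField.mlieBracket (𝓡 (4 * n + 3)) (fun y => S.I a y (X y)) Y x ∈ S.Q x)

/-- An admissible triple `(T₁, T₂, T₃)`: smooth vector fields transverse to `Q` with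
`T_a ∈ Γ(Q_b ∩ Q_c)` and `I_a T_b = T_c` for `(a, b, c)` a cyclic permutation of `(1, 2, 3)`. -/
structure IsAdmissibleTriple (T : Fin 3 → ∀ x : M, Tan n x) : Prop where
  smooth : ∀ a, SmoothOn (T a) Set.univ
  transverse : ∀ a x, T a x ∉ S.Q x
  mem : ∀ a x, T a x ∈ S.Qa (a + 1) x ⊓ S.Qa (a + 2) x
  cyclic : ∀ a x, S.I a x (T (a + 1) x) = T (a + 2) x

/-- The three-plane field `ℝT₁ ⊕ ℝT₂ ⊕ ℝT₃` of a triple. -/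
def planeField (T : Fin 3 → ∀ x : M, Tan n x) (x : M) : Submodule ℝ (Tan n x) :=
  Submodule.span ℝ (Set.range fun a => T a x)

/-- `P` is an admissible three-plane field (denoted `Q^⊥`). -/
def IsAdmissible (P : ∀ x : M, Submodule ℝ (Tan n x)) : Prop :=
  ∃ T, S.IsAdmissibleTriple T ∧ P = planeField T

/-- The `ℝ³`-valued one-form `θ` is compatible with the almost hyper CR structure:
`ker θ_a = Q_a`, and `θ₃ ∘ I = θ₂` on `Q₁`, `θ₁ ∘ J = θ₃` on `Q₂`, `θ₂ ∘ K = θ₁` on `Q₃`. -/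
structure IsCompatible (θ : Fin 3 → ∀ x : M, Tan n x →L[ℝ] ℝ) : Prop where
  smooth : ∀ a, IsSmoothOneForm (θ a)
  ker : ∀ a x v, θ a x v = 0 ↔ v ∈ S.Qa a x
  comp : ∀ a x, ∀ v ∈ S.Qa a x, θ (a + 2) x (S.I a x v) = θ (a + 1) x v

/-- The Levi form of `θ` on `Q`: `Levi_θ(v, w) = (dθ₁(v, I w) + dθ₁(J v, K w)) / 2`. -/
def levi (θ : Fin 3 → ∀ x : M, Tan n x →L[ℝ] ℝ) (x : M) (v w : Tan n x) : ℝ :=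
  (dform (θ 0) x v (S.I 0 x w) + dform (θ 0) x (S.I 1 x v) (S.I 2 x w)) / 2

/-- The form `h(v, w) = (2n+4) Levi_θ(v, w) - ∑ₐ dθ_a(v, I_a w)` on `Q`. -/
def hForm (θ : Fin 3 → ∀ x : M, Tan n x →L[ℝ] ℝ) (x : M) (v w : Tan n x) : ℝ :=
  (2 * (n : ℝ) + 4) * S.levi θ x v w - ∑ a : Fin 3, dform (θ a) x v (S.I a x w)

end AlmostHyperCR

variable (n M)

/-- A hyper pseudohermitian structure: an integrable almost hyper CR structure together with a
compatible `ℝ³`-valued one-form `θ` whose Levi form is positive definite on `Q`. -/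
structure HyperPseudohermitian extends AlmostHyperCR n M where
  integrable : toAlmostHyperCR.Integrable
  θ : Fin 3 → ∀ x : M, Tan n x →L[ℝ] ℝ
  compatible : toAlmostHyperCR.IsCompatible θ
  levi_pos : ∀ x, ∀ v ∈ toAlmostHyperCR.Q x, v ≠ 0 → 0 < toAlmostHyperCR.levi θ x v v

end Structures

/-! ### The model `Sp(n)·Sp(1)`-module `ℍⁿ* ⊗ (sp(n) + sp(1))^⊥` and its summand `E ⊗ H` -/

section Model

/-- Indices of an adapted frame: `(k, 0), (k, 1), (k, 2), (k, 3)` stand for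
`ε, Iε, Jε, Kε` with `ε = ε_{4k-3}`. -/
abbrev Idx (n : ℕ) : Type := Fin n × Fin 4

/-- Real `4n × 4n` matrices `(A_{ij})`, with the Frobenius inner product `tr(Aᵀ B)`. On `so(4n)`
it is a positive multiple of the Killing inner product `-(4n-2) tr(A B)`. -/
abbrev Gl (n : ℕ) : Type := EuclideanSpace ℝ (Idx n × Idx n)

/-- `A : Gl n` as a matrix. -/
def toMat {n : ℕ} (A : Gl n) : Matrix (Idx n) (Idx n) ℝ := Matrix.of fun i j => A (i, j)

/-- The matrices of `I`, `J`, `K` on `ℝ⁴` with respect to the basis `ε, Iε, Jε, Kε`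
(the image of the `j`-th basis vector is the `j`-th column). -/
def unitMat : Fin 3 → Matrix (Fin 4) (Fin 4) ℝ :=
  ![!![0, -1, 0, 0; 1, 0, 0, 0; 0, 0, 0, -1; 0, 0, 1, 0],
    !![0, 0, -1, 0; 0, 0, 0, 1; 1, 0, 0, 0; 0, -1, 0, 0],
    !![0, 0, 0, -1; 0, 0, -1, 0; 0, 1, 0, 0; 1, 0, 0, 0]]

/-- The matrices of `I`, `J`, `K` on `ℝ^{4n}` with respect to an adapted basis. -/
def quatMat (n : ℕ) (a : Fin 3) : Gl n :=
  WithLp.toLp 2 fun p => if p.1.1 = p.2.1 then unitMat a p.1.2 p.2.2 else 0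

/-- `so(4n)`. -/
def so (n : ℕ) : Submodule ℝ (Gl n) where
  carrier := {A | ∀ i j, A (i, j) = -A (j, i)}
  add_mem' := by
    intro A B hA hB i j
    simp only [PiLp.add_apply, hA i j, hB i j]
    ring
  zero_mem' := by
    intro i j
    simp
  smul_mem' := by
    intro c A hA i j
    simp only [PiLp.smul_apply, hA i j, smul_neg]

/-- `sp(n)`: the elements of `so(4n)` that commute with `I`, `J`, `K`. -/
def spn (n : ℕ) : Submodule ℝ (Gl n) where
  carrier := {A | A ∈ so n ∧
    ∀ a, toMat A * toMat (quatMat n a) = toMat (quatMat n a) * toMat A}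
  add_mem' := by
    rintro A B ⟨hA, hA'⟩ ⟨hB, hB'⟩
    refine ⟨add_mem hA hB, fun a => ?_⟩
    have h : toMat (A + B) = toMat A + toMat B := by ext; simp [toMat]
    rw [h, add_mul, mul_add, hA', hB']
  zero_mem' := by
    refine ⟨zero_mem _, fun a => ?_⟩
    have h : toMat (0 : Gl n) = 0 := by ext; simp [toMat]
    rw [h, zero_mul, mul_zero]
  smul_mem' := by
    rintro c A ⟨hA, hA'⟩
    refine ⟨Submodule.smul_mem _ c hA, fun a => ?_⟩
    have h : toMat (c • A) = c • toMat A := by ext; simp [toMat]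
    rw [h, smul_mul_assoc, mul_smul_comm, hA']

/-- `sp(1)`, spanned by `I`, `J`, `K`. -/
def sp1 (n : ℕ) : Submodule ℝ (Gl n) := Submodule.span ℝ (Set.range (quatMat n))

/-- `(sp(n) + sp(1))^⊥`, the orthogonal complement of `sp(n) + sp(1)` in `so(4n)`. -/
def obsSpace (n : ℕ) : Submodule ℝ (Gl n) := so n ⊓ (spn n ⊔ sp1 n)ᗮ

/-- `ℍⁿ* ⊗ gl(4n)`: a form `α` on `ℍⁿ = ℝ^{4n}` with values in matrices, given by its values on
the standard basis. -/
abbrev FormGl (n : ℕ) : Type := PiLp 2 fun _ : Idx n => Gl n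

/-- The `(sp(n) + sp(1))^⊥`-component of a `gl(4n)`-valued form on `ℍⁿ`. -/
def obsPart {n : ℕ} (α : FormGl n) : FormGl n :=
  WithLp.toLp 2 fun i => (obsSpace n).starProjection (α i)

/-- The form `X ↦ X ∧ w` on `ℍⁿ`, where `X ∧ w` is the element `Y ↦ ⟨X, Y⟩ w - ⟨w, Y⟩ X` of
`so(4n)`. -/
def wedgeForm {n : ℕ} (w : EuclideanSpace ℝ (Idx n)) : FormGl n :=
  WithLp.toLp 2 fun i => WithLp.toLp 2 fun p =>
    (if p.2 = i then w p.1 else 0) - (if p.1 = i then w p.2 else 0)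

/-- The summand `E ⊗ H` of `ℍⁿ* ⊗ (sp(n) + sp(1))^⊥ ≅ (E ⊗ H) ⊗ (Λ²₀E ⊗ S²H)`, as the image of
`ℍⁿ ≅ E ⊗ H` under the equivariant embedding `w ↦ (X ↦ (X ∧ w)^{obs})`. After complexification
this embedding is the tensor product of
`E → E ⊗ Λ²₀E, e ↦ ∑ₖ (e_{2k-1} ⊗ (e_{2k} ∧ e)₀ - e_{2k} ⊗ (e_{2k-1} ∧ e)₀)` and
`H → H ⊗ S²H, f ↦ f₁ ⊗ (f₂ · f) - f₂ ⊗ (f₁ · f)`, because the invariant element of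
`(E ⊗ H) ⊗ (E ⊗ H)` is `∑ₖ (e_{2k-1} ⊗ e_{2k} - e_{2k} ⊗ e_{2k-1}) ⊗ (f₁ ⊗ f₂ - f₂ ⊗ f₁)`, and
the projection of `Λ²(E ⊗ H)` to `Λ²₀E ⊗ S²H` is `(e ⊗ f) ∧ (e' ⊗ f') ↦ (e ∧ e')₀ ⊗ (f · f')`. -/
def summandEH (n : ℕ) : Submodule ℝ (FormGl n) :=
  Submodule.span ℝ (Set.range fun w : EuclideanSpace ℝ (Idx n) => obsPart (wedgeForm w))

end Model

/-! ### The connection of a three-plane field and its obstruction -/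

namespace HyperPseudohermitian

variable {n : ℕ} {M : Type*} [TopologicalSpace M] [ChartedSpace (ModelE n) M]
  [IsManifold (𝓡 (4 * n + 3)) ∞ M] (S : HyperPseudohermitian n M)

/-- The metric `g` on `Q`: the Levi form of `θ`. -/
def g (x : M) (v w : Tan n x) : ℝ := S.levi S.θ x v w

/-- `g^⊥ = θ₁² + θ₂² + θ₃²`. -/
def gPerp (x : M) (v w : Tan n x) : ℝ := ∑ a : Fin 3, S.θ a x v * S.θ a x w

/-- Ultra-pseudoconvexity: `h` is positive or negative definite on `Q`. -/
def UltraPseudoconvex : Prop :=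
  (∀ x, ∀ v ∈ S.Q x, v ≠ 0 → 0 < S.hForm S.θ x v v) ∨
    (∀ x, ∀ v ∈ S.Q x, v ≠ 0 → S.hForm S.θ x v v < 0)

/-- `∇` is a smooth connection on `TM` such that, with respect to the splitting `TM = Q ⊕ P`
(where `P = Q^⊥`):
(i) `Q` and `P` are preserved by `∇`; (ii) `g` and `g^⊥` are `∇`-parallel; (iii) for `X, Y ∈ Q`
and `U, V ∈ P`, (a) `Tor(X, Y)_Q = 0`; (b) `Tor(U, V)_P = 0`; (c) `X ↦ Tor(U, X)_Q` is
`g`-symmetric; (d) `U ↦ Tor(U, X)_P` is `g^⊥`-symmetric. -/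
structure IsAssociated (P : ∀ x : M, Submodule ℝ (Tan n x)) (D : Connection n M) : Prop where
  smooth : CovariantDerivative.ContMDiffCovariantDerivative D ∞
  preserves_Q : ∀ Y, IsSection S.Q Y → ∀ x v, D Y x v ∈ S.Q x
  preserves_P : ∀ V, IsSection P V → ∀ x v, D V x v ∈ P x
  parallel_g : ∀ Y Z, IsSection S.Q Y → IsSection S.Q Z → ∀ x v,
    mvfderiv (𝓡 (4 * n + 3)) (fun y => S.g y (Y y) (Z y)) x v
      = S.g x (D Y x v) (Z x) + S.g x (Y x) (D Z x v)
  parallel_gPerp : ∀ V W, IsSection P V → IsSection P W → ∀ x v,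
    mvfderiv (𝓡 (4 * n + 3)) (fun y => S.gPerp y (V y) (W y)) x v
      = S.gPerp x (D V x v) (W x) + S.gPerp x (V x) (D W x v)
  torsion_QQ : ∀ x, ∀ X ∈ S.Q x, ∀ Y ∈ S.Q x, component (S.Q x) (P x) (D.torsion x X Y) = 0
  torsion_PP : ∀ x, ∀ U ∈ P x, ∀ V ∈ P x, component (P x) (S.Q x) (D.torsion x U V) = 0
  torsion_symm_Q : ∀ x, ∀ U ∈ P x, ∀ X ∈ S.Q x, ∀ Y ∈ S.Q x,
    S.g x (component (S.Q x) (P x) (D.torsion x U X)) Y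
      = S.g x X (component (S.Q x) (P x) (D.torsion x U Y))
  torsion_symm_P : ∀ x, ∀ X ∈ S.Q x, ∀ U ∈ P x, ∀ V ∈ P x,
    S.gPerp x (component (P x) (S.Q x) (D.torsion x U X)) V
      = S.gPerp x U (component (P x) (S.Q x) (D.torsion x V X))

/-- `ε` is an adapted orthonormal frame for `Q` on the open set `U`:
`ε (k, 1) = I ε (k, 0)`, `ε (k, 2) = J ε (k, 0)`, `ε (k, 3) = K ε (k, 0)`. -/
structure IsAdaptedFrame (U : Set M) (ε : Idx n → ∀ x : M, Tan n x) : Prop where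
  isOpen : IsOpen U
  smooth : ∀ i, SmoothOn (ε i) U
  mem : ∀ i, ∀ x ∈ U, ε i x ∈ S.Q x
  orthonormal : ∀ i j, ∀ x ∈ U, S.g x (ε i x) (ε j x) = if i = j then 1 else 0
  adapted : ∀ k (a : Fin 3), ∀ x ∈ U, ε (k, a.succ) x = S.I a x (ε (k, 0) x)

/-- The matrix `ω` of connection forms of `∇` with respect to the frame `ε` of `Q`, at the point
`q` and restricted to `Q`: `∇ ε_j = ∑ᵢ ω_{ij} ε_i`, i.e. `ω_{ij}(X) = g(∇_X ε_j, ε_i)`. -/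
def omega (D : Connection n M) (ε : Idx n → ∀ x : M, Tan n x) (q : M) : FormGl n :=
  WithLp.toLp 2 fun k => WithLp.toLp 2 fun p => S.g q (D (ε p.2) q (ε k q)) (ε p.1 q)

/-- The obstruction `ω^{obs}`, the `(sp(n) + sp(1))^⊥`-component of `ω`. -/
def omegaObs (D : Connection n M) (ε : Idx n → ∀ x : M, Tan n x) (q : M) : FormGl n :=
  obsPart (S.omega D ε q)

/-- `ω^{E⊗H}`, the (orthogonal) component of `ω^{obs}` in the summand `E ⊗ H`. -/
def omegaEH (D : Connection n M) (ε : Idx n → ∀ x : M, Tan n x) (q : M) : FormGl n :=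
  (summandEH n).starProjection (S.omegaObs D ε q)

/-- The condition `ω^{E⊗H} = 0`: it holds in all adapted local frames, at all points. -/
def OmegaEHVanishes (D : Connection n M) : Prop :=
  ∀ U ε, S.IsAdaptedFrame U ε → ∀ q ∈ U, S.omegaEH D ε q = 0

end HyperPseudohermitian

/-- Two connections are the same: they agree on all vector fields at every point of
differentiability. (A term of type `Connection n M` also has values, without meaning, on vector
fields which are not differentiable.) -/
def SameConnection {n : ℕ} {M : Type*} [TopologicalSpace M] [ChartedSpace (ModelE n) M]
    [IsManifold (𝓡 (4 * n + 3)) ∞ M] (D D' : Connection n M) : Prop :=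
  ∀ (Y : ∀ x : M, Tan n x) (x : M),
    MDifferentiableAt (𝓡 (4 * n + 3)) (𝓡 (4 * n + 3)).tangent
      (fun y => (⟨y, Y y⟩ : TangentBundle (𝓡 (4 * n + 3)) M)) x → D Y x = D' Y x

end HyperCR

end

set_option linter.unusedSectionVars false
set_option linter.unusedSimpArgs false

noncomputable section

/-! Dividing an admissible triple by the common value of the `θ_a(T_a)` does not change its span, so
it is enough to study triples with `θ_a(T_a) = 1`. One exists because the conditions on `T₃` (`θ₁ =
θ₂ = 0`, `θ₃ = 1`) are convex and locally solvable, and `T₃` determines the other two fields. Any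
two normalized triples differ by `T'_a = T_a + I_a Z` with `Z` in `Q` (`translate`,
`exists_translate`).

For a fixed plane field, extend `g` by zero along `Q^⊥` and `g^⊥` by zero along `Q`. On each
summand, and given that the splitting is preserved, parallelism of the metric, vanishing of the pure
torsion and symmetry of the mixed torsion are together equivalent to one Koszul formula for the
degenerate extended form: `2 B(∇_X Y, W)` is the usual expression for `Y`, `W` in the summand and
arbitrary `X` (`koszul_eq`, `isHalfAssociated`). The two Koszul formulas define the associated
connection and determine it (`exists_connection`, `sameConnection`).

It remains to see how `ω^{E⊗H}` depends on `Z`. In an adapted frame the Koszul expression contains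
only brackets. Moving the plane field alters the `Q`-component of a bracket through its
`θ_a`-components, which on `Q` are values of `-dθ_a`. So `ω` changes by an explicit term linear in
`Z` and in the `dθ_a` (`omega_change`). Vanishing of `ω^{E⊗H}` means that `ω` is orthogonal to all
generators `X ↦ (X ∧ w)^{obs}`. Integrability makes every `dθ_a(·, I_a ·)` symmetric and
`I_a`-invariant, and gives all of them the same invariant part under the other two units, namely the
Levi form. With these relations the pairing with a generator changes exactly by `-(3/2)(1 - 1/n)
h(w, Z)` (`pairEH_change`). As `n > 1` and `h` is definite, one value of `Z` at each point makes the
pairing vanish.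

The pairing transforms as a covector under a change of adapted frame, because the inhomogeneous term
of the connection matrix commutes with `I`, `J`, `K` and is invisible to the obstruction
(`pairEH_frame`). Hence the pointwise solutions form a global section, smooth by Cramer's rule
(`correction_eq`, `correction_smooth`), and translating by it gives the canonical triple. -/

namespace HyperCR

/-! ### Calculus of smooth functions and vector fields on open sets. -/

section Calculus

variable {n : ℕ} {M : Type*} [TopologicalSpace M] [ChartedSpace (ModelE n) M]

/-- `f` is a smooth function on the set `U`. -/
def SmoothFun (n : ℕ) {M : Type*} [TopologicalSpace M] [ChartedSpace (ModelE n) M]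
    (f : M → ℝ) (U : Set M) : Prop :=
  ContMDiffOn (𝓡 (4 * n + 3)) 𝓘(ℝ, ℝ) ∞ f U

/-- `f` is differentiable at `x`. -/
abbrev DiffFunAt (n : ℕ) {M : Type*} [TopologicalSpace M] [ChartedSpace (ModelE n) M]
    (f : M → ℝ) (x : M) : Prop :=
  MDifferentiableAt (𝓡 (4 * n + 3)) 𝓘(ℝ, ℝ) f x

theorem DiffFunAt.sum {ι : Type*} {s : Finset ι} {f : ι → M → ℝ} {x : M}
    (hf : ∀ i ∈ s, DiffFunAt n (f i) x) : DiffFunAt n (fun y => ∑ i ∈ s, f i y) x := by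
  classical
  induction s using Finset.induction_on with
  | empty => simpa using mdifferentiableAt_const
  | insert a s ha h =>
    simp only [Finset.sum_insert ha]
    exact (hf a (by simp)).add (h fun i hi => hf i (by simp [hi]))

namespace SmoothFun

variable {f g : M → ℝ} {U V : Set M}

theorem mono (h : SmoothFun n f U) (hVU : V ⊆ U) : SmoothFun n f V := ContMDiffOn.mono h hVU

theorem congr (h : SmoothFun n f U) (hfg : ∀ x ∈ U, g x = f x) : SmoothFun n g U :=
  ContMDiffOn.congr h hfg

theorem diffAt (h : SmoothFun n f U) (hU : IsOpen U) {x : M} (hx : x ∈ U) : DiffFunAt n f x :=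
  (ContMDiffOn.contMDiffAt h (hU.mem_nhds hx)).mdifferentiableAt (by simp)

theorem const (c : ℝ) : SmoothFun n (fun _ : M => c) U := contMDiffOn_const

theorem add (hf : SmoothFun n f U) (hg : SmoothFun n g U) : SmoothFun n (fun x => f x + g x) U :=
  ContMDiffOn.add hf hg

theorem sub (hf : SmoothFun n f U) (hg : SmoothFun n g U) : SmoothFun n (fun x => f x - g x) U :=
  ContMDiffOn.sub hf hg

theorem mul (hf : SmoothFun n f U) (hg : SmoothFun n g U) : SmoothFun n (fun x => f x * g x) U :=
  ContMDiffOn.mul hf hg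

theorem sum {ι : Type*} {s : Finset ι} {f : ι → M → ℝ} (hf : ∀ i ∈ s, SmoothFun n (f i) U) :
    SmoothFun n (fun x => ∑ i ∈ s, f i x) U :=
  contMDiffOn_finsetSum hf

theorem prod {ι : Type*} {s : Finset ι} {f : ι → M → ℝ} (hf : ∀ i ∈ s, SmoothFun n (f i) U) :
    SmoothFun n (fun x => ∏ i ∈ s, f i x) U :=
  contMDiffOn_finsetProd hf

theorem comp {φ : ℝ → ℝ} (hf : SmoothFun n f U) (hφ : ∀ x ∈ U, ContDiffAt ℝ ∞ φ (f x)) :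
    SmoothFun n (fun x => φ (f x)) U := fun x hx =>
  ((hφ x hx).contMDiffAt).comp_contMDiffWithinAt x (hf x hx)

theorem inv (hf : SmoothFun n f U) (h0 : ∀ x ∈ U, f x ≠ 0) : SmoothFun n (fun x => (f x)⁻¹) U :=
  hf.comp fun x hx => contDiffAt_inv ℝ (h0 x hx)

theorem div (hf : SmoothFun n f U) (hg : SmoothFun n g U) (h0 : ∀ x ∈ U, g x ≠ 0) :
    SmoothFun n (fun x => f x / g x) U := by
  simp only [div_eq_mul_inv]
  exact hf.mul (hg.inv h0)

theorem sqrt (hf : SmoothFun n f U) (h0 : ∀ x ∈ U, f x ≠ 0) : SmoothFun n (fun x => √(f x)) U :=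
  hf.comp fun x hx => Real.contDiffAt_sqrt (h0 x hx)

end SmoothFun

variable [IsManifold (𝓡 (4 * n + 3)) ∞ M]

/-- The vector field `X` is differentiable at `x`. -/
abbrev DiffAt (X : ∀ x : M, Tan n x) (x : M) : Prop :=
  MDifferentiableAt (𝓡 (4 * n + 3)) (𝓡 (4 * n + 3)).tangent
    (fun y => (⟨y, X y⟩ : TangentBundle (𝓡 (4 * n + 3)) M)) x

/-- The derivative of the function `f` in the direction `v`. -/
abbrev dir (f : M → ℝ) (x : M) (v : Tan n x) : ℝ := mvfderiv (𝓡 (4 * n + 3)) f x v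

/-- The Lie bracket of vector fields. -/
abbrev brak (X Y : ∀ x : M, Tan n x) (x : M) : Tan n x :=
  VectorField.mlieBracket (𝓡 (4 * n + 3)) X Y x

namespace SmoothOn

variable {X Y : ∀ x : M, Tan n x} {f : M → ℝ} {U V : Set M}

theorem mono (h : SmoothOn X U) (hVU : V ⊆ U) : SmoothOn X V := ContMDiffOn.mono h hVU

theorem congr (h : SmoothOn X U) (hXY : ∀ x ∈ U, Y x = X x) : SmoothOn Y U :=
  ContMDiffOn.congr h fun x hx => by simp [hXY x hx]

theorem diffAt (h : SmoothOn X U) (hU : IsOpen U) {x : M} (hx : x ∈ U) : DiffAt X x :=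
  (ContMDiffOn.contMDiffAt h (hU.mem_nhds hx)).mdifferentiableAt (by simp)

theorem add (hX : SmoothOn X U) (hY : SmoothOn Y U) : SmoothOn (fun x => X x + Y x) U :=
  ContMDiffOn.add_section hX hY

theorem sub (hX : SmoothOn X U) (hY : SmoothOn Y U) : SmoothOn (fun x => X x - Y x) U :=
  ContMDiffOn.sub_section hX hY

theorem neg (hX : SmoothOn X U) : SmoothOn (fun x => -X x) U :=
  ContMDiffOn.neg_section hX

theorem smul (hf : SmoothFun n f U) (hX : SmoothOn X U) : SmoothOn (fun x => f x • X x) U :=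
  ContMDiffOn.smul_section hf hX

theorem sum {ι : Type*} {s : Finset ι} {X : ι → ∀ x : M, Tan n x}
    (hX : ∀ i ∈ s, SmoothOn (X i) U) : SmoothOn (fun x => ∑ i ∈ s, X i x) U :=
  ContMDiffOn.sum_section hX

theorem of_locally (h : ∀ x ∈ U, ∃ V, IsOpen V ∧ x ∈ V ∧ SmoothOn X V) : SmoothOn X U := by
  intro x hx
  obtain ⟨V, hV, hxV, hXV⟩ := h x hx
  exact (ContMDiffOn.contMDiffAt hXV (hV.mem_nhds hxV)).contMDiffWithinAt

theorem bracket (hU : IsOpen U) (hX : SmoothOn X U) (hY : SmoothOn Y U) :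
    SmoothOn (brak X Y) U := by
  intro x hx
  have h2 : IsManifold (𝓡 (4 * n + 3)) (minSmoothness ℝ 3) M := by
    rw [minSmoothness_of_isRCLikeNormedField]
    exact IsManifold.of_le (n := ∞) (WithTop.coe_le_coe.2 (le_top : (3 : ℕ∞) ≤ ⊤))
  -- `∞ + 1 = ∞`, so the bracket of smooth fields loses no regularity.
  have : IsManifold (𝓡 (4 * n + 3)) (((⊤ : ℕ∞) : WithTop ℕ∞) + 1) M := ‹_›
  refine (ContMDiffAt.mlieBracket_vectorField (m := ⊤) (n := ⊤)
    (ContMDiffOn.contMDiffAt hX (hU.mem_nhds hx))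
    (ContMDiffOn.contMDiffAt hY (hU.mem_nhds hx)) ?_).contMDiffWithinAt
  simp

end SmoothOn

theorem SmoothFun.dir {X : ∀ x : M, Tan n x} {f : M → ℝ} {U : Set M} (hU : IsOpen U)
    (hf : SmoothFun n f U) (hX : SmoothOn X U) :
    SmoothFun n (fun x => dir f x (X x)) U := by
  have h1 := ContMDiffOn.contMDiffOn_tangentMapWithin (m := ∞) hf (by simp) hU.uniqueMDiffOn
  have h2 := h1.comp hX (fun x hx => hx)
  have h3 := (contMDiff_snd_tangentBundle_modelSpace ℝ 𝓘(ℝ, ℝ) (n := ∞)).comp_contMDiffOn h2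
  refine h3.congr fun x hx => ?_
  simp only [Function.comp, tangentMapWithin, mfderivWithin_of_isOpen hU hx]
  rfl

theorem IsSmoothOneForm.smoothFun {θ : ∀ x : M, Tan n x →L[ℝ] ℝ} (hθ : IsSmoothOneForm θ)
    {X : ∀ x : M, Tan n x} {U : Set M} (hX : SmoothOn X U) :
    SmoothFun n (fun x => θ x (X x)) U := by
  have h2 := ContMDiffOn.clm_bundle_apply (b := fun y : M => y) (F₂ := ℝ)
    (E₂ := Bundle.Trivial M ℝ) (ϕ := θ) (v := X) (hθ.contMDiffOn (s := U)) hX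
  intro x hx
  exact ((Bundle.contMDiffWithinAt_totalSpace).1 (h2 x hx)).2

theorem IsSmoothOneForm.dform_smooth {θ : ∀ x : M, Tan n x →L[ℝ] ℝ} (hθ : IsSmoothOneForm θ)
    {X Y : ∀ x : M, Tan n x} {U : Set M} (hU : IsOpen U) (hX : SmoothOn X U)
    (hY : SmoothOn Y U) : SmoothFun n (fun x => dform θ x (X x) (Y x)) U := by
  have h : SmoothFun n (fun x => cartan θ X Y x) U :=
    (((hθ.smoothFun hY).dir hU hX).sub ((hθ.smoothFun hX).dir hU hY)).sub
      (hθ.smoothFun (hX.bracket hU hY))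
  exact h.congr fun x hx => dform_apply hθ (hX.diffAt hU hx) (hY.diffAt hU hx)

/-- A vector field that is smooth near `x` agrees near `x` with a global smooth multiple of it. -/
theorem SmoothOn.exists_global [T2Space M] {X : ∀ x : M, Tan n x} {U : Set M} (hU : IsOpen U)
    (hX : SmoothOn X U) {x : M} (hx : x ∈ U) :
    ∃ f : M → ℝ, SmoothOn (fun y => f y • X y) Set.univ ∧ (∀ᶠ y in 𝓝 x, f y = 1) ∧
      ∀ y ∉ U, f y = 0 := by
  obtain ⟨f, -, hf⟩ := (SmoothBumpFunction.nhds_basis_tsupport (I := 𝓡 (4 * n + 3)) x).mem_iff.1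
    (hU.mem_nhds hx)
  refine ⟨f, ?_, f.eventuallyEq_one, fun y hy => image_eq_zero_of_notMem_tsupport fun h => hy (hf h)⟩
  exact (ContMDiffOn.smul_section_of_tsupport (f.contMDiff.contMDiffOn) hU hf hX).contMDiffOn

/-- Vectors extend to global smooth vector fields. -/
theorem exists_smooth_extension [T2Space M] {x : M} (v : Tan n x) :
    ∃ X : ∀ x : M, Tan n x, SmoothOn X Set.univ ∧ X x = v := by
  obtain ⟨s, hs, h⟩ := FiberBundle.exists_contMDiffOn_extend (k := ∞) (𝓡 (4 * n + 3)) (ModelE n) v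
  obtain ⟨U, hUs, hU, hxU⟩ := mem_nhds_iff.1 hs
  have h' : SmoothOn (FiberBundle.extend (ModelE n) v) U := h.mono hUs
  obtain ⟨f, hf, hf1, -⟩ := h'.exists_global hU hxU
  exact ⟨_, hf, by simp [hf1.self_of_nhds]⟩

/-- Around each point there is a smooth frame of the tangent bundle, and the coefficients of
smooth or differentiable vector fields are smooth or differentiable. -/
theorem exists_frame (x : M) : ∃ (U : Set M) (ι : Type) (_ : Fintype ι)
    (s : ι → ∀ y : M, Tan n y) (c : ι → ∀ y : M, Tan n y →ₗ[ℝ] ℝ), IsOpen U ∧ x ∈ U ∧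
    (∀ i, SmoothOn (s i) U) ∧
    (∀ y ∈ U, ∀ v : Tan n y, v = ∑ i, c i y v • s i y) ∧
    ∀ i (X : ∀ y : M, Tan n y), DiffAt X x → DiffFunAt n (fun y => c i y (X y)) x := by
  let t := trivializationAt (ModelE n) (TangentSpace (𝓡 (4 * n + 3)) : M → Type _) x
  have hx : x ∈ t.baseSet := FiberBundle.mem_baseSet_trivializationAt _ _ x
  let b := (EuclideanSpace.basisFun (Fin (4 * n + 3)) ℝ).toBasis
  refine ⟨t.baseSet, Fin (4 * n + 3), inferInstance, t.localFrame b,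
    t.localFrameCoeff (𝓡 (4 * n + 3)) b, t.open_baseSet, hx,
    fun i => t.contMDiffOn_localFrame_baseSet ∞ b i,
    fun y hy v => ?_, fun i X hX => mdifferentiableAt_localFrameCoeff b hx hX i⟩
  classical
  -- The expansion is a statement about sections; a single vector `v` enters as the section equal to
  -- `v` at `y` and zero elsewhere.
  have h := t.eq_sum_localFrameCoeff_smul (I := 𝓡 (4 * n + 3)) (s := Function.update (fun _ => 0) y v) (b := b) hy
  simpa using h

end Calculus

/-! ### Smooth fields of bilinear forms and endomorphisms. -/

section Tensors

variable {n : ℕ} {M : Type*} [TopologicalSpace M] [ChartedSpace (ModelE n) M]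
  [IsManifold (𝓡 (4 * n + 3)) ∞ M]

/-- A field of bilinear forms is smooth if it is smooth on smooth vector fields. -/
def IsSmoothForm (B : ∀ x : M, Tan n x →ₗ[ℝ] Tan n x →ₗ[ℝ] ℝ) : Prop :=
  ∀ U, IsOpen U → ∀ X Y : ∀ x : M, Tan n x, SmoothOn X U → SmoothOn Y U →
    SmoothFun n (fun x => B x (X x) (Y x)) U

/-- A field of endomorphisms is smooth if it preserves smooth vector fields. -/
def IsSmoothEnd (A : ∀ x : M, Tan n x →ₗ[ℝ] Tan n x) : Prop :=
  ∀ U, IsOpen U → ∀ X : ∀ x : M, Tan n x, SmoothOn X U → SmoothOn (fun x => A x (X x)) U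

/-- The axioms of a covariant derivative concern fields that are merely differentiable at a point,
while smoothness of a form is tested on smooth fields. Expanding both arguments in a smooth frame
bridges the gap. -/
theorem IsSmoothForm.diffAt {B : ∀ x : M, Tan n x →ₗ[ℝ] Tan n x →ₗ[ℝ] ℝ} (hB : IsSmoothForm B)
    {X Y : ∀ x : M, Tan n x} {x : M} (hX : DiffAt X x) (hY : DiffAt Y x) :
    DiffFunAt n (fun y => B y (X y) (Y y)) x := by
  obtain ⟨U, ι, _, s, c, hU, hx, hs, hc, hd⟩ := exists_frame (n := n) x
  have h : DiffFunAt n (fun y => ∑ i, ∑ j, c i y (Y y) * (c j y (X y) * B y (s j y) (s i y))) x := by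
    refine DiffFunAt.sum fun i _ => DiffFunAt.sum fun j _ => ?_
    exact (hd i Y hY).mul ((hd j X hX).mul ((hB U hU _ _ (hs j) (hs i)).diffAt hU hx))
  refine h.congr_of_eventuallyEq ?_
  filter_upwards [hU.mem_nhds hx] with y hy
  conv_lhs => rw [hc y hy (X y), hc y hy (Y y)]
  simp [Finset.mul_sum]

theorem IsSmoothEnd.diffAt {A : ∀ x : M, Tan n x →ₗ[ℝ] Tan n x} (hA : IsSmoothEnd A)
    {X : ∀ x : M, Tan n x} {x : M} (hX : DiffAt X x) :
    DiffAt (fun y => A y (X y)) x := by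
  obtain ⟨U, ι, _, s, c, hU, hx, hs, hc, hd⟩ := exists_frame (n := n) x
  have h : DiffAt (fun y => ∑ i, c i y (X y) • A y (s i y)) x :=
    MDifferentiableAt.sum_section fun i _ =>
      (hd i X hX).smul_section ((hA U hU _ (hs i)).diffAt hU hx)
  refine h.congr_of_eventuallyEq ?_
  filter_upwards [hU.mem_nhds hx] with y hy
  conv_lhs => rw [hc y hy (X y)]
  simp

/-- A field of endomorphisms that preserves smooth vector fields is a smooth section of the
endomorphism bundle. -/
theorem contMDiff_end_of_apply {A : ∀ x : M, Tan n x →L[ℝ] Tan n x}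
    (hA : IsSmoothEnd fun x => (A x : Tan n x →ₗ[ℝ] Tan n x)) :
    ContMDiff (𝓡 (4 * n + 3)) ((𝓡 (4 * n + 3)).prod 𝓘(ℝ, ModelE n →L[ℝ] ModelE n)) ∞
      (fun x => Bundle.TotalSpace.mk' (ModelE n →L[ℝ] ModelE n)
        (E := fun x : M => (Tan n x →L[ℝ] Tan n x)) x (A x)) := by
  intro x
  rw [contMDiffAt_hom_bundle]
  refine ⟨contMDiffAt_id, ?_⟩
  let t := trivializationAt (ModelE n) (TangentSpace (𝓡 (4 * n + 3)) : M → Type _) x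
  have hx : x ∈ t.baseSet := FiberBundle.mem_baseSet_trivializationAt _ _ x
  let b := (EuclideanSpace.basisFun (Fin (4 * n + 3)) ℝ).toBasis
  have h1 : ∀ i, ContMDiffAt (𝓡 (4 * n + 3)) 𝓘(ℝ, ModelE n) ∞
      (fun y => (t ⟨y, A y (t.localFrame b i y)⟩).2) x := by
    intro i
    have := hA t.baseSet t.open_baseSet _ (t.contMDiffOn_localFrame_baseSet ∞ b i)
    have := ContMDiffOn.contMDiffAt this (t.open_baseSet.mem_nhds hx)
    exact (Bundle.contMDiffAt_totalSpace.1 this).2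
  -- `φ i` sends a vector `w` to the map `v ↦ v_i w`; an endomorphism is the sum of the `φ i`
  -- applied to its columns.
  let φ : Fin (4 * n + 3) → (ModelE n →L[ℝ] (ModelE n →L[ℝ] ModelE n)) := fun i =>
    ContinuousLinearMap.smulRightL ℝ (ModelE n) (ModelE n) (EuclideanSpace.proj i)
  have h2 : ContMDiffAt (𝓡 (4 * n + 3)) 𝓘(ℝ, ModelE n →L[ℝ] ModelE n) ∞
      (fun y => ∑ i, φ i ((t ⟨y, A y (t.localFrame b i y)⟩).2)) x :=
    ContMDiffAt.sum fun i _ => (φ i).contMDiff.contMDiffAt.comp x (h1 i)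
  refine h2.congr_of_eventuallyEq ?_
  filter_upwards [t.open_baseSet.mem_nhds hx] with y hy
  refine ContinuousLinearMap.ext fun v => ?_
  simp only [φ, sum_apply]
  rw [ContinuousLinearMap.inCoordinates_eq hy hy]
  have hv : v = ∑ i, v i • b i := by simpa [b] using (b.sum_repr v).symm
  conv_lhs => rw [hv]
  rw [map_sum]
  refine Finset.sum_congr rfl fun i _ => ?_
  rw [map_smul]
  simp [t.localFrame_apply_of_mem_baseSet b hy, Bundle.Trivialization.basisAt, t]

end Tensors
end HyperCR

namespace HyperCR

/-! ### The exterior derivative as a bilinear form. -/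

section DForm

variable {n : ℕ} {M : Type*} [TopologicalSpace M] [ChartedSpace (ModelE n) M]
  [IsManifold (𝓡 (4 * n + 3)) ∞ M]

theorem dform_swap (θ : ∀ x : M, Tan n x →L[ℝ] ℝ) (x : M) (v w : Tan n x) :
    dform θ x v w = -dform θ x w v := cartan_swap ..

theorem dform_add_left {θ : ∀ x : M, Tan n x →L[ℝ] ℝ} (hθ : IsSmoothOneForm θ) (x : M)
    (v v' w : Tan n x) : dform θ x (v + v') w = dform θ x v w + dform θ x v' w := by
  have h := tensorialAt_cartan hθ (FiberBundle.extend (ModelE n) w) x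
  exact (TensorialAt.mkHom _ x h).map_add v v'

theorem dform_smul_left {θ : ∀ x : M, Tan n x →L[ℝ] ℝ} (hθ : IsSmoothOneForm θ) (x : M)
    (c : ℝ) (v w : Tan n x) : dform θ x (c • v) w = c * dform θ x v w := by
  have h := tensorialAt_cartan hθ (FiberBundle.extend (ModelE n) w) x
  exact (TensorialAt.mkHom _ x h).map_smul c v

/-- The exterior derivative of a smooth one-form as a bilinear map. -/
def dlin {θ : ∀ x : M, Tan n x →L[ℝ] ℝ} (hθ : IsSmoothOneForm θ) (x : M) :
    Tan n x →ₗ[ℝ] Tan n x →ₗ[ℝ] ℝ :=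
  LinearMap.mk₂ ℝ (dform θ x) (dform_add_left hθ x) (fun c v w => dform_smul_left hθ x c v w)
    (fun v w w' => by
      rw [dform_swap, dform_add_left hθ, dform_swap θ x v w, dform_swap θ x v w']; ring)
    (fun c v w => by
      rw [dform_swap, dform_smul_left hθ, dform_swap θ x v w]; simp)

theorem dlin_apply {θ : ∀ x : M, Tan n x →L[ℝ] ℝ} (hθ : IsSmoothOneForm θ) (x : M)
    (v w : Tan n x) : dlin hθ x v w = dform θ x v w := rfl

end DForm

namespace HyperPseudohermitian

variable {n : ℕ} {M : Type*} [TopologicalSpace M] [ChartedSpace (ModelE n) M]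
  [IsManifold (𝓡 (4 * n + 3)) ∞ M] (S : HyperPseudohermitian n M)

/-! ### The quaternionic structure on `Q` -/

theorem mem_Q_iff {x : M} {v : Tan n x} : v ∈ S.Q x ↔ ∀ a, S.θ a x v = 0 := by
  simp only [AlmostHyperCR.Q, Submodule.mem_inf, Fin.forall_fin_succ, S.compatible.ker]
  simp [and_assoc]

theorem Q_le (a : Fin 3) (x : M) : S.Q x ≤ S.Qa a x := fun v hv => by
  rw [← S.compatible.ker]
  exact (S.mem_Q_iff.1 hv) a

theorem I_sq_zero {x : M} {v : Tan n x} (hv : v ∈ S.Qa 0 x) : S.I 0 x (S.I 0 x v) = -v :=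
  S.almostCR_one.sq x v hv

theorem I_sq_one {x : M} {v : Tan n x} (hv : v ∈ S.Qa 1 x) : S.I 1 x (S.I 1 x v) = -v :=
  S.almostCR_two.sq x v hv

/-- Compatibility rotates the pair `(θ₂, θ₃)`: it gives `θ₃(Iv) = θ₂(v)`, and, applied to `Iv`, also
`θ₂(Iv) = -θ₃(v)`. Both right-hand sides vanish on `Q`. -/
theorem I_zero_mem {x : M} {v : Tan n x} (hv : v ∈ S.Q x) : S.I 0 x v ∈ S.Q x := by
  have h0 := S.Q_le 0 x hv
  have h := S.mem_Q_iff.1 hv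
  have hm := S.almostCR_one.mapsTo x v h0
  rw [S.mem_Q_iff]
  have e1 := S.compatible.comp 0 x v h0
  have e2 := S.compatible.comp 0 x _ hm
  rw [S.I_sq_zero h0] at e2
  intro a
  fin_cases a
  · exact (S.compatible.ker 0 x _).2 hm
  · simpa [h 2] using e2.symm
  · simpa [h 1] using e1

theorem I_one_mem {x : M} {v : Tan n x} (hv : v ∈ S.Q x) : S.I 1 x v ∈ S.Q x := by
  have h0 := S.Q_le 1 x hv
  have h := S.mem_Q_iff.1 hv
  have hm := S.almostCR_two.mapsTo x v h0
  rw [S.mem_Q_iff]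
  have e1 := S.compatible.comp 1 x v h0
  have e2 := S.compatible.comp 1 x _ hm
  rw [S.I_sq_one h0] at e2
  intro a
  fin_cases a
  · simpa [h 2] using e1
  · exact (S.compatible.ker 1 x _).2 hm
  · simpa [h 0] using e2.symm

theorem Q_le_inf (x : M) : S.Q x ≤ S.Qa 0 x ⊓ S.Qa 1 x := inf_le_left

theorem mem_map_zero {x : M} {v : Tan n x} (hv : v ∈ S.Q x) :
    v ∈ (S.Qa 0 x ⊓ S.Qa 1 x).map (S.I 0 x) :=
  ⟨-S.I 0 x v, neg_mem (S.Q_le_inf x (S.I_zero_mem hv)), by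
    rw [map_neg, S.I_sq_zero (S.Q_le 0 x hv), neg_neg]⟩

theorem mem_map_one {x : M} {v : Tan n x} (hv : v ∈ S.Q x) :
    v ∈ (S.Qa 0 x ⊓ S.Qa 1 x).map (S.I 1 x) :=
  ⟨-S.I 1 x v, neg_mem (S.Q_le_inf x (S.I_one_mem hv)), by
    rw [map_neg, S.I_sq_one (S.Q_le 1 x hv), neg_neg]⟩

/-- Since `I` and `J` preserve `Q`, it lies in both `I(Q₁ ∩ Q₂)` and `J(Q₁ ∩ Q₂)`. So both
prescriptions for `K` apply there, and all quaternion relations on `Q` follow from `K = IJ = -JI`.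
-/
theorem I_two_eq {x : M} {v : Tan n x} (hv : v ∈ S.Q x) : S.I 2 x v = S.I 0 x (S.I 1 x v) :=
  S.third_right x v (S.mem_map_one hv)

theorem I_mem (a : Fin 3) {x : M} {v : Tan n x} (hv : v ∈ S.Q x) : S.I a x v ∈ S.Q x := by
  fin_cases a
  · exact S.I_zero_mem hv
  · exact S.I_one_mem hv
  · simpa [S.I_two_eq hv] using S.I_zero_mem (S.I_one_mem hv)

theorem I_one_zero {x : M} {v : Tan n x} (hv : v ∈ S.Q x) :
    S.I 1 x (S.I 0 x v) = -S.I 2 x v := by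
  rw [S.third_left x v (S.mem_map_zero hv), neg_neg]

theorem I_one_two {x : M} {v : Tan n x} (hv : v ∈ S.Q x) :
    S.I 1 x (S.I 2 x v) = S.I 0 x v := by
  rw [S.I_two_eq hv, S.I_one_zero (S.I_one_mem hv), S.I_two_eq (S.I_one_mem hv),
    S.I_sq_one (S.Q_le 1 x hv), map_neg, neg_neg]

theorem I_sq (a : Fin 3) {x : M} {v : Tan n x} (hv : v ∈ S.Q x) :
    S.I a x (S.I a x v) = -v := by
  fin_cases a
  · exact S.I_sq_zero (S.Q_le 0 x hv)
  · exact S.I_sq_one (S.Q_le 1 x hv)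
  · change S.I 2 x (S.I 2 x v) = -v
    rw [S.I_two_eq (S.I_mem 2 hv), S.I_one_two hv, S.I_sq_zero (S.Q_le 0 x hv)]

theorem I_mul (a : Fin 3) {x : M} {v : Tan n x} (hv : v ∈ S.Q x) :
    S.I a x (S.I (a + 1) x v) = S.I (a + 2) x v := by
  fin_cases a
  · exact (S.I_two_eq hv).symm
  · exact S.I_one_two hv
  · change S.I 2 x (S.I 0 x v) = S.I 1 x v
    rw [S.I_two_eq (S.I_mem 0 hv), S.I_one_zero hv, S.I_two_eq hv, map_neg,
      S.I_sq 0 (S.I_mem 1 hv), neg_neg]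

theorem I_mul_rev (a : Fin 3) {x : M} {v : Tan n x} (hv : v ∈ S.Q x) :
    S.I (a + 1) x (S.I a x v) = -S.I (a + 2) x v := by
  fin_cases a
  · exact S.I_one_zero hv
  · change S.I 2 x (S.I 1 x v) = -S.I 0 x v
    rw [S.I_two_eq (S.I_mem 1 hv), S.I_sq 1 hv, map_neg]
  · change S.I 0 x (S.I 2 x v) = -S.I 1 x v
    rw [S.I_two_eq hv, S.I_sq 0 (S.I_mem 1 hv)]

/-! ### Normalized admissible triples -/

/-- Each one-form `θ_a` is non-zero on `Q_{a+2}`, for `a = 1`. -/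
theorem exists_mem_theta_ne (x : M) : ∃ v ∈ S.Qa 0 x, S.θ 1 x v ≠ 0 := by
  by_contra! h
  have h0 : S.Qa 0 x ≤ S.Qa 1 x := fun v hv => (S.compatible.ker 1 x v).1 (h v hv)
  have h1 : S.Qa 1 x = ⊤ := by simpa [sup_eq_right.2 h0] using S.transversal x
  have h2 := S.almostCR_two.subbundle.1 x
  rw [h1, finrank_top] at h2
  have h3 : Module.finrank ℝ (Tan n x) = 4 * n + 3 := by
    change Module.finrank ℝ (ModelE n) = _
    simp
  omega

/-- A normalized admissible triple. -/
structure IsNormalized (T : Fin 3 → ∀ x : M, Tan n x) : Prop where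
  triple : S.IsAdmissibleTriple T
  norm : ∀ a x, S.θ a x (T a x) = 1

/-- A vector field in `Q₁ ∩ Q₂` with `θ₃ = 1` determines a normalized admissible triple. -/
theorem isNormalized_of_third {T : ∀ x : M, Tan n x} (hT : SmoothOn T Set.univ)
    (h0 : ∀ x, S.θ 0 x (T x) = 0) (h1 : ∀ x, S.θ 1 x (T x) = 0) (h2 : ∀ x, S.θ 2 x (T x) = 1) :
    S.IsNormalized ![fun x => S.I 1 x (T x), fun x => -S.I 0 x (T x), T] := by
  have m0 : ∀ x, T x ∈ S.Qa 0 x := fun x => (S.compatible.ker 0 x _).1 (h0 x)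
  have m1 : ∀ x, T x ∈ S.Qa 1 x := fun x => (S.compatible.ker 1 x _).1 (h1 x)
  have n0 : ∀ x, S.I 0 x (T x) ∈ S.Qa 0 x := fun x => S.almostCR_one.mapsTo x _ (m0 x)
  have n1 : ∀ x, S.I 1 x (T x) ∈ S.Qa 1 x := fun x => S.almostCR_two.mapsTo x _ (m1 x)
  have e1 : ∀ x, S.θ 1 x (S.I 0 x (T x)) = -1 := fun x => by
    have := S.compatible.comp 0 x _ (n0 x)
    rw [S.I_sq_zero (m0 x)] at this
    simpa [h2] using this.symm
  have e2 : ∀ x, S.θ 2 x (S.I 0 x (T x)) = 0 := fun x => by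
    have := S.compatible.comp 0 x _ (m0 x)
    simpa [h1] using this
  have e3 : ∀ x, S.θ 0 x (S.I 1 x (T x)) = 1 := fun x => by
    have := S.compatible.comp 1 x _ (m1 x)
    simpa [h2] using this
  have e4 : ∀ x, S.θ 2 x (S.I 1 x (T x)) = 0 := fun x => by
    have := S.compatible.comp 1 x _ (n1 x)
    rw [S.I_sq_one (m1 x)] at this
    simpa [h0] using this.symm
  have nn : ∀ a x, S.θ a x ((![fun x => S.I 1 x (T x), fun x => -S.I 0 x (T x), T] :
      Fin 3 → ∀ x : M, Tan n x) a x) = 1 := by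
    intro a x
    fin_cases a
    · exact e3 x
    · change S.θ 1 x (-S.I 0 x (T x)) = 1
      simp [e1]
    · exact h2 x
  refine ⟨⟨?_, ?_, ?_, ?_⟩, nn⟩
  · intro a
    fin_cases a
    · exact (S.almostCR_two.smooth T ⟨hT, m1⟩).1
    · exact (S.almostCR_one.smooth T ⟨hT, m0⟩).1.neg
    · exact hT
  · intro a x h
    have := S.mem_Q_iff.1 h a
    rw [nn] at this
    exact one_ne_zero this
  · intro a x
    simp only [Submodule.mem_inf, ← S.compatible.ker]
    fin_cases a
    · exact ⟨(S.compatible.ker 1 x _).2 (n1 x), e4 x⟩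
    · change S.θ 2 x (-S.I 0 x (T x)) = 0 ∧ S.θ 0 x (-S.I 0 x (T x)) = 0
      simpa [e2] using (S.compatible.ker 0 x _).2 (n0 x)
    · exact ⟨h0 x, h1 x⟩
  · intro a x
    fin_cases a
    · change S.I 0 x (-S.I 0 x (T x)) = T x
      rw [map_neg, S.I_sq_zero (m0 x), neg_neg]
    · rfl
    · change S.I 2 x (S.I 1 x (T x)) = -S.I 0 x (T x)
      have m : S.I 1 x (T x) ∈ (S.Qa 0 x ⊓ S.Qa 1 x).map (S.I 1 x) :=
        ⟨T x, ⟨m0 x, m1 x⟩, rfl⟩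
      rw [S.third_right x _ m, S.I_sq_one (m1 x), map_neg]

/-- Around each point there is a smooth vector field in `Q₁ ∩ Q₂` with `θ₃ = 1`. -/
theorem exists_local_third (x : M) : ∃ U, IsOpen U ∧ x ∈ U ∧ ∃ T : ∀ x : M, Tan n x,
    SmoothOn T U ∧ ∀ y ∈ U, S.θ 0 y (T y) = 0 ∧ S.θ 1 y (T y) = 0 ∧ S.θ 2 y (T y) = 1 := by
  obtain ⟨v, hv, hv1⟩ := S.exists_mem_theta_ne x
  obtain ⟨V, hV, rfl⟩ := S.almostCR_one.subbundle.2 x v hv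
  have hIV := S.almostCR_one.smooth V hV
  have s1 := (S.compatible.smooth 1).smoothFun hV.1
  have s2 := (S.compatible.smooth 2).smoothFun hV.1
  set s : M → ℝ := fun y => S.θ 1 y (V y) with hs
  set t : M → ℝ := fun y => S.θ 2 y (V y) with ht
  have hd : SmoothFun n (fun y => s y * s y + t y * t y) Set.univ := (s1.mul s1).add (s2.mul s2)
  let U : Set M := {y | s y ≠ 0}
  have hU : IsOpen U := isOpen_ne.preimage (continuousOn_univ.1 s1.continuousOn)
  have hpos : ∀ y ∈ U, s y * s y + t y * t y ≠ 0 := fun y (hy : s y ≠ 0) =>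
    (add_pos_of_pos_of_nonneg (mul_self_pos.2 hy) (mul_self_nonneg _)).ne'
  have sub : U ⊆ Set.univ := Set.subset_univ _
  -- On the plane spanned by `V` and `IV` the pair `(θ₂, θ₃)` takes the values `(s, t)` and `(-t,
  -- s)`. Solving `(θ₂, θ₃) = (0, 1)` there gives the coefficients `t` and `s` over `s² + t²`.
  refine ⟨U, hU, hv1, fun y => (t y / (s y * s y + t y * t y)) • V y +
    (s y / (s y * s y + t y * t y)) • S.I 0 y (V y), ?_, fun y hy => ?_⟩
  · exact (SmoothOn.smul ((s2.mono sub).div (hd.mono sub) hpos) (hV.1.mono sub)).add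
      (SmoothOn.smul ((s1.mono sub).div (hd.mono sub) hpos) (hIV.1.mono sub))
  have f0 : S.θ 0 y (V y) = 0 := (S.compatible.ker 0 y _).2 (hV.2 y)
  have f0' : S.θ 0 y (S.I 0 y (V y)) = 0 := (S.compatible.ker 0 y _).2 (hIV.2 y)
  have f1 : S.θ 1 y (S.I 0 y (V y)) = -t y := by
    have := S.compatible.comp 0 y _ (hIV.2 y)
    rw [S.I_sq_zero (hV.2 y)] at this
    simpa using this.symm
  have f2 : S.θ 2 y (S.I 0 y (V y)) = s y := S.compatible.comp 0 y _ (hV.2 y)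
  have g1 : S.θ 1 y (V y) = s y := rfl
  have g2 : S.θ 2 y (V y) = t y := rfl
  have := hpos y hy
  simp only [map_add, map_smul, f0, f0', f1, f2, g1, g2, smul_eq_mul]
  refine ⟨by simp, by field_simp; ring, ?_⟩
  rw [div_mul_eq_mul_div, div_mul_eq_mul_div, ← add_div, div_eq_one_iff_eq this]
  ring

theorem exists_isNormalized [T2Space M] [SecondCountableTopology M] :
    ∃ T, S.IsNormalized T := by
  have : LocallyCompactSpace M := Manifold.locallyCompact_of_finiteDimensional (𝓡 (4 * n + 3))
  -- The conditions on the third field are affine in each fibre, so local solutions can be averaged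
  -- by a partition of unity.
  obtain ⟨T, hT⟩ := exists_contMDiffSection_forall_mem_convex_of_local (n := ⊤) (𝓡 (4 * n + 3))
    (F_fiber := ModelE n) (TangentSpace (𝓡 (4 * n + 3)) : M → Type _)
    (fun x => {v | S.θ 0 x v = 0 ∧ S.θ 1 x v = 0 ∧ S.θ 2 x v = 1}) (fun x => by
      rintro v ⟨h0, h1, h2⟩ w ⟨k0, k1, k2⟩ a b - - hab
      simp [h0, h1, h2, k0, k1, k2, hab])
    (fun x => by
      obtain ⟨U, hU, hx, T, hT, h⟩ := S.exists_local_third x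
      exact ⟨U, hU.mem_nhds hx, T, hT, h⟩)
  exact ⟨_, S.isNormalized_of_third (T := T) T.contMDiff.contMDiffOn (fun x => (hT x).1)
    (fun x => (hT x).2.1) (fun x => (hT x).2.2)⟩

end HyperPseudohermitian
end HyperCR

namespace HyperCR

namespace HyperPseudohermitian

variable {n : ℕ} {M : Type*} [TopologicalSpace M] [ChartedSpace (ModelE n) M]
  [IsManifold (𝓡 (4 * n + 3)) ∞ M] (S : HyperPseudohermitian n M)

/-! ### The splitting defined by a normalized triple -/

variable {S} {T T' : Fin 3 → ∀ x : M, Tan n x}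

theorem IsNormalized.theta_apply (hT : S.IsNormalized T) (a b : Fin 3) (x : M) :
    S.θ a x (T b x) = if a = b then 1 else 0 := by
  have h1 := (S.compatible.ker _ x _).2 (hT.triple.mem b x).1
  have h2 := (S.compatible.ker _ x _).2 (hT.triple.mem b x).2
  have h3 := hT.norm b x
  have h : ∀ a b : Fin 3, a = b ∨ a = b + 1 ∨ a = b + 2 := by decide
  have n1 : ∀ b : Fin 3, b + 1 ≠ b := by decide
  have n2 : ∀ b : Fin 3, b + 2 ≠ b := by decide
  rcases h a b with rfl | rfl | rfl
  · simp [h3]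
  · simp [h1, n1]
  · simp [h2, n2]

variable (S) in
/-- The projection to `Q` along the plane field of a normalized triple. -/
def proj (T : Fin 3 → ∀ x : M, Tan n x) (x : M) : Tan n x →ₗ[ℝ] Tan n x :=
  LinearMap.id - ∑ a, ((S.θ a x : Tan n x →ₗ[ℝ] ℝ)).smulRight (T a x)

theorem proj_apply (T : Fin 3 → ∀ x : M, Tan n x) (x : M) (v : Tan n x) :
    S.proj T x v = v - ∑ a, S.θ a x v • T a x := by
  simp [proj]

theorem proj_of_mem (T : Fin 3 → ∀ x : M, Tan n x) {x : M} {v : Tan n x} (hv : v ∈ S.Q x) :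
    S.proj T x v = v := by
  simp [proj_apply, S.mem_Q_iff.1 hv]

namespace IsNormalized

theorem proj_mem (hT : S.IsNormalized T) (x : M) (v : Tan n x) : S.proj T x v ∈ S.Q x := by
  rw [S.mem_Q_iff]
  intro a
  simp [proj_apply, hT.theta_apply]

theorem proj_T (hT : S.IsNormalized T) (a : Fin 3) (x : M) : S.proj T x (T a x) = 0 := by
  simp [proj_apply, hT.theta_apply]

theorem proj_smooth (hT : S.IsNormalized T) : IsSmoothEnd (S.proj T) := by
  intro U hU X hX
  simp only [proj_apply]
  exact hX.sub (SmoothOn.sum fun a _ => SmoothOn.smul ((S.compatible.smooth a).smoothFun hX)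
    ((hT.triple.smooth a).mono (Set.subset_univ _)))

theorem mem_planeField (hT : S.IsNormalized T) {x : M} {v : Tan n x} :
    v ∈ AlmostHyperCR.planeField T x ↔ S.proj T x v = 0 := by
  constructor
  · intro h
    induction h using Submodule.span_induction with
    | mem v hv => obtain ⟨a, rfl⟩ := hv; exact hT.proj_T a x
    | zero => simp
    | add v w _ _ hv hw => simp [hv, hw]
    | smul c v _ hv => simp [hv]
  · intro h
    rw [proj_apply, sub_eq_zero] at h
    rw [h]
    exact Submodule.sum_mem _ fun a _ => Submodule.smul_mem _ _
      (Submodule.subset_span ⟨a, rfl⟩)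

theorem sub_proj_mem (hT : S.IsNormalized T) (x : M) (v : Tan n x) :
    v - S.proj T x v ∈ AlmostHyperCR.planeField T x := by
  rw [hT.mem_planeField, map_sub, proj_of_mem T (hT.proj_mem x v), sub_self]

theorem isCompl (hT : S.IsNormalized T) (x : M) :
    IsCompl (S.Q x) (AlmostHyperCR.planeField T x) := by
  refine ⟨?_, ?_⟩
  · rw [Submodule.disjoint_def]
    intro v hv hv'
    rw [hT.mem_planeField, proj_of_mem T hv] at hv'
    exact hv'
  · rw [codisjoint_iff, eq_top_iff]
    intro v _
    rw [← add_sub_cancel (S.proj T x v) v]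
    exact Submodule.add_mem_sup (hT.proj_mem x v) (hT.sub_proj_mem x v)

theorem component_Q (hT : S.IsNormalized T) (x : M) (v : Tan n x) :
    component (S.Q x) (AlmostHyperCR.planeField T x) v = S.proj T x v := by
  rw [component, dif_pos (hT.isCompl x)]
  conv_lhs => rw [← add_sub_cancel (S.proj T x v) v, map_add]
  rw [Submodule.projectionOnto_apply_of_mem_left _ (hT.proj_mem x v),
    (Submodule.projectionOnto_apply_eq_zero_iff _).2 (hT.sub_proj_mem x v), add_zero]

theorem component_P (hT : S.IsNormalized T) (x : M) (v : Tan n x) :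
    component (AlmostHyperCR.planeField T x) (S.Q x) v = v - S.proj T x v := by
  rw [component, dif_pos (hT.isCompl x).symm]
  conv_lhs => rw [← add_sub_cancel (S.proj T x v) v, map_add]
  rw [Submodule.projectionOnto_apply_of_mem_left _ (hT.sub_proj_mem x v),
    (Submodule.projectionOnto_apply_eq_zero_iff _).2 (hT.proj_mem x v), zero_add]

/-- Each vector of `Q` extends to a global section of `Q`. -/
theorem exists_section [T2Space M] (hT : S.IsNormalized T) {x : M} {v : Tan n x}
    (hv : v ∈ S.Q x) : ∃ X, IsSection S.Q X ∧ X x = v := by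
  obtain ⟨X, hX, rfl⟩ := exists_smooth_extension v
  exact ⟨fun y => S.proj T y (X y), ⟨hT.proj_smooth _ isOpen_univ X hX, fun y => hT.proj_mem y _⟩,
    proj_of_mem T hv⟩

end IsNormalized

/-- The relations `I_a T_b = T_c` and compatibility force the three functions `θ_a(T_a)` to
coincide. Transversality to `Q` makes the common function nowhere zero, so it can be divided out. -/
theorem exists_isNormalized_of_isAdmissible {P : ∀ x : M, Submodule ℝ (Tan n x)}
    (hP : S.IsAdmissible P) : ∃ T, S.IsNormalized T ∧ P = AlmostHyperCR.planeField T := by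
  obtain ⟨T, hT, rfl⟩ := hP
  have hstep : ∀ a x, S.θ (a + 2) x (T (a + 2) x) = S.θ (a + 1) x (T (a + 1) x) := by
    intro a x
    rw [← hT.cyclic a x]
    refine S.compatible.comp a x _ ?_
    have := (hT.mem (a + 1) x).2
    rwa [add_assoc, show (1 : Fin 3) + 2 = 0 from rfl, add_zero] at this
  have hall : ∀ a x, S.θ a x (T a x) = S.θ 0 x (T 0 x) := by
    intro a x
    fin_cases a
    · rfl
    · exact hstep 2 x
    · exact (hstep 0 x).trans (hstep 2 x)
  have hne : ∀ x, S.θ 0 x (T 0 x) ≠ 0 := by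
    intro x h
    refine hT.transverse 0 x (S.mem_Q_iff.2 fun a => ?_)
    have h1 := (S.compatible.ker _ x _).2 (hT.mem 0 x).1
    have h2 := (S.compatible.ker _ x _).2 (hT.mem 0 x).2
    fin_cases a
    · exact h
    · exact h1
    · exact h2
  refine ⟨fun a x => (S.θ 0 x (T 0 x))⁻¹ • T a x, ⟨⟨?_, ?_, ?_, ?_⟩, ?_⟩, ?_⟩
  · exact fun a => SmoothOn.smul (((S.compatible.smooth 0).smoothFun (hT.smooth 0)).inv
      fun x _ => hne x) (hT.smooth a)
  · intro a x h
    exact hT.transverse a x ((Submodule.smul_mem_iff _ (inv_ne_zero (hne x))).1 h)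
  · exact fun a x => Submodule.smul_mem _ _ (hT.mem a x)
  · intro a x
    rw [map_smul, hT.cyclic]
  · intro a x
    rw [map_smul, smul_eq_mul, hall a x, inv_mul_cancel₀ (hne x)]
  · funext x
    refine le_antisymm (Submodule.span_le.2 ?_) (Submodule.span_le.2 ?_)
    · rintro _ ⟨a, rfl⟩
      refine (Submodule.smul_mem_iff _ (inv_ne_zero (hne x))).1 ?_
      exact Submodule.subset_span ⟨a, rfl⟩
    · rintro _ ⟨a, rfl⟩
      exact Submodule.smul_mem _ _ (Submodule.subset_span ⟨a, rfl⟩)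

/-! ### The Levi form -/

section Levi

theorem dform_section (a : Fin 3) {X Y : ∀ x : M, Tan n x} (hX : IsSection S.Q X)
    (hY : IsSection S.Q Y) (x : M) :
    dform (S.θ a) x (X x) (Y x) = -S.θ a x (brak X Y x) := by
  have h1 : (fun y => S.θ a y (X y)) = fun _ => 0 := funext fun y => S.mem_Q_iff.1 (hX.2 y) a
  have h2 : (fun y => S.θ a y (Y y)) = fun _ => 0 := funext fun y => S.mem_Q_iff.1 (hY.2 y) a
  rw [dform_apply (S.compatible.smooth a) (hX.1.diffAt isOpen_univ (Set.mem_univ x))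
    (hY.1.diffAt isOpen_univ (Set.mem_univ x)), cartan, h1, h2]
  simp [mvfderiv_const]

variable (S) in
theorem I_section (a : Fin 3) {X : ∀ x : M, Tan n x} (hX : IsSection S.Q X) :
    IsSection S.Q (fun x => S.I a x (X x)) := by
  refine ⟨?_, fun x => S.I_mem a (hX.2 x)⟩
  have h1 : ∀ {X : ∀ x : M, Tan n x}, IsSection S.Q X →
      SmoothOn (fun x => S.I 0 x (X x)) Set.univ := fun hX =>
    (S.almostCR_one.smooth _ ⟨hX.1, fun x => S.Q_le 0 x (hX.2 x)⟩).1
  have h2 : SmoothOn (fun x => S.I 1 x (X x)) Set.univ :=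
    (S.almostCR_two.smooth X ⟨hX.1, fun x => S.Q_le 1 x (hX.2 x)⟩).1
  fin_cases a
  · exact h1 hX
  · exact h2
  · exact (h1 ⟨h2, fun x => S.I_mem 1 (hX.2 x)⟩).congr fun x _ => S.I_two_eq (hX.2 x)

/-- The complex structures are only known to preserve global smooth sections. A local field is
therefore first multiplied by a bump function, which changes nothing near the given point. -/
theorem IsNormalized.I_proj_smooth [T2Space M] (hT : S.IsNormalized T) (a : Fin 3) :
    IsSmoothEnd (fun x => S.I a x ∘ₗ S.proj T x) := by
  intro U hU X hX
  refine SmoothOn.of_locally fun x hx => ?_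
  have hp := hT.proj_smooth U hU X hX
  obtain ⟨f, hf, hf1, -⟩ := hp.exists_global hU hx
  obtain ⟨V, hV1, hV, hxV⟩ := eventually_nhds_iff.1 hf1
  refine ⟨V, hV, hxV, ?_⟩
  have h := S.I_section a ⟨hf, fun y => Submodule.smul_mem _ _ (hT.proj_mem y _)⟩
  exact (h.1.mono (Set.subset_univ V)).congr fun y hy => by simp [hV1 y hy]

theorem IsNormalized.dform_I [T2Space M] (hT : S.IsNormalized T) (a : Fin 3) {x : M}
    {v w : Tan n x} (hv : v ∈ S.Q x) (hw : w ∈ S.Q x) :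
    dform (S.θ a) x (S.I a x v) (S.I a x w) = dform (S.θ a) x v w := by
  obtain ⟨X, hX, rfl⟩ := hT.exists_section hv
  obtain ⟨Y, hY, rfl⟩ := hT.exists_section hw
  have h := (S.compatible.ker a x _).2 (S.integrable a X Y hX hY x).1
  rw [map_sub, sub_eq_zero] at h
  rw [dform_section a (S.I_section a hX) (S.I_section a hY), dform_section a hX hY, brak, ← h]

/-- This is the `θ_{a+2}`-component of the second integrability condition, rewritten with `θ_{a+2} ∘
I_a = θ_{a+1}` on `Q_a`. -/
theorem IsNormalized.dform_mixed [T2Space M] (hT : S.IsNormalized T) (a : Fin 3) {x : M}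
    {v w : Tan n x} (hv : v ∈ S.Q x) (hw : w ∈ S.Q x) :
    dform (S.θ (a + 1)) x v w - dform (S.θ (a + 1)) x (S.I a x v) (S.I a x w)
      = dform (S.θ (a + 2)) x v (S.I a x w) + dform (S.θ (a + 2)) x (S.I a x v) w := by
  obtain ⟨X, hX, rfl⟩ := hT.exists_section hv
  obtain ⟨Y, hY, rfl⟩ := hT.exists_section hw
  obtain ⟨h1, h2⟩ := S.integrable a X Y hX hY x
  have h3 := S.compatible.comp a x _ h1
  have h4 := S.mem_Q_iff.1 h2 (a + 2)
  rw [map_sub, map_sub, h3, map_sub] at h4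
  rw [dform_section _ (S.I_section a hX) (S.I_section a hY), dform_section _ hX hY,
    dform_section _ hX (S.I_section a hY), dform_section _ (S.I_section a hX) hY]
  simp only [brak]
  linarith

theorem dform_neg_left (a : Fin 3) (x : M) (v w : Tan n x) :
    dform (S.θ a) x (-v) w = -dform (S.θ a) x v w := by
  simp only [← dlin_apply (S.compatible.smooth a), map_neg, LinearMap.neg_apply]

theorem dform_neg_right (a : Fin 3) (x : M) (v w : Tan n x) :
    dform (S.θ a) x v (-w) = -dform (S.θ a) x v w := by
  simp only [← dlin_apply (S.compatible.smooth a), map_neg]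

variable (S) in
/-- The form `dθ_a(v, I_a w)`. -/
def beta (a : Fin 3) (x : M) (v w : Tan n x) : ℝ := dform (S.θ a) x v (S.I a x w)

theorem IsNormalized.beta_symm [T2Space M] (hT : S.IsNormalized T) (a : Fin 3) {x : M}
    {v w : Tan n x} (hv : v ∈ S.Q x) (hw : w ∈ S.Q x) : S.beta a x v w = S.beta a x w v := by
  rw [beta, ← hT.dform_I a hv (S.I_mem a hw), S.I_sq a hw, dform_neg_right, ← dform_swap, beta]

theorem IsNormalized.beta_I [T2Space M] (hT : S.IsNormalized T) (a : Fin 3) {x : M}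
    {v w : Tan n x} (hv : v ∈ S.Q x) (hw : w ∈ S.Q x) :
    S.beta a x (S.I a x v) (S.I a x w) = S.beta a x v w :=
  hT.dform_I a hv (S.I_mem a hw)

/-- Substituting `I_{a+1} w` for `w` in `dform_mixed` turns it into an equality of `I_a`-averages of
two of the forms. This is what makes the Levi form independent of the index used to define it. -/
theorem IsNormalized.beta_mixed [T2Space M] (hT : S.IsNormalized T) (a : Fin 3) {x : M}
    {v w : Tan n x} (hv : v ∈ S.Q x) (hw : w ∈ S.Q x) :
    S.beta (a + 1) x v w + S.beta (a + 1) x (S.I a x v) (S.I a x w)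
      = S.beta (a + 2) x v w + S.beta (a + 2) x (S.I a x v) (S.I a x w) := by
  have h := hT.dform_mixed a hv (S.I_mem (a + 1) hw)
  have e0 : ∀ a : Fin 3, a + 2 + 1 = a ∧ a + 2 + 2 = a + 1 := by decide
  have h1 := S.I_mul (a + 2) hw
  rw [(e0 a).1, (e0 a).2] at h1
  have e1 : dform (S.θ (a + 1)) x (S.I a x v) (S.I a x (S.I (a + 1) x w))
      = -dform (S.θ (a + 1)) x (S.I a x v) (S.I (a + 1) x (S.I a x w)) := by
    rw [S.I_mul a hw, S.I_mul_rev a hw, dform_neg_right, neg_neg]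
  rw [e1, S.I_mul a hw] at h
  simp only [beta, h1]
  linarith

theorem IsNormalized.beta_I_add_two [T2Space M] (hT : S.IsNormalized T) (a : Fin 3) {x : M}
    {v w : Tan n x} (hv : v ∈ S.Q x) (hw : w ∈ S.Q x) :
    S.beta a x (S.I (a + 2) x v) (S.I (a + 2) x w)
      = S.beta a x (S.I (a + 1) x v) (S.I (a + 1) x w) := by
  rw [← S.I_mul a hv, ← S.I_mul a hw, hT.beta_I a (S.I_mem _ hv) (S.I_mem _ hw)]

variable (S) in
theorem levi_eq_zero_one {x : M} {v w : Tan n x} (hw : w ∈ S.Q x) :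
    2 * S.levi S.θ x v w = S.beta 0 x v w + S.beta 0 x (S.I 1 x v) (S.I 1 x w) := by
  have h := S.I_mul 0 hw
  simp only [Fin.isValue, zero_add] at h
  rw [AlmostHyperCR.levi, beta, beta, h]
  ring

/-- The Levi form is the part of `dθ_a(v, I_a w)` that is invariant under `I_{a+1}`. -/
theorem IsNormalized.levi_eq_add_one [T2Space M] (hT : S.IsNormalized T) (a : Fin 3) {x : M}
    {v w : Tan n x} (hv : v ∈ S.Q x) (hw : w ∈ S.Q x) :
    2 * S.levi S.θ x v w
      = S.beta a x v w + S.beta a x (S.I (a + 1) x v) (S.I (a + 1) x w) := by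
  have h0 := S.levi_eq_zero_one (v := v) hw
  -- `h1` compares the `J`-averages of the third and first forms, `h2` the `I`-averages of the
  -- second and third. For each form the averages over the two units other than its own agree (`h3`,
  -- `h4`), which links the three.
  have h1 : S.beta 2 x v w + S.beta 2 x (S.I 1 x v) (S.I 1 x w)
      = S.beta 0 x v w + S.beta 0 x (S.I 1 x v) (S.I 1 x w) := hT.beta_mixed 1 hv hw
  have h2 : S.beta 1 x v w + S.beta 1 x (S.I 0 x v) (S.I 0 x w)
      = S.beta 2 x v w + S.beta 2 x (S.I 0 x v) (S.I 0 x w) := hT.beta_mixed 0 hv hw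
  have h3 : S.beta 2 x (S.I 1 x v) (S.I 1 x w) = S.beta 2 x (S.I 0 x v) (S.I 0 x w) :=
    hT.beta_I_add_two 2 hv hw
  have h4 : S.beta 1 x (S.I 0 x v) (S.I 0 x w) = S.beta 1 x (S.I 2 x v) (S.I 2 x w) :=
    hT.beta_I_add_two 1 hv hw
  fin_cases a
  · exact h0
  · change _ = S.beta 1 x v w + S.beta 1 x (S.I 2 x v) (S.I 2 x w)
    linarith
  · change _ = S.beta 2 x v w + S.beta 2 x (S.I 0 x v) (S.I 0 x w)
    linarith

theorem IsNormalized.levi_eq_add_two [T2Space M] (hT : S.IsNormalized T) (a : Fin 3) {x : M}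
    {v w : Tan n x} (hv : v ∈ S.Q x) (hw : w ∈ S.Q x) :
    2 * S.levi S.θ x v w
      = S.beta a x v w + S.beta a x (S.I (a + 2) x v) (S.I (a + 2) x w) := by
  rw [hT.beta_I_add_two a hv hw, hT.levi_eq_add_one a hv hw]

theorem IsNormalized.g_symm [T2Space M] (hT : S.IsNormalized T) {x : M}
    {v w : Tan n x} (hv : v ∈ S.Q x) (hw : w ∈ S.Q x) : S.g x v w = S.g x w v := by
  have h1 := S.levi_eq_zero_one (v := v) hw
  have h2 := S.levi_eq_zero_one (v := w) hv
  rw [hT.beta_symm 0 hv hw, hT.beta_symm 0 (S.I_mem 1 hv) (S.I_mem 1 hw)] at h1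
  simp only [g]
  linarith

/-- With `a = b + 2`, the Levi form is half the sum of `beta a` and its pullback by `I_b`. Since
`I_b² = -1`, a further pullback by `I_b` only exchanges the two terms. -/
theorem IsNormalized.g_I [T2Space M] (hT : S.IsNormalized T) (b : Fin 3) {x : M}
    {v w : Tan n x} (hv : v ∈ S.Q x) (hw : w ∈ S.Q x) :
    S.g x (S.I b x v) (S.I b x w) = S.g x v w := by
  have e : ∀ b : Fin 3, b + 2 + 1 = b := by decide
  have h1 := hT.levi_eq_add_one (b + 2) hv hw
  have h2 := hT.levi_eq_add_one (b + 2) (S.I_mem b hv) (S.I_mem b hw)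
  rw [e] at h1 h2
  rw [S.I_sq b hv, S.I_sq b hw] at h2
  have h3 : S.beta (b + 2) x (-v) (-w) = S.beta (b + 2) x v w := by
    rw [beta, map_neg, dform_neg_left, dform_neg_right, neg_neg, beta]
  simp only [g]
  linarith

variable (S) in
/-- The Levi form of the `Q`-components, as a field of bilinear forms on the tangent bundle. -/
def gForm (T : Fin 3 → ∀ x : M, Tan n x) (x : M) : Tan n x →ₗ[ℝ] Tan n x →ₗ[ℝ] ℝ :=
  (2 : ℝ)⁻¹ • ((dlin (S.compatible.smooth 0) x).compl₁₂ (S.proj T x) (S.I 0 x ∘ₗ S.proj T x)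
    + (dlin (S.compatible.smooth 0) x).compl₁₂ (S.I 1 x ∘ₗ S.proj T x) (S.I 2 x ∘ₗ S.proj T x))

theorem gForm_apply (T : Fin 3 → ∀ x : M, Tan n x) (x : M) (v w : Tan n x) :
    S.gForm T x v w = S.g x (S.proj T x v) (S.proj T x w) := by
  simp [gForm, g, AlmostHyperCR.levi, dlin_apply]
  ring

theorem gForm_of_mem (T : Fin 3 → ∀ x : M, Tan n x) {x : M} {v w : Tan n x} (hv : v ∈ S.Q x)
    (hw : w ∈ S.Q x) : S.gForm T x v w = S.g x v w := by
  rw [gForm_apply, proj_of_mem T hv, proj_of_mem T hw]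

theorem IsNormalized.gForm_symm [T2Space M] (hT : S.IsNormalized T) (x : M) (v w : Tan n x) :
    S.gForm T x v w = S.gForm T x w v := by
  rw [gForm_apply, gForm_apply, hT.g_symm (hT.proj_mem x v) (hT.proj_mem x w)]

theorem IsNormalized.gForm_smooth [T2Space M] (hT : S.IsNormalized T) :
    IsSmoothForm (S.gForm T) := by
  intro U hU X Y hX hY
  have h := S.compatible.smooth 0
  have h1 := h.dform_smooth hU (hT.proj_smooth U hU X hX) (hT.I_proj_smooth 0 U hU Y hY)
  have h2 := h.dform_smooth hU (hT.I_proj_smooth 1 U hU X hX) (hT.I_proj_smooth 2 U hU Y hY)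
  refine ((SmoothFun.const (2 : ℝ)⁻¹).mul (h1.add h2)).congr fun x _ => ?_
  simp [gForm, dlin_apply]
  ring

variable (S) in
/-- `g^⊥` as a field of bilinear forms on the tangent bundle. -/
def gPerpForm (x : M) : Tan n x →ₗ[ℝ] Tan n x →ₗ[ℝ] ℝ :=
  ∑ a, (LinearMap.mul ℝ ℝ).compl₁₂ (S.θ a x : Tan n x →ₗ[ℝ] ℝ) (S.θ a x : Tan n x →ₗ[ℝ] ℝ)

theorem gPerpForm_apply (x : M) (v w : Tan n x) : S.gPerpForm x v w = S.gPerp x v w := by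
  simp [gPerpForm, gPerp]

theorem gPerpForm_smooth : IsSmoothForm S.gPerpForm := by
  intro U hU X Y hX hY
  simp only [gPerpForm_apply, gPerp]
  exact SmoothFun.sum fun a _ =>
    ((S.compatible.smooth a).smoothFun hX).mul ((S.compatible.smooth a).smoothFun hY)

theorem gPerpForm_symm (x : M) (v w : Tan n x) : S.gPerpForm x v w = S.gPerpForm x w v := by
  simp only [gPerpForm_apply, gPerp, mul_comm]

end Levi

end HyperPseudohermitian
end HyperCR

namespace HyperCR

namespace HyperPseudohermitian

variable {n : ℕ} {M : Type*} [TopologicalSpace M] [ChartedSpace (ModelE n) M]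
  [IsManifold (𝓡 (4 * n + 3)) ∞ M] {S : HyperPseudohermitian n M}
  {T : Fin 3 → ∀ x : M, Tan n x}

/-! ### Adapted frames -/

variable (S) in
/-- The vectors `v, Iv, Jv, Kv`. -/
def quatVec (c : Fin 4) (x : M) (v : Tan n x) : Tan n x :=
  Fin.cases (motive := fun _ => Tan n x) v (fun a => S.I a x v) c

@[simp] theorem quatVec_zero (x : M) (v : Tan n x) : S.quatVec 0 x v = v := rfl

@[simp] theorem quatVec_succ (a : Fin 3) (x : M) (v : Tan n x) :
    S.quatVec a.succ x v = S.I a x v := rfl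

theorem quatVec_mem (c : Fin 4) {x : M} {v : Tan n x} (hv : v ∈ S.Q x) :
    S.quatVec c x v ∈ S.Q x := by
  refine Fin.cases hv (fun a => S.I_mem a hv) c

theorem I_quatVec (a : Fin 3) (c : Fin 4) {x : M} {v : Tan n x} (hv : v ∈ S.Q x) :
    ∃ (s : ℝ) (c' : Fin 4), S.I a x (S.quatVec c x v) = s • S.quatVec c' x v := by
  have hb : ∀ a b : Fin 3, b = a ∨ b = a + 1 ∨ (a = b + 1 ∧ a + 1 = b + 2) := by decide
  refine Fin.cases ⟨1, a.succ, by simp⟩ (fun b => ?_) c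
  rcases hb a b with rfl | rfl | ⟨rfl, -⟩
  · exact ⟨-1, 0, by simp [S.I_sq _ hv]⟩
  · exact ⟨1, (a + 2).succ, by simp only [quatVec_succ, S.I_mul _ hv, one_smul]⟩
  · exact ⟨-1, (b + 2).succ, by simp only [quatVec_succ, S.I_mul_rev _ hv, neg_smul, one_smul]⟩

theorem IsNormalized.gForm_pos (T : Fin 3 → ∀ x : M, Tan n x) {x : M} {v : Tan n x}
    (hv : v ∈ S.Q x) (h0 : v ≠ 0) : 0 < S.gForm T x v v := by
  rw [gForm_of_mem T hv hv]
  exact S.levi_pos x v hv h0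

theorem IsNormalized.gForm_I [T2Space M] (hT : S.IsNormalized T) (a : Fin 3) {x : M}
    {v w : Tan n x} (hv : v ∈ S.Q x) (hw : w ∈ S.Q x) :
    S.gForm T x (S.I a x v) (S.I a x w) = S.gForm T x v w := by
  rw [gForm_of_mem T (S.I_mem a hv) (S.I_mem a hw), gForm_of_mem T hv hw, hT.g_I a hv hw]

theorem IsNormalized.gForm_I_right [T2Space M] (hT : S.IsNormalized T) (a : Fin 3) {x : M}
    {v w : Tan n x} (hv : v ∈ S.Q x) (hw : w ∈ S.Q x) :
    S.gForm T x v (S.I a x w) = -S.gForm T x (S.I a x v) w := by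
  rw [← hT.gForm_I a hv (S.I_mem a hw), S.I_sq a hw, map_neg]

theorem IsNormalized.gForm_I_self [T2Space M] (hT : S.IsNormalized T) (a : Fin 3) {x : M}
    {v : Tan n x} (hv : v ∈ S.Q x) : S.gForm T x (S.I a x v) v = 0 := by
  have h := hT.gForm_I_right a hv hv
  rw [hT.gForm_symm] at h
  linarith

theorem IsNormalized.gForm_quatVec_self [T2Space M] (hT : S.IsNormalized T) (c d : Fin 4) {x : M}
    {v : Tan n x} (hv : v ∈ S.Q x) :
    S.gForm T x (S.quatVec c x v) (S.quatVec d x v) = if c = d then S.gForm T x v v else 0 := by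
  have hb : ∀ a b : Fin 3, b = a ∨ b = a + 1 ∨ a = b + 1 := by decide
  have n1 : ∀ b : Fin 3, b + 1 ≠ b := by decide
  refine Fin.cases (Fin.cases ?_ (fun b => ?_) d) (fun a => Fin.cases ?_ (fun b => ?_) d) c
  · simp
  · rw [if_neg (Fin.succ_ne_zero b).symm, quatVec_zero, quatVec_succ, hT.gForm_symm,
      hT.gForm_I_self b hv]
  · rw [if_neg (Fin.succ_ne_zero a), quatVec_zero, quatVec_succ, hT.gForm_I_self a hv]
  · simp only [quatVec_succ, Fin.succ_inj]
    rcases hb a b with rfl | rfl | rfl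
    · simp [hT.gForm_I _ hv hv]
    · rw [if_neg (n1 a).symm, ← neg_neg (S.gForm T x (S.I a x v) _), ← hT.gForm_I_right a hv
        (S.I_mem _ hv), S.I_mul a hv, hT.gForm_symm, hT.gForm_I_self _ hv, neg_zero]
    · rw [if_neg (n1 b), hT.gForm_I_right b (S.I_mem _ hv) hv, S.I_mul b hv,
        hT.gForm_I_self _ hv, neg_zero]

/-- The orthogonal complement of a quaternionic line is quaternionic: `I_a` is skew for the metric
and permutes `v, Iv, Jv, Kv` up to sign (`I_quatVec`). -/
theorem IsNormalized.gForm_quatVec_eq_zero [T2Space M] (hT : S.IsNormalized T) {x : M}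
    {u v : Tan n x} (hu : u ∈ S.Q x) (hv : v ∈ S.Q x)
    (h : ∀ c, S.gForm T x (S.quatVec c x v) u = 0) (c d : Fin 4) :
    S.gForm T x (S.quatVec c x v) (S.quatVec d x u) = 0 := by
  refine Fin.cases (h c) (fun a => ?_) d
  rw [quatVec_succ, hT.gForm_I_right a (quatVec_mem c hv) hu]
  obtain ⟨s, c', hs⟩ := S.I_quatVec a c hv
  rw [hs, map_smul, LinearMap.smul_apply, h, smul_zero, neg_zero]

theorem IsNormalized.finrank_Q (hT : S.IsNormalized T) (x : M) :
    Module.finrank ℝ (S.Q x) = 4 * n := by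
  let φ : Tan n x →ₗ[ℝ] Fin 3 → ℝ := LinearMap.pi fun a => (S.θ a x : Tan n x →ₗ[ℝ] ℝ)
  have hker : LinearMap.ker φ = S.Q x := by
    ext v
    rw [S.mem_Q_iff, LinearMap.mem_ker, funext_iff]
    rfl
  have hsurj : LinearMap.range φ = ⊤ := by
    rw [LinearMap.range_eq_top]
    intro c
    refine ⟨∑ b, c b • T b x, ?_⟩
    funext a
    simp [φ, hT.theta_apply]
  have : FiniteDimensional ℝ (Tan n x) := inferInstanceAs (FiniteDimensional ℝ (ModelE n))
  have h := LinearMap.finrank_range_add_finrank_ker φ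
  have h3 : Module.finrank ℝ (Tan n x) = 4 * n + 3 := by
    change Module.finrank ℝ (ModelE n) = _
    simp
  rw [hker, hsurj, finrank_top, h3, Module.finrank_fin_fun] at h
  omega

theorem IsNormalized.quatVec_smoothOn [T2Space M] (hT : S.IsNormalized T) (c : Fin 4)
    {U : Set M} (hU : IsOpen U) {X : ∀ x : M, Tan n x} (hX : SmoothOn X U)
    (hQ : ∀ x ∈ U, X x ∈ S.Q x) : SmoothOn (fun x => S.quatVec c x (X x)) U := by
  refine Fin.cases hX (fun a => ?_) c
  exact (hT.I_proj_smooth a U hU X hX).congr fun x hx => by simp [proj_of_mem T (hQ x hx)]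

/-- Gram-Schmidt orthonormalization over the quaternions. -/
theorem IsNormalized.exists_partial_frame [T2Space M] (hT : S.IsNormalized T) (q : M) (k : ℕ)
    (hk : k ≤ n) : ∃ (U : Set M) (e : ℕ → ∀ x : M, Tan n x), IsOpen U ∧ q ∈ U ∧
      (∀ i < k, SmoothOn (e i) U) ∧ (∀ i < k, ∀ x ∈ U, e i x ∈ S.Q x) ∧
      ∀ i < k, ∀ j < k, ∀ x ∈ U, ∀ c d, S.gForm T x (S.quatVec c x (e i x))
        (S.quatVec d x (e j x)) = if i = j ∧ c = d then 1 else 0 := by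
  induction k with
  | zero => exact ⟨Set.univ, fun _ _ => 0, isOpen_univ, Set.mem_univ _, by simp, by simp, by simp⟩
  | succ k ih =>
    obtain ⟨U, e, hU, hq, hs, hQ, ho⟩ := ih (by omega)
    have : FiniteDimensional ℝ (Tan n q) := inferInstanceAs (FiniteDimensional ℝ (ModelE n))
    -- a vector outside of the span
    obtain ⟨v, hv, hvs⟩ : ∃ v ∈ S.Q q, v ∉ Submodule.span ℝ
        (Set.range fun p : Fin k × Fin 4 => S.quatVec p.2 q (e p.1 q)) := by
      by_contra! h
      have h1 : S.Q q ≤ Submodule.span ℝ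
        (Set.range fun p : Fin k × Fin 4 => S.quatVec p.2 q (e p.1 q)) := h
      have h2 := Submodule.finrank_mono h1
      have h3 := finrank_range_le_card (R := ℝ)
        (b := fun p : Fin k × Fin 4 => S.quatVec p.2 q (e p.1 q))
      rw [hT.finrank_Q] at h2
      simp only [Set.finrank, Fintype.card_prod, Fintype.card_fin] at h3
      omega
    obtain ⟨V, hV, rfl⟩ := hT.exists_section hv
    have hsm : ∀ p : Fin k × Fin 4, SmoothOn (fun x => S.quatVec p.2 x (e p.1 x)) U := fun p =>
      hT.quatVec_smoothOn p.2 hU (hs p.1 p.1.2) (hQ p.1 p.1.2)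
    -- The component of `V` orthogonal to the quaternionic span of the earlier vectors. It is
    -- nonzero at `q` because `V q` lies outside that span.
    let W : ∀ x : M, Tan n x := fun x => V x - ∑ p : Fin k × Fin 4,
      S.gForm T x (S.quatVec p.2 x (e p.1 x)) (V x) • S.quatVec p.2 x (e p.1 x)
    have hV' : SmoothOn V U := hV.1.mono (Set.subset_univ U)
    have hW : SmoothOn W U := hV'.sub (SmoothOn.sum fun p _ => SmoothOn.smul
      (hT.gForm_smooth U hU _ _ (hsm p) hV') (hsm p))
    have hWQ : ∀ x ∈ U, W x ∈ S.Q x := fun x hx => sub_mem (hV.2 x)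
      (Submodule.sum_mem _ fun p _ => Submodule.smul_mem _ _ (quatVec_mem _ (hQ p.1 p.1.2 x hx)))
    have hWo : ∀ i < k, ∀ x ∈ U, ∀ c, S.gForm T x (S.quatVec c x (e i x)) (W x) = 0 := by
      intro i hi x hx c
      simp only [W, map_sub, map_sum, map_smul, smul_eq_mul]
      rw [Finset.sum_eq_single (⟨⟨i, hi⟩, c⟩ : Fin k × Fin 4)]
      · simp [ho i hi i hi x hx]
      · rintro ⟨j, d⟩ - hne
        rw [ho i hi j j.2 x hx, if_neg, mul_zero]
        rintro ⟨h1, h2⟩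
        exact hne (Prod.ext (Fin.ext h1.symm) h2.symm)
      · simp
    have hWq : W q ≠ 0 := by
      intro h
      rw [sub_eq_zero] at h
      refine hvs ?_
      rw [h]
      exact Submodule.sum_mem _ fun p _ => Submodule.smul_mem _ _ (Submodule.subset_span ⟨p, rfl⟩)
    have hg : SmoothFun n (fun x => S.gForm T x (W x) (W x)) U := hT.gForm_smooth U hU W W hW hW
    let U' : Set M := U ∩ (fun x => S.gForm T x (W x) (W x)) ⁻¹' {r | r ≠ 0}
    have hU' : IsOpen U' := hg.continuousOn.isOpen_inter_preimage hU isOpen_ne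
    have sub : U' ⊆ U := Set.inter_subset_left
    let N : ∀ x : M, Tan n x := fun x => (√(S.gForm T x (W x) (W x)))⁻¹ • W x
    have hpos : ∀ x ∈ U', 0 < S.gForm T x (W x) (W x) := by
      rintro x ⟨hx, hx0⟩
      refine IsNormalized.gForm_pos T (hWQ x hx) fun h => hx0 ?_
      simp [h]
    have hN : SmoothOn N U' := SmoothOn.smul (((hg.mono sub).sqrt fun x hx => (hpos x hx).ne').inv
      fun x hx => (Real.sqrt_pos.2 (hpos x hx)).ne') (hW.mono sub)
    have hNQ : ∀ x ∈ U', N x ∈ S.Q x := fun x hx => Submodule.smul_mem _ _ (hWQ x hx.1)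
    have hNo : ∀ i < k, ∀ x ∈ U', ∀ c, S.gForm T x (S.quatVec c x (e i x)) (N x) = 0 := by
      intro i hi x hx c
      simp only [N, map_smul, hWo i hi x hx.1 c, smul_zero]
    have hNN : ∀ x ∈ U', S.gForm T x (N x) (N x) = 1 := by
      intro x hx
      have h := hpos x hx
      simp only [N, map_smul, LinearMap.smul_apply, smul_eq_mul]
      rw [← mul_assoc, ← mul_inv, Real.mul_self_sqrt h.le, inv_mul_cancel₀ h.ne']
    have hqU' : q ∈ U' := ⟨hq, (IsNormalized.gForm_pos T (hWQ q hq) hWq).ne'⟩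
    refine ⟨U', fun i => if i = k then N else e i, hU', hqU', ?_, ?_, ?_⟩
    · intro i hi
      by_cases h : i = k
      · simpa [h] using hN
      · simpa [h] using (hs i (by omega)).mono sub
    · intro i hi x hx
      by_cases h : i = k
      · simpa [h] using hNQ x hx
      · simpa [h] using hQ i (by omega) x (sub hx)
    · intro i hi j hj x hx c d
      by_cases h : i = k
      · by_cases h' : j = k
        · subst h; subst h'
          simp only [if_true, true_and]
          rw [hT.gForm_quatVec_self c d (hNQ x hx), hNN x hx]
        · have h'' : i ≠ j := by omega
          simp only [h, h', if_true, if_false]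
          rw [if_neg (by rintro ⟨h1, -⟩; omega), hT.gForm_symm, hT.gForm_quatVec_eq_zero (hNQ x hx)
            (hQ j (by omega) x hx.1) (fun c => hNo j (by omega) x hx c)]
      · by_cases h' : j = k
        · simp only [h, h', if_true, if_false]
          rw [if_neg (by rintro ⟨h1, -⟩; omega), hT.gForm_quatVec_eq_zero (hNQ x hx)
            (hQ i (by omega) x hx.1) (fun c => hNo i (by omega) x hx c)]
        · simp only [h, h', if_false]
          exact ho i (by omega) j (by omega) x hx.1 c d

theorem IsNormalized.exists_adaptedFrame [T2Space M] (hT : S.IsNormalized T) (q : M) :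
    ∃ U ε, S.IsAdaptedFrame U ε ∧ q ∈ U := by
  obtain ⟨U, e, hU, hq, hs, hQ, ho⟩ := hT.exists_partial_frame q n le_rfl
  refine ⟨U, fun p x => S.quatVec p.2 x (e p.1 x), ⟨hU, fun p => ?_, fun p x hx => ?_,
    fun p r x hx => ?_, fun k a x hx => rfl⟩, hq⟩
  · exact hT.quatVec_smoothOn _ hU (hs _ p.1.2) (hQ _ p.1.2)
  · exact quatVec_mem _ (hQ _ p.1.2 x hx)
  · rw [← gForm_of_mem T (quatVec_mem _ (hQ _ p.1.2 x hx)) (quatVec_mem _ (hQ _ r.1.2 x hx)),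
      ho _ p.1.2 _ r.1.2 x hx]
    congr 1
    simp [Prod.ext_iff, Fin.ext_iff]

end HyperPseudohermitian
end HyperCR

namespace HyperCR

/-! ### The Koszul expression of a possibly degenerate symmetric form. -/

section Koszul

variable {n : ℕ} {M : Type*} [TopologicalSpace M] [ChartedSpace (ModelE n) M]
  [IsManifold (𝓡 (4 * n + 3)) ∞ M]

/-- The right hand side of the Koszul formula for the bilinear form `B`. -/
def koszul (B : ∀ x : M, Tan n x →ₗ[ℝ] Tan n x →ₗ[ℝ] ℝ) (X Y W : ∀ x : M, Tan n x) (x : M) : ℝ :=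
  dir (fun y => B y (Y y) (W y)) x (X x) + dir (fun y => B y (X y) (W y)) x (Y x)
    - dir (fun y => B y (X y) (Y y)) x (W x)
    + B x (brak X Y x) (W x) - B x (brak X W x) (Y x) - B x (brak Y W x) (X x)

variable {B : ∀ x : M, Tan n x →ₗ[ℝ] Tan n x →ₗ[ℝ] ℝ} {X Y W : ∀ x : M, Tan n x} {x : M}

theorem dir_congr {f g : M → ℝ} (h : ∀ᶠ y in 𝓝 x, f y = g y) (v : Tan n x) :
    dir f x v = dir g x v := by
  have h' := Filter.EventuallyEq.mfderiv_eq (I := 𝓡 (4 * n + 3)) (I' := 𝓘(ℝ, ℝ)) h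
  simp only [dir, mvfderiv, h']
  rfl

theorem dir_eq_zero {f : M → ℝ} {c : ℝ} (h : ∀ᶠ y in 𝓝 x, f y = c) (v : Tan n x) :
    dir f x v = 0 := by
  rw [dir_congr h v]
  simp [dir, mvfderiv_const]

theorem koszul_congr {X' Y' W' : ∀ x : M, Tan n x} (hX : ∀ᶠ y in 𝓝 x, X y = X' y)
    (hY : ∀ᶠ y in 𝓝 x, Y y = Y' y) (hW : ∀ᶠ y in 𝓝 x, W y = W' y) :
    koszul B X Y W x = koszul B X' Y' W' x := by
  have hb : ∀ {X X' Y Y' : ∀ x : M, Tan n x}, (∀ᶠ y in 𝓝 x, X y = X' y) →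
      (∀ᶠ y in 𝓝 x, Y y = Y' y) → brak X Y x = brak X' Y' x := fun h h' =>
    Filter.EventuallyEq.mlieBracket_vectorField_eq h h'
  simp only [koszul]
  have hBc : ∀ {V V' Z Z' : ∀ x : M, Tan n x}, (∀ᶠ y in 𝓝 x, V y = V' y) →
      (∀ᶠ y in 𝓝 x, Z y = Z' y) → ∀ᶠ y in 𝓝 x, B y (V y) (Z y) = B y (V' y) (Z' y) :=
    fun h h' => (h.and h').mono fun y h => by rw [h.1, h.2]
  rw [dir_congr (hBc hY hW), dir_congr (hBc hX hW), dir_congr (hBc hX hY), hb hX hY, hb hX hW, hb hY hW,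
    hX.self_of_nhds, hY.self_of_nhds, hW.self_of_nhds]

theorem koszul_zero_mid (X W : ∀ x : M, Tan n x) : koszul B X (fun _ => 0) W x = 0 := by
  have h1 : brak X (fun _ => 0) x = 0 := by
    have := VectorField.mlieBracket_zero_right (I := 𝓡 (4 * n + 3)) (W := X)
    exact congrFun this x
  have h2 : brak (fun _ => 0) W x = 0 := by
    have := VectorField.mlieBracket_zero_left (I := 𝓡 (4 * n + 3)) (W := W)
    exact congrFun this x
  simp [koszul, h1, h2, dir, mvfderiv_const]

theorem koszul_zero_right (X Y : ∀ x : M, Tan n x) : koszul B X Y (fun _ => 0) x = 0 := by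
  have h1 : ∀ X : ∀ x : M, Tan n x, brak X (fun _ => 0) x = 0 := fun X => by
    have := VectorField.mlieBracket_zero_right (I := 𝓡 (4 * n + 3)) (W := X)
    exact congrFun this x
  simp [koszul, h1, dir, mvfderiv_const]

theorem koszul_add_left (hB : IsSmoothForm B) {X' : ∀ x : M, Tan n x} (hX : DiffAt X x) (hX' : DiffAt X' x)
    (hY : DiffAt Y x) (hW : DiffAt W x) :
    koszul B (X + X') Y W x = koszul B X Y W x + koszul B X' Y W x := by
  simp only [koszul, brak, Pi.add_apply, map_add, LinearMap.add_apply, dir]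
  rw [mvfderiv_fun_add (hB.diffAt hX hW) (hB.diffAt hX' hW),
    mvfderiv_fun_add (hB.diffAt hX hY) (hB.diffAt hX' hY),
    VectorField.mlieBracket_add_left hX hX', VectorField.mlieBracket_add_left hX hX']
  simp only [map_add, LinearMap.add_apply, _root_.add_apply]
  ring

theorem koszul_add_mid (hB : IsSmoothForm B) {Y' : ∀ x : M, Tan n x} (hX : DiffAt X x) (hY : DiffAt Y x)
    (hY' : DiffAt Y' x) (hW : DiffAt W x) :
    koszul B X (Y + Y') W x = koszul B X Y W x + koszul B X Y' W x := by
  simp only [koszul, brak, Pi.add_apply, map_add, LinearMap.add_apply, dir]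
  rw [mvfderiv_fun_add (hB.diffAt hY hW) (hB.diffAt hY' hW),
    mvfderiv_fun_add (hB.diffAt hX hY) (hB.diffAt hX hY'),
    VectorField.mlieBracket_add_right hY hY', VectorField.mlieBracket_add_left hY hY']
  simp only [map_add, LinearMap.add_apply, _root_.add_apply]
  ring

theorem koszul_add_right (hB : IsSmoothForm B) {W' : ∀ x : M, Tan n x} (hX : DiffAt X x) (hY : DiffAt Y x)
    (hW : DiffAt W x) (hW' : DiffAt W' x) :
    koszul B X Y (W + W') x = koszul B X Y W x + koszul B X Y W' x := by
  simp only [koszul, brak, Pi.add_apply, map_add, LinearMap.add_apply, dir]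
  rw [mvfderiv_fun_add (hB.diffAt hY hW) (hB.diffAt hY hW'),
    mvfderiv_fun_add (hB.diffAt hX hW) (hB.diffAt hX hW'),
    VectorField.mlieBracket_add_right hW hW', VectorField.mlieBracket_add_right hW hW']
  simp only [map_add, LinearMap.add_apply, _root_.add_apply]
  ring

theorem koszul_smul_left (hB : IsSmoothForm B)
    (hs : ∀ x v w, B x v w = B x w v) {f : M → ℝ} (hf : DiffFunAt n f x) (hX : DiffAt X x)
    (hY : DiffAt Y x) (hW : DiffAt W x) :
    koszul B (f • X) Y W x = f x * koszul B X Y W x := by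
  simp only [koszul, brak, Pi.smul_apply', map_smul, LinearMap.smul_apply, smul_eq_mul, dir]
  rw [mvfderiv_fun_mul hf (hB.diffAt hX hW), mvfderiv_fun_mul hf (hB.diffAt hX hY),
    VectorField.mlieBracket_smul_left hf hX, VectorField.mlieBracket_smul_left hf hX]
  simp only [map_add, LinearMap.add_apply, _root_.add_apply, map_smul, map_neg, neg_smul,
    LinearMap.smul_apply, LinearMap.neg_apply, smul_eq_mul, _root_.smul_apply]
  rw [hs x (X x) (W x), hs x (X x) (Y x)]
  ring

/-- The middle slot is the only one that is not tensorial. The extra term, halved, is the Leibniz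
term of the connection that the Koszul formula defines. -/
theorem koszul_smul_mid (hB : IsSmoothForm B)
    (hs : ∀ x v w, B x v w = B x w v) {f : M → ℝ} (hf : DiffFunAt n f x) (hX : DiffAt X x)
    (hY : DiffAt Y x) (hW : DiffAt W x) :
    koszul B X (f • Y) W x = f x * koszul B X Y W x + 2 * (dir f x (X x) * B x (Y x) (W x)) := by
  simp only [koszul, brak, Pi.smul_apply', map_smul, LinearMap.smul_apply, smul_eq_mul, dir]
  rw [mvfderiv_fun_mul hf (hB.diffAt hY hW), mvfderiv_fun_mul hf (hB.diffAt hX hY),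
    VectorField.mlieBracket_smul_right hf hY, VectorField.mlieBracket_smul_left hf hY]
  simp only [map_add, LinearMap.add_apply, _root_.add_apply, map_smul, map_neg, neg_smul,
    LinearMap.smul_apply, LinearMap.neg_apply, smul_eq_mul, _root_.smul_apply]
  rw [hs x (Y x) (X x)]
  ring

theorem koszul_smul_right (hB : IsSmoothForm B)
    (hs : ∀ x v w, B x v w = B x w v) {f : M → ℝ} (hf : DiffFunAt n f x) (hX : DiffAt X x)
    (hY : DiffAt Y x) (hW : DiffAt W x) :
    koszul B X Y (f • W) x = f x * koszul B X Y W x := by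
  simp only [koszul, brak, Pi.smul_apply', map_smul, LinearMap.smul_apply, smul_eq_mul, dir]
  rw [mvfderiv_fun_mul hf (hB.diffAt hY hW), mvfderiv_fun_mul hf (hB.diffAt hX hW),
    VectorField.mlieBracket_smul_right hf hW, VectorField.mlieBracket_smul_right hf hW]
  simp only [map_add, LinearMap.add_apply, _root_.add_apply, map_smul, map_neg, neg_smul,
    LinearMap.smul_apply, LinearMap.neg_apply, smul_eq_mul, _root_.smul_apply]
  rw [hs x (W x) (X x), hs x (W x) (Y x)]
  ring

/-- This symmetry yields metric compatibility of a connection given by the Koszul formula. -/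
theorem koszul_add_swap (hs : ∀ x v w, B x v w = B x w v) (X Y W : ∀ x : M, Tan n x) (x : M) :
    koszul B X Y W x + koszul B X W Y x = 2 * dir (fun y => B y (Y y) (W y)) x (X x) := by
  have h1 : brak W Y x = -brak Y W x := by
    simp only [brak]; rw [VectorField.mlieBracket_swap_apply]
  have h2 : (fun y => B y (W y) (Y y)) = fun y => B y (Y y) (W y) := funext fun y => hs y _ _
  simp only [koszul, h1, h2, map_neg, LinearMap.neg_apply]
  ring

/-- This antisymmetry yields the vanishing of the component of the torsion in the summand on which
the form is definite. -/
theorem koszul_sub_swap (hs : ∀ x v w, B x v w = B x w v) (X Y W : ∀ x : M, Tan n x) (x : M) :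
    koszul B X Y W x - koszul B Y X W x = 2 * B x (brak X Y x) (W x) := by
  have h1 : brak Y X x = -brak X Y x := by
    simp only [brak]; rw [VectorField.mlieBracket_swap_apply]
  have h2 : (fun y => B y (Y y) (X y)) = fun y => B y (X y) (Y y) := funext fun y => hs y _ _
  simp only [koszul, h1, h2, map_neg, LinearMap.neg_apply]
  ring

theorem koszul_smooth (hB : IsSmoothForm B) {U : Set M} (hU : IsOpen U) (hX : SmoothOn X U) (hY : SmoothOn Y U)
    (hW : SmoothOn W U) : SmoothFun n (fun x => koszul B X Y W x) U :=
  (((((hB U hU Y W hY hW).dir hU hX).add ((hB U hU X W hX hW).dir hU hY)).sub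
    ((hB U hU X Y hX hY).dir hU hW)).add (hB U hU _ _ (hX.bracket hU hY) hW)).sub
    (hB U hU _ _ (hX.bracket hU hW) hY) |>.sub (hB U hU _ _ (hY.bracket hU hW) hX)

end Koszul

/-! ### Connections adapted to a splitting of the tangent bundle -/

section Split

variable {n : ℕ} {M : Type*} [TopologicalSpace M] [ChartedSpace (ModelE n) M]
  [IsManifold (𝓡 (4 * n + 3)) ∞ M]

/-- `B` is a smooth field of semi-definite symmetric bilinear forms, positive definite on `A` and
with radical `A'`, where `TM = A ⊕ A'` with smooth projection `π` to `A`. -/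
structure IsSplitForm (A A' : ∀ x : M, Submodule ℝ (Tan n x)) (π : ∀ x : M, Tan n x →ₗ[ℝ] Tan n x)
    (B : ∀ x : M, Tan n x →ₗ[ℝ] Tan n x →ₗ[ℝ] ℝ) : Prop where
  proj_mem : ∀ x v, π x v ∈ A x
  sub_proj_mem : ∀ x v, v - π x v ∈ A' x
  proj_of_mem : ∀ x, ∀ v ∈ A x, π x v = v
  proj_of_mem' : ∀ x, ∀ v ∈ A' x, π x v = 0
  proj_smooth : IsSmoothEnd π
  radical : ∀ x, ∀ v ∈ A' x, ∀ w, B x v w = 0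
  symm : ∀ x v w, B x v w = B x w v
  smooth : IsSmoothForm B
  pos : ∀ x, ∀ v ∈ A x, v ≠ 0 → 0 < B x v v

/-- The part of the definition of an associated connection that concerns the summand `A`. -/
structure IsHalfAssociated (A A' : ∀ x : M, Submodule ℝ (Tan n x))
    (π : ∀ x : M, Tan n x →ₗ[ℝ] Tan n x)
    (B : ∀ x : M, Tan n x →ₗ[ℝ] Tan n x →ₗ[ℝ] ℝ) (D : Connection n M) : Prop where
  preserves : ∀ Y, IsSection A Y → ∀ x v, D Y x v ∈ A x
  preserves' : ∀ Y, IsSection A' Y → ∀ x v, D Y x v ∈ A' x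
  parallel : ∀ Y Z, IsSection A Y → IsSection A Z → ∀ x v,
    dir (fun y => B y (Y y) (Z y)) x v = B x (D Y x v) (Z x) + B x (Y x) (D Z x v)
  torsion : ∀ x, ∀ X ∈ A x, ∀ Y ∈ A x, π x (D.torsion x X Y) = 0
  torsion_symm : ∀ x, ∀ U ∈ A' x, ∀ X ∈ A x, ∀ Y ∈ A x,
    B x (π x (D.torsion x U X)) Y = B x X (π x (D.torsion x U Y))

variable {A A' : ∀ x : M, Submodule ℝ (Tan n x)} {π : ∀ x : M, Tan n x →ₗ[ℝ] Tan n x}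
  {B : ∀ x : M, Tan n x →ₗ[ℝ] Tan n x →ₗ[ℝ] ℝ} {D : Connection n M}

theorem IsSection.diffAt {X : ∀ x : M, Tan n x} (hX : IsSection A X) (x : M) : DiffAt X x :=
  hX.1.diffAt isOpen_univ (Set.mem_univ x)

namespace IsSplitForm

theorem proj_left (H : IsSplitForm A A' π B) (x : M) (v w : Tan n x) :
    B x (π x v) w = B x v w := by
  have := H.radical x _ (H.sub_proj_mem x v) w
  rw [map_sub, LinearMap.sub_apply, sub_eq_zero] at this
  exact this.symm

theorem radical' (H : IsSplitForm A A' π B) {x : M} {v w : Tan n x} (hw : w ∈ A' x) :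
    B x v w = 0 := by
  rw [H.symm, H.radical x w hw]

theorem proj_right (H : IsSplitForm A A' π B) (x : M) (v w : Tan n x) :
    B x v (π x w) = B x v w := by
  rw [H.symm, H.proj_left, H.symm]

theorem proj_section (H : IsSplitForm A A' π B) {X : ∀ x : M, Tan n x}
    (hX : SmoothOn X Set.univ) : IsSection A (fun x => π x (X x)) :=
  ⟨H.proj_smooth _ isOpen_univ X hX, fun x => H.proj_mem x _⟩

theorem sub_proj_section (H : IsSplitForm A A' π B) {X : ∀ x : M, Tan n x}
    (hX : SmoothOn X Set.univ) : IsSection A' (fun x => X x - π x (X x)) :=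
  ⟨hX.sub (H.proj_smooth _ isOpen_univ X hX), fun x => H.sub_proj_mem x _⟩

/-- The Koszul formula for half-associated connections. -/
theorem koszul_eq [T2Space M] (H : IsSplitForm A A' π B) (hD : IsHalfAssociated A A' π B D)
    {X Y W : ∀ x : M, Tan n x} (hX : SmoothOn X Set.univ) (hY : IsSection A Y)
    (hW : IsSection A W) (x : M) :
    2 * B x (D Y x (X x)) (W x) = koszul B X Y W x := by
  have htor : ∀ {X Y : ∀ x : M, Tan n x}, SmoothOn X Set.univ → SmoothOn Y Set.univ →
      D.torsion x (X x) (Y x) = D Y x (X x) - D X x (Y x) - brak X Y x := fun hX hY =>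
    D.torsion_apply (hX.diffAt isOpen_univ (Set.mem_univ x)) (hY.diffAt isOpen_univ (Set.mem_univ x))
  -- fields in `A`
  have h1 : ∀ {X : ∀ x : M, Tan n x}, IsSection A X →
      2 * B x (D Y x (X x)) (W x) = koszul B X Y W x := by
    intro X hX
    have ht : ∀ {X Y : ∀ x : M, Tan n x}, IsSection A X → IsSection A Y → ∀ w,
        B x (brak X Y x) w = B x (D Y x (X x)) w - B x (D X x (Y x)) w := by
      intro X Y hX hY w
      have h := hD.torsion x _ (hX.2 x) _ (hY.2 x)
      have h2 := H.proj_left x (D.torsion x (X x) (Y x)) w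
      rw [h, htor hX.1 hY.1] at h2
      simp only [map_zero, map_sub, LinearMap.sub_apply, LinearMap.zero_apply] at h2
      linarith
    rw [koszul, ht hX hY, ht hX hW, ht hY hW, hD.parallel Y W hY hW, hD.parallel X W hX hW,
      hD.parallel X Y hX hY, H.symm x (X x), H.symm x (X x), H.symm x (Y x)]
    ring
  -- fields in `A'`
  have h2 : ∀ {X : ∀ x : M, Tan n x}, IsSection A' X →
      2 * B x (D Y x (X x)) (W x) = koszul B X Y W x := by
    intro X hX
    have h := hD.torsion_symm x _ (hX.2 x) _ (hY.2 x) _ (hW.2 x)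
    rw [H.proj_left, H.proj_right, htor hX.1 hY.1, htor hX.1 hW.1] at h
    -- As `X` lies in the radical, the Koszul expression keeps one derivative and two brackets. The
    -- derivative is supplied by parallelism and the bracket terms by symmetry of the mixed torsion.
    have e1 : ∀ Z : ∀ x : M, Tan n x, (fun y => B y (X y) (Z y)) = fun _ => 0 := fun Z =>
      funext fun y => H.radical y _ (hX.2 y) _
    have e2 := H.radical x _ (hD.preserves' X hX x (Y x)) (W x)
    have e3 := H.radical' (v := Y x) (hD.preserves' X hX x (W x))
    have e4 := H.radical' (v := brak Y W x) (hX.2 x)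
    simp only [map_sub, LinearMap.sub_apply, e2, e3] at h
    rw [koszul, e1, e1, e4, hD.parallel Y W hY hW, H.symm x (brak X W x)]
    simp only [dir, mvfderiv_const, _root_.zero_apply]
    linarith
  have e : X = (fun y => π y (X y)) + fun y => X y - π y (X y) := by
    funext y; simp
  have k1 := H.proj_section hX
  have k2 := H.sub_proj_section hX
  have h3 := h1 k1
  have h4 := h2 k2
  have h5 := koszul_add_left H.smooth (k1.diffAt x) (k2.diffAt x) (hY.diffAt x) (hW.diffAt x)
  rw [← e, ← h3, ← h4] at h5
  rw [h5]
  simp only [map_sub, LinearMap.sub_apply]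
  ring

/-- The Koszul formula characterizes half-associated connections. -/
theorem isHalfAssociated [T2Space M] (H : IsSplitForm A A' π B)
    (h : ∀ Y, IsSection A Y → ∀ x v, D Y x v ∈ A x)
    (h' : ∀ Y, IsSection A' Y → ∀ x v, D Y x v ∈ A' x)
    (hK : ∀ X Y W, SmoothOn X Set.univ → IsSection A Y → IsSection A W → ∀ x,
      2 * B x (D Y x (X x)) (W x) = koszul B X Y W x) : IsHalfAssociated A A' π B D := by
  have ext : ∀ {x : M} {v : Tan n x}, v ∈ A x → ∃ X, IsSection A X ∧ X x = v := by
    intro x v hv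
    obtain ⟨X, hX, rfl⟩ := exists_smooth_extension v
    exact ⟨_, H.proj_section hX, H.proj_of_mem x _ hv⟩
  have ext' : ∀ {x : M} {v : Tan n x}, v ∈ A' x → ∃ X, IsSection A' X ∧ X x = v := by
    intro x v hv
    obtain ⟨X, hX, rfl⟩ := exists_smooth_extension v
    exact ⟨_, H.sub_proj_section hX, by simp [H.proj_of_mem' x _ hv]⟩
  have nondeg : ∀ {x : M} {v : Tan n x}, v ∈ A x → (∀ w ∈ A x, B x v w = 0) → v = 0 := by
    intro x v hv hw
    by_contra h0
    exact (H.pos x v hv h0).ne' (hw v hv)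
  have htor : ∀ {X Y : ∀ x : M, Tan n x} (x : M), SmoothOn X Set.univ → SmoothOn Y Set.univ →
      D.torsion x (X x) (Y x) = D Y x (X x) - D X x (Y x) - brak X Y x := fun x hX hY =>
    D.torsion_apply (hX.diffAt isOpen_univ (Set.mem_univ x)) (hY.diffAt isOpen_univ (Set.mem_univ x))
  refine ⟨h, h', ?_, ?_, ?_⟩
  · intro Y Z hY hZ x v
    obtain ⟨X, hX, rfl⟩ := exists_smooth_extension v
    have e1 := hK X Y Z hX hY hZ x
    have e2 := hK X Z Y hX hZ hY x
    have e3 := koszul_add_swap H.symm X Y Z x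
    rw [H.symm x (Y x)]
    linarith
  · intro x v hv w hw
    obtain ⟨X, hX, rfl⟩ := ext hv
    obtain ⟨Y, hY, rfl⟩ := ext hw
    refine nondeg (H.proj_mem x _) fun w hw => ?_
    obtain ⟨W, hW, rfl⟩ := ext hw
    have e1 := hK X Y W hX.1 hY hW x
    have e2 := hK Y X W hY.1 hX hW x
    have e3 := koszul_sub_swap H.symm X Y W x
    rw [H.proj_left, htor x hX.1 hY.1]
    simp only [map_sub, LinearMap.sub_apply]
    linarith
  · intro x u hu v hv w hw
    obtain ⟨X, hX, rfl⟩ := ext' hu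
    obtain ⟨Y, hY, rfl⟩ := ext hv
    obtain ⟨W, hW, rfl⟩ := ext hw
    rw [H.proj_left, H.proj_right, htor x hX.1 hY.1, htor x hX.1 hW.1]
    have e0 : ∀ Z : ∀ x : M, Tan n x, (fun y => B y (X y) (Z y)) = fun _ => 0 := fun Z =>
      funext fun y => H.radical y _ (hX.2 y) _
    have e1 := hK X Y W hX.1 hY hW x
    have e1' := hK X W Y hX.1 hW hY x
    have e2 := H.radical x _ (h' X hX x (Y x)) (W x)
    have e3 := H.radical' (v := Y x) (h' X hX x (W x))
    have e4 := H.radical' (v := brak Y W x) (hX.2 x)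
    have e4' := H.radical' (v := brak W Y x) (hX.2 x)
    have e5 : (fun y => B y (W y) (Y y)) = fun y => B y (Y y) (W y) := funext fun y => H.symm y _ _
    rw [koszul, e0, e0, e4] at e1
    rw [koszul, e0, e0, e4', e5] at e1'
    simp only [dir, mvfderiv_const, _root_.zero_apply] at e1 e1'
    simp only [map_sub, LinearMap.sub_apply, e2, e3]
    rw [H.symm x (Y x), H.symm x (Y x)]
    linarith

end IsSplitForm

end Split

end HyperCR

namespace HyperCR

/-! ### Existence and uniqueness of the connection of a splitting. -/

section Existence

variable {n : ℕ} {M : Type*} [TopologicalSpace M] [ChartedSpace (ModelE n) M]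
  [IsManifold (𝓡 (4 * n + 3)) ∞ M]

variable {A A' : ∀ x : M, Submodule ℝ (Tan n x)} {π π' : ∀ x : M, Tan n x →ₗ[ℝ] Tan n x}
  {B B' : ∀ x : M, Tan n x →ₗ[ℝ] Tan n x →ₗ[ℝ] ℝ}

/-- The Koszul expression of the projections of `Y` and `W`. -/
def projKoszul (π : ∀ x : M, Tan n x →ₗ[ℝ] Tan n x)
    (B : ∀ x : M, Tan n x →ₗ[ℝ] Tan n x →ₗ[ℝ] ℝ) (X Y W : ∀ x : M, Tan n x) (x : M) : ℝ :=
  koszul B X (fun y => π y (Y y)) (fun y => π y (W y)) x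

namespace IsSplitForm

section Tensorial

variable {X X' Y Y' W W' : ∀ x : M, Tan n x} {x : M} {f : M → ℝ}

theorem projKoszul_add_left (H : IsSplitForm A A' π B) (hX : DiffAt X x) (hX' : DiffAt X' x)
    (hY : DiffAt Y x) (hW : DiffAt W x) :
    projKoszul π B (X + X') Y W x = projKoszul π B X Y W x + projKoszul π B X' Y W x :=
  koszul_add_left H.smooth hX hX' (H.proj_smooth.diffAt hY) (H.proj_smooth.diffAt hW)

theorem projKoszul_smul_left (H : IsSplitForm A A' π B) (hf : DiffFunAt n f x) (hX : DiffAt X x)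
    (hY : DiffAt Y x) (hW : DiffAt W x) :
    projKoszul π B (f • X) Y W x = f x * projKoszul π B X Y W x :=
  koszul_smul_left H.smooth H.symm hf hX (H.proj_smooth.diffAt hY) (H.proj_smooth.diffAt hW)

theorem projKoszul_add_mid (H : IsSplitForm A A' π B) (hX : DiffAt X x) (hY : DiffAt Y x)
    (hY' : DiffAt Y' x) (hW : DiffAt W x) :
    projKoszul π B X (Y + Y') W x = projKoszul π B X Y W x + projKoszul π B X Y' W x := by
  have e : (fun y => π y ((Y + Y') y)) = (fun y => π y (Y y)) + fun y => π y (Y' y) := by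
    funext y; simp
  rw [projKoszul, e]
  exact koszul_add_mid H.smooth hX (H.proj_smooth.diffAt hY) (H.proj_smooth.diffAt hY')
    (H.proj_smooth.diffAt hW)

theorem projKoszul_smul_mid (H : IsSplitForm A A' π B) (hf : DiffFunAt n f x) (hX : DiffAt X x)
    (hY : DiffAt Y x) (hW : DiffAt W x) :
    projKoszul π B X (f • Y) W x
      = f x * projKoszul π B X Y W x + 2 * (dir f x (X x) * B x (Y x) (W x)) := by
  have e : (fun y => π y ((f • Y) y)) = f • (fun y => π y (Y y)) := by
    funext y; simp
  rw [projKoszul, e]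
  rw [koszul_smul_mid H.smooth H.symm hf hX (H.proj_smooth.diffAt hY) (H.proj_smooth.diffAt hW),
    H.proj_left, H.proj_right]
  rfl

theorem projKoszul_add_right (H : IsSplitForm A A' π B) (hX : DiffAt X x) (hY : DiffAt Y x)
    (hW : DiffAt W x) (hW' : DiffAt W' x) :
    projKoszul π B X Y (W + W') x = projKoszul π B X Y W x + projKoszul π B X Y W' x := by
  have e : (fun y => π y ((W + W') y)) = (fun y => π y (W y)) + fun y => π y (W' y) := by
    funext y; simp
  rw [projKoszul, e]
  exact koszul_add_right H.smooth hX (H.proj_smooth.diffAt hY) (H.proj_smooth.diffAt hW)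
    (H.proj_smooth.diffAt hW')

theorem projKoszul_smul_right (H : IsSplitForm A A' π B) (hf : DiffFunAt n f x)
    (hX : DiffAt X x) (hY : DiffAt Y x) (hW : DiffAt W x) :
    projKoszul π B X Y (f • W) x = f x * projKoszul π B X Y W x := by
  have e : (fun y => π y ((f • W) y)) = f • (fun y => π y (W y)) := by
    funext y; simp
  rw [projKoszul, e]
  exact koszul_smul_right H.smooth H.symm hf hX (H.proj_smooth.diffAt hY)
    (H.proj_smooth.diffAt hW)

theorem projKoszul_smooth (H : IsSplitForm A A' π B) {U : Set M} (hU : IsOpen U)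
    (hX : SmoothOn X U) (hY : SmoothOn Y U) (hW : SmoothOn W U) :
    SmoothFun n (fun x => projKoszul π B X Y W x) U :=
  koszul_smooth H.smooth hU hX (H.proj_smooth U hU Y hY) (H.proj_smooth U hU W hW)

theorem tensorialAt_left (H : IsSplitForm A A' π B) (hY : DiffAt Y x) (hW : DiffAt W x) :
    TensorialAt (𝓡 (4 * n + 3)) (ModelE n)
      (fun X : ∀ x : M, Tan n x => projKoszul π B X Y W x) x where
  smul hf hX := H.projKoszul_smul_left hf hX hY hW
  add hX hX' := H.projKoszul_add_left hX hX' hY hW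

theorem tensorialAt_right (H : IsSplitForm A A' π B) (hX : DiffAt X x) (hY : DiffAt Y x) :
    TensorialAt (𝓡 (4 * n + 3)) (ModelE n)
      (fun W : ∀ x : M, Tan n x => projKoszul π B X Y W x) x where
  smul hf hW := H.projKoszul_smul_right hf hX hY hW
  add hW hW' := H.projKoszul_add_right hX hY hW hW'

end Tensorial

variable {D : Connection n M}

/-- A connection defined by the Koszul formulas of two complementary split forms is
half-associated to each of them. -/
theorem isHalfAssociated_of_koszul [T2Space M] (H : IsSplitForm A A' π B)
    (H' : IsSplitForm A' A π' B')
    (hK : ∀ Y x, DiffAt Y x → ∀ X W, DiffAt X x → DiffAt W x →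
      2 * (B x (D Y x (X x)) (W x) + B' x (D Y x (X x)) (W x))
        = projKoszul π B X Y W x + projKoszul π' B' X Y W x) :
    IsHalfAssociated A A' π B D := by
  have zeroK : ∀ {C C' : ∀ x : M, Submodule ℝ (Tan n x)} {ρ : ∀ x : M, Tan n x →ₗ[ℝ] Tan n x}
      {F : ∀ x : M, Tan n x →ₗ[ℝ] Tan n x →ₗ[ℝ] ℝ}, IsSplitForm C C' ρ F →
      (∀ {X Y W : ∀ x : M, Tan n x} {x : M}, IsSection C' Y → projKoszul ρ F X Y W x = 0) ∧
      (∀ {X Y W : ∀ x : M, Tan n x} {x : M}, IsSection C' W → projKoszul ρ F X Y W x = 0) := by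
    intro C C' ρ F G
    refine ⟨fun hY => ?_, fun hW => ?_⟩
    · rw [projKoszul, show (fun y => ρ y _) = fun _ => 0 from
        funext fun y => G.proj_of_mem' y _ (hY.2 y), koszul_zero_mid]
    · rw [projKoszul, show (fun y => ρ y _) = fun _ => 0 from
        funext fun y => G.proj_of_mem' y _ (hW.2 y), koszul_zero_right]
  have pres : ∀ {C C' : ∀ x : M, Submodule ℝ (Tan n x)} {ρ ρ' : ∀ x : M, Tan n x →ₗ[ℝ] Tan n x}
      {F F' : ∀ x : M, Tan n x →ₗ[ℝ] Tan n x →ₗ[ℝ] ℝ}, IsSplitForm C C' ρ F →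
      IsSplitForm C' C ρ' F' →
      (∀ Y x, DiffAt Y x → ∀ X W, DiffAt X x → DiffAt W x →
        2 * (F x (D Y x (X x)) (W x) + F' x (D Y x (X x)) (W x))
        = projKoszul ρ F X Y W x + projKoszul ρ' F' X Y W x) →
      ∀ Y, IsSection C Y → ∀ x v, D Y x v ∈ C x := by
    intro C C' ρ ρ' F F' G G' hG Y hY x v
    obtain ⟨X, hX, rfl⟩ := exists_smooth_extension v
    -- For `Y` in `C` and a test field in `C'` both Koszul expressions vanish, as each has a zero
    -- projected argument. So `D Y` is orthogonal to `C'`, and positivity of `F'` on `C'` puts it in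
    -- `C`.
    have h1 : ∀ w ∈ C' x, F' x (D Y x (X x)) w = 0 := by
      intro w hw
      obtain ⟨W₀, hW₀, rfl⟩ := exists_smooth_extension w
      have hW := G'.proj_section hW₀
      have e : ρ' x (W₀ x) = W₀ x := G'.proj_of_mem x _ hw
      have h := hG Y x (hY.diffAt x) X _ (hX.diffAt isOpen_univ (Set.mem_univ x)) (hW.diffAt x)
      rw [(zeroK G).2 hW, (zeroK G').1 hY] at h
      simp only [e] at h
      rw [G.radical' hw] at h
      linarith
    set u := D Y x (X x)
    have h2 := h1 _ (G.sub_proj_mem x u)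
    have h3 : F' x (u - ρ x u) (u - ρ x u) = 0 := by
      have := map_sub (F' x) u (ρ x u)
      rw [this, LinearMap.sub_apply, h2, G'.radical x _ (G.proj_mem x u), sub_zero]
    have h4 : u - ρ x u = 0 := by
      by_contra h0
      exact (G'.pos x _ (G.sub_proj_mem x u) h0).ne' h3
    rw [sub_eq_zero.1 h4]
    exact G.proj_mem x u
  refine H.isHalfAssociated (pres H H' hK) (pres H' H fun Y x hY X W hX hW => ?_) ?_
  · rw [add_comm, hK Y x hY X W hX hW, add_comm]
  · intro X Y W hX hY hW x
    have h := hK Y x (hY.diffAt x) X W (hX.diffAt isOpen_univ (Set.mem_univ x)) (hW.diffAt x)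
    rw [H'.radical' (hW.2 x), (zeroK H').1 hY, add_zero, add_zero, projKoszul] at h
    rw [h]
    congr 1
    · exact funext fun y => H.proj_of_mem y _ (hY.2 y)
    · exact funext fun y => H.proj_of_mem y _ (hW.2 y)

/-- Complementary split forms have a smooth connection that is half-associated to both. -/
theorem exists_connection [T2Space M] (H : IsSplitForm A A' π B) (H' : IsSplitForm A' A π' B')
    (hfr : ∀ q, ∃ (U : Set M) (ι : Type) (_ : Fintype ι) (e : ι → ∀ x : M, Tan n x),
      IsOpen U ∧ q ∈ U ∧ (∀ i, SmoothOn (e i) U) ∧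
      ∀ x ∈ U, ∀ v, v = ∑ i, (B x v (e i x) + B' x v (e i x)) • e i x) :
    ∃ D : Connection n M, CovariantDerivative.ContMDiffCovariantDerivative D ∞ ∧
      IsHalfAssociated A A' π B D ∧ IsHalfAssociated A' A π' B' D := by
  have hL : ∀ (Y : ∀ x : M, Tan n x) (x : M), ∃ L : Tan n x →L[ℝ] Tan n x, DiffAt Y x →
      ∀ X W, DiffAt X x → DiffAt W x →
        2 * (B x (L (X x)) (W x) + B' x (L (X x)) (W x))
          = projKoszul π B X Y W x + projKoszul π' B' X Y W x := by
    intro Y x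
    -- At points where `Y` is not differentiable no condition is imposed, and the value is set to
    -- zero.
    by_cases hY : DiffAt Y x
    swap
    · exact ⟨0, fun h => absurd h hY⟩
    obtain ⟨U, ι, _, e, hU, hx, he, hexp⟩ := hfr x
    have h1 : ∀ W : ∀ x : M, Tan n x, DiffAt W x → TensorialAt (𝓡 (4 * n + 3)) (ModelE n)
        (fun X : ∀ x : M, Tan n x => projKoszul π B X Y W x + projKoszul π' B' X Y W x) x :=
      fun W hW =>
      ⟨fun hf hX => by
        simp only [(H.tensorialAt_left hY hW).smul hf hX, (H'.tensorialAt_left hY hW).smul hf hX,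
          smul_eq_mul, mul_add],
      fun hX hX' => by
        simp only [(H.tensorialAt_left hY hW).add hX hX', (H'.tensorialAt_left hY hW).add hX hX']
        ring⟩
    have h2 : ∀ X : ∀ x : M, Tan n x, DiffAt X x → TensorialAt (𝓡 (4 * n + 3)) (ModelE n)
        (fun W : ∀ x : M, Tan n x => projKoszul π B X Y W x + projKoszul π' B' X Y W x) x :=
      fun X hX =>
      ⟨fun hf hW => by
        simp only [(H.tensorialAt_right hX hY).smul hf hW, (H'.tensorialAt_right hX hY).smul hf hW,
          smul_eq_mul, mul_add],
      fun hW hW' => by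
        simp only [(H.tensorialAt_right hX hY).add hW hW', (H'.tensorialAt_right hX hY).add hW hW']
        ring⟩
    let ψ : Tan n x →L[ℝ] Tan n x →L[ℝ] ℝ := TensorialAt.mkHom₂ _ x h1 h2
    have hψ : ∀ X W : ∀ x : M, Tan n x, DiffAt X x → DiffAt W x →
        ψ (X x) (W x) = projKoszul π B X Y W x + projKoszul π' B' X Y W x :=
      fun X W hX hW => TensorialAt.mkHom₂_apply h1 h2 hX hW
    have hed := fun i => (he i).diffAt hU hx
    -- The frame is its own dual basis for `B + B'`, so the vector determined by the Koszul formulas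
    -- has the halved Koszul expressions against `e i` as coefficients.
    refine ⟨∑ i, (1 / 2 : ℝ) • (TensorialAt.mkHom _ x (h1 _ (hed i))).smulRight (e i x),
      fun _ X W hX hW => ?_⟩
    have hm : ∀ i, TensorialAt.mkHom _ x (h1 _ (hed i)) (X x) = ψ (X x) (e i x) := fun i => by
      rw [hψ X _ hX (hed i)]
      exact TensorialAt.mkHom_apply _ hX
    rw [← hψ X W hX hW]
    conv_rhs => rw [hexp x hx (W x)]
    simp only [sum_apply, _root_.smul_apply, ContinuousLinearMap.smulRight_apply,
      hm, map_sum, map_smul, LinearMap.sum_apply, LinearMap.smul_apply,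
      smul_eq_mul, ← Finset.sum_add_distrib, Finset.mul_sum]
    refine Finset.sum_congr rfl fun i _ => ?_
    rw [H.symm x (W x), H'.symm x (W x)]
    ring
  choose L hL using hL
  have nondeg : ∀ {x : M} {u v : Tan n x},
      (∀ w, B x u w + B' x u w = B x v w + B' x v w) → u = v := by
    intro x u v h
    obtain ⟨U, ι, _, e, hU, hx, he, hexp⟩ := hfr x
    rw [hexp x hx u, hexp x hx v]
    simp only [h]
  let D : Connection n M :=
    { toFun := L
      isCovariantDerivativeOnUniv :=
        { add := by
            intro σ σ' x hσ hσ' _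
            refine ContinuousLinearMap.ext fun v => nondeg fun w => ?_
            obtain ⟨X, hX, rfl⟩ := exists_smooth_extension v
            obtain ⟨W, hW, rfl⟩ := exists_smooth_extension w
            have hX := hX.diffAt isOpen_univ (Set.mem_univ x)
            have hW := hW.diffAt isOpen_univ (Set.mem_univ x)
            have k1 := hL (σ + σ') x (mdifferentiableAt_add_section hσ hσ') X W hX hW
            have k2 := hL σ x hσ X W hX hW
            have k3 := hL σ' x hσ' X W hX hW
            rw [H.projKoszul_add_mid hX hσ hσ' hW, H'.projKoszul_add_mid hX hσ hσ' hW] at k1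
            simp only [_root_.add_apply, map_add, LinearMap.add_apply]
            linarith
          leibniz := by
            intro σ f x hσ hf _
            refine ContinuousLinearMap.ext fun v => nondeg fun w => ?_
            obtain ⟨X, hX, rfl⟩ := exists_smooth_extension v
            obtain ⟨W, hW, rfl⟩ := exists_smooth_extension w
            have hX := hX.diffAt isOpen_univ (Set.mem_univ x)
            have hW := hW.diffAt isOpen_univ (Set.mem_univ x)
            have k1 := hL (f • σ) x (MDifferentiableAt.smul_section hf hσ) X W hX hW
            have k2 := hL σ x hσ X W hX hW
            rw [H.projKoszul_smul_mid hf hX hσ hW, H'.projKoszul_smul_mid hf hX hσ hW] at k1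
            simp only [_root_.add_apply, map_add, LinearMap.add_apply, _root_.smul_apply,
              map_smul, LinearMap.smul_apply, smul_eq_mul, ContinuousLinearMap.smulRight_apply]
            change _ = f x * _ + dir f x (X x) * _ + (f x * _ + dir f x (X x) * _)
            linear_combination k1 / 2 - f x / 2 * k2 } }
  refine ⟨D, ⟨⟨fun {σ} hσ => ?_⟩⟩, H.isHalfAssociated_of_koszul H' fun Y x => hL Y x,
    H'.isHalfAssociated_of_koszul H fun Y x hY X W hX hW => ?_⟩
  · have hσ' : SmoothOn σ Set.univ := hσ.of_le (by simp)
    refine (contMDiff_end_of_apply (A := L σ) fun U hU X hX => ?_).contMDiffOn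
    refine SmoothOn.of_locally fun q hq => ?_
    obtain ⟨V, ι, _, e, hV, hqV, he, hexp⟩ := hfr q
    have hX' := hX.mono (V := U ∩ V) Set.inter_subset_left
    have hs' := hσ'.mono (V := U ∩ V) (Set.subset_univ _)
    have he' := fun i => (he i).mono (V := U ∩ V) Set.inter_subset_right
    have hUV := hU.inter hV
    refine ⟨U ∩ V, hUV, ⟨hq, hqV⟩, ?_⟩
    -- Near `q` the same expansion holds with one fixed smooth frame, so smoothness does not depend
    -- on the pointwise choices in `L`.
    have : SmoothOn (fun x => ∑ i, ((1 / 2 : ℝ) * (projKoszul π B X σ (e i) x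
        + projKoszul π' B' X σ (e i) x)) • e i x) (U ∩ V) :=
      SmoothOn.sum fun i _ => SmoothOn.smul ((SmoothFun.const _).mul
        ((H.projKoszul_smooth hUV hX' hs' (he' i)).add
          (H'.projKoszul_smooth hUV hX' hs' (he' i)))) (he' i)
    refine this.congr fun x hx => ?_
    conv_lhs => rw [hexp x hx.2 ((L σ x : Tan n x →ₗ[ℝ] Tan n x) (X x))]
    refine Finset.sum_congr rfl fun i _ => ?_
    rw [← hL σ x (hs'.diffAt hUV hx) X (e i) (hX'.diffAt hUV hx) ((he' i).diffAt hUV hx)]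
    congr 1
    rw [ContinuousLinearMap.coe_coe]
    ring
  · have := hL Y x hY X W hX hW
    rw [add_comm (projKoszul _ _ _ _ _ _)]
    rw [← this, add_comm]

/-- The Koszul formula determines half-associated connections on sections of `A`. -/
theorem eq_of_isHalfAssociated [T2Space M] (H : IsSplitForm A A' π B) {D' : Connection n M}
    (hD : IsHalfAssociated A A' π B D) (hD' : IsHalfAssociated A A' π B D')
    {Y : ∀ x : M, Tan n x} (hY : IsSection A Y) (x : M) : D Y x = D' Y x := by
  refine ContinuousLinearMap.ext fun v => ?_
  obtain ⟨X, hX, rfl⟩ := exists_smooth_extension v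
  rw [← sub_eq_zero]
  by_contra h0
  have hm : D Y x (X x) - D' Y x (X x) ∈ A x :=
    sub_mem (hD.preserves Y hY x _) (hD'.preserves Y hY x _)
  refine (H.pos x _ hm h0).ne' ?_
  obtain ⟨W, hW, hWx⟩ := exists_smooth_extension (D Y x (X x) - D' Y x (X x))
  have hW' := H.proj_section hW
  have e : π x (W x) = W x := H.proj_of_mem x _ (hWx ▸ hm)
  have h1 := H.koszul_eq hD hX hY hW' x
  have h2 := H.koszul_eq hD' hX hY hW' x
  simp only [e] at h1 h2
  rw [hWx] at h1 h2
  rw [map_sub (B x), LinearMap.sub_apply]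
  linarith

/-- Connections that are half-associated to complementary split forms are the same. -/
theorem sameConnection [T2Space M] (H : IsSplitForm A A' π B) (H' : IsSplitForm A' A π' B')
    {D' : Connection n M}
    (h₁ : IsHalfAssociated A A' π B D) (h₂ : IsHalfAssociated A' A π' B' D)
    (h₁' : IsHalfAssociated A A' π B D') (h₂' : IsHalfAssociated A' A π' B' D') :
    SameConnection D D' := by
  intro Y x hY
  -- The difference of two connections is tensorial. Hence only the value `Y x` matters, and it can
  -- be extended by the sum of a smooth section of `A` and one of `A'`.
  have hd : ∀ {Z : ∀ x : M, Tan n x}, DiffAt Z x →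
      IsCovariantDerivativeOn.difference (F := ModelE n) (s := Set.univ) D.isCovariantDerivativeOn
        D'.isCovariantDerivativeOn x (Z x) = D Z x - D' Z x := fun hZ =>
    IsCovariantDerivativeOn.difference_apply _ _ (Set.mem_univ x) hZ
  have h := hd hY
  have h0 : IsCovariantDerivativeOn.difference (F := ModelE n) (s := Set.univ) D.isCovariantDerivativeOn
        D'.isCovariantDerivativeOn x (Y x) = 0 := by
    obtain ⟨Z, hZ, hZx⟩ := exists_smooth_extension (Y x)
    have k1 := H.proj_section hZ
    have k2 := H.sub_proj_section hZ
    have e : Y x = π x (Z x) + (Z x - π x (Z x)) := by rw [hZx]; abel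
    rw [e, map_add, hd (k1.diffAt x), hd (k2.diffAt x), H.eq_of_isHalfAssociated h₁ h₁' k1,
      H'.eq_of_isHalfAssociated h₂ h₂' k2, sub_self, sub_self, add_zero]
  rw [h0] at h
  exact sub_eq_zero.1 h.symm

end IsSplitForm

end Existence

end HyperCR

namespace HyperCR

/-! ### The associated connection of a normalized triple. -/

namespace HyperPseudohermitian

variable {n : ℕ} {M : Type*} [TopologicalSpace M] [ChartedSpace (ModelE n) M]
  [IsManifold (𝓡 (4 * n + 3)) ∞ M] {S : HyperPseudohermitian n M}
  {T : Fin 3 → ∀ x : M, Tan n x} {D : Connection n M}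

theorem IsNormalized.isSplitForm_gForm [T2Space M] (hT : S.IsNormalized T) :
    IsSplitForm S.Q (AlmostHyperCR.planeField T) (S.proj T) (S.gForm T) where
  proj_mem := hT.proj_mem
  sub_proj_mem := hT.sub_proj_mem
  proj_of_mem _ _ hv := proj_of_mem T hv
  proj_of_mem' _ _ hv := hT.mem_planeField.1 hv
  proj_smooth := hT.proj_smooth
  radical x v hv w := by
    rw [hT.gForm_symm, gForm_apply, hT.mem_planeField.1 hv]
    rw [← proj_of_mem T (zero_mem (S.Q x)), ← gForm_apply, map_zero]
  symm := hT.gForm_symm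
  smooth := hT.gForm_smooth
  pos _ _ hv h0 := IsNormalized.gForm_pos T hv h0

theorem IsNormalized.isSplitForm_gPerpForm [T2Space M] (hT : S.IsNormalized T) :
    IsSplitForm (AlmostHyperCR.planeField T) S.Q (fun x => LinearMap.id - S.proj T x)
      S.gPerpForm where
  proj_mem := hT.sub_proj_mem
  sub_proj_mem x v := by
    rw [LinearMap.sub_apply, LinearMap.id_apply, sub_sub_cancel]
    exact hT.proj_mem x v
  proj_of_mem x v hv := by simp [hT.mem_planeField.1 hv]
  proj_of_mem' x v hv := by simp [proj_of_mem T hv]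
  proj_smooth U hU X hX := hX.sub (hT.proj_smooth U hU X hX)
  radical x v hv w := by simp [gPerpForm_apply, gPerp, S.mem_Q_iff.1 hv]
  symm := gPerpForm_symm
  smooth := gPerpForm_smooth
  pos x v hv h0 := by
    rw [gPerpForm_apply, gPerp]
    by_contra h
    have h1 : ∀ a ∈ Finset.univ, 0 ≤ S.θ a x v * S.θ a x v := fun a _ => mul_self_nonneg _
    have h2 := (Finset.sum_eq_zero_iff_of_nonneg h1).1
      (le_antisymm (not_lt.1 h) (Finset.sum_nonneg h1))
    refine h0 ?_
    rw [← hT.mem_planeField.1 hv, proj_of_mem T]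
    exact S.mem_Q_iff.2 fun a => mul_self_eq_zero.1 (h2 a (Finset.mem_univ a))

/-- The conditions split into two halves of the same shape, with the roles of `Q` and `Q^⊥`
exchanged. In (d) the arguments of the torsion come in the opposite order; the resulting signs
cancel between the two sides. -/
theorem IsNormalized.isAssociated_iff [T2Space M] (hT : S.IsNormalized T) :
    S.IsAssociated (AlmostHyperCR.planeField T) D ↔
      CovariantDerivative.ContMDiffCovariantDerivative D ∞ ∧
      IsHalfAssociated S.Q (AlmostHyperCR.planeField T) (S.proj T) (S.gForm T) D ∧
      IsHalfAssociated (AlmostHyperCR.planeField T) S.Q (fun x => LinearMap.id - S.proj T x)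
        S.gPerpForm D := by
  have hg : ∀ {Y Z : ∀ x : M, Tan n x}, IsSection S.Q Y → IsSection S.Q Z →
      (fun y => S.g y (Y y) (Z y)) = fun y => S.gForm T y (Y y) (Z y) := fun hY hZ =>
    funext fun y => (gForm_of_mem T (hY.2 y) (hZ.2 y)).symm
  have hcomp : ∀ x X U, component (AlmostHyperCR.planeField T x) (S.Q x) (D.torsion x U X)
      = -(D.torsion x X U - S.proj T x (D.torsion x X U)) := fun x X U => by
    rw [hT.component_P, D.torsion_antisymm, map_neg, ← neg_sub_neg, sub_neg_eq_add]
    abel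
  constructor
  · intro h
    refine ⟨h.smooth, ⟨h.preserves_Q, h.preserves_P, ?_, ?_, ?_⟩,
      ⟨h.preserves_P, h.preserves_Q, ?_, ?_, ?_⟩⟩
    · intro Y Z hY hZ x v
      rw [gForm_of_mem T (h.preserves_Q Y hY x v) (hZ.2 x),
        gForm_of_mem T (hY.2 x) (h.preserves_Q Z hZ x v), ← hg hY hZ]
      exact h.parallel_g Y Z hY hZ x v
    · intro x X hX Y hY
      rw [← hT.component_Q]
      exact h.torsion_QQ x X hX Y hY
    · intro x U hU X hX Y hY
      rw [gForm_of_mem T (hT.proj_mem x _) hY, gForm_of_mem T hX (hT.proj_mem x _),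
        ← hT.component_Q, ← hT.component_Q]
      exact h.torsion_symm_Q x U hU X hX Y hY
    · intro Y Z hY hZ x v
      simp only [gPerpForm_apply]
      exact h.parallel_gPerp Y Z hY hZ x v
    · intro x X hX Y hY
      rw [LinearMap.sub_apply, LinearMap.id_apply, ← hT.component_P]
      exact h.torsion_PP x X hX Y hY
    · intro x X hX U hU V hV
      have := h.torsion_symm_P x X hX U hU V hV
      rw [hcomp, hcomp, ← gPerpForm_apply, ← gPerpForm_apply, map_neg, map_neg,
        LinearMap.neg_apply, neg_inj] at this
      exact this
  · rintro ⟨h0, h1, h2⟩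
    refine ⟨h0, h1.preserves, h1.preserves', ?_, ?_, ?_, ?_, ?_, ?_⟩
    · intro Y Z hY hZ x v
      have := h1.parallel Y Z hY hZ x v
      rw [gForm_of_mem T (h1.preserves Y hY x v) (hZ.2 x),
        gForm_of_mem T (hY.2 x) (h1.preserves Z hZ x v), ← hg hY hZ] at this
      exact this
    · intro Y Z hY hZ x v
      have := h2.parallel Y Z hY hZ x v
      simp only [gPerpForm_apply] at this
      exact this
    · intro x X hX Y hY
      rw [hT.component_Q]
      exact h1.torsion x X hX Y hY
    · intro x X hX Y hY
      rw [hT.component_P]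
      exact h2.torsion x X hX Y hY
    · intro x U hU X hX Y hY
      rw [hT.component_Q, hT.component_Q, ← gForm_of_mem T (hT.proj_mem x _) hY,
        ← gForm_of_mem T hX (hT.proj_mem x _)]
      exact h1.torsion_symm x U hU X hX Y hY
    · intro x X hX U hU V hV
      have := h2.torsion_symm x X hX U hU V hV
      rw [hcomp, hcomp, ← gPerpForm_apply, ← gPerpForm_apply, map_neg, map_neg,
        LinearMap.neg_apply, neg_inj]
      exact this

/-- An orthonormal family is independent, and `4n` is the rank of `Q`. -/
theorem IsNormalized.expand_adaptedFrame (hT : S.IsNormalized T) {U : Set M}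
    {ε : Idx n → ∀ x : M, Tan n x} (hε : S.IsAdaptedFrame U ε) {x : M} (hx : x ∈ U)
    {v : Tan n x} (hv : v ∈ S.Q x) : v = ∑ i, S.gForm T x v (ε i x) • ε i x := by
  let e : Idx n → S.Q x := fun i => ⟨ε i x, hε.mem i x hx⟩
  have ho : ∀ i j, S.gForm T x (ε i x) (ε j x) = if i = j then 1 else 0 := fun i j => by
    rw [gForm_of_mem T (hε.mem i x hx) (hε.mem j x hx), hε.orthonormal i j x hx]
  have hcoef : ∀ (c : Idx n → ℝ) j, S.gForm T x (∑ i, c i • ε i x) (ε j x) = c j := fun c j => by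
    simp [ho]
  have hli : LinearIndependent ℝ e := by
    rw [Fintype.linearIndependent_iff]
    intro c hc j
    have h1 : ∑ i, c i • ε i x = 0 := by
      have := congrArg Subtype.val hc
      simpa [e] using this
    rw [← hcoef c j, h1, map_zero, LinearMap.zero_apply]
  have hcard : Fintype.card (Idx n) = Module.finrank ℝ (S.Q x) := by
    rw [hT.finrank_Q]; simp [mul_comm]
  have : FiniteDimensional ℝ (Tan n x) :=
    inferInstanceAs (FiniteDimensional ℝ (ModelE n))
  rcases isEmpty_or_nonempty (Idx n) with hE | hE
  -- For an empty index set (`n = 0`) the basis construction does not apply, but then `Q` is zero.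
  · have h0 : Module.finrank ℝ (S.Q x) = 0 := by rw [← hcard, Fintype.card_eq_zero]
    rw [Submodule.finrank_eq_zero.1 h0, Submodule.mem_bot] at hv
    simp [hv]
  · let b := basisOfLinearIndependentOfCardEqFinrank hli hcard
    have h1 : v = ∑ i, b.repr ⟨v, hv⟩ i • ε i x := by
      have := congrArg Subtype.val (b.sum_repr ⟨v, hv⟩)
      simpa [b, e] using this.symm
    have h2 : ∀ j, b.repr ⟨v, hv⟩ j = S.gForm T x v (ε j x) := fun j => by
      conv_rhs => rw [h1]
      rw [hcoef]
    simpa only [h2] using h1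

/-- An adapted frame of `Q` together with the triple itself is orthonormal for the sum of the two
extended forms; this is the local frame the existence result asks for. -/
theorem IsNormalized.exists_isAssociated [T2Space M] (hT : S.IsNormalized T) :
    ∃ D, S.IsAssociated (AlmostHyperCR.planeField T) D := by
  simp only [hT.isAssociated_iff]
  refine hT.isSplitForm_gForm.exists_connection hT.isSplitForm_gPerpForm fun q => ?_
  obtain ⟨U, ε, hε, hq⟩ := hT.exists_adaptedFrame q
  refine ⟨U, Idx n ⊕ Fin 3, inferInstance, Sum.elim ε T, hε.isOpen, hq, ?_, fun x hx v => ?_⟩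
  · rintro (i | a)
    · exact hε.smooth i
    · exact (hT.triple.smooth a).mono (Set.subset_univ _)
  · rw [Fintype.sum_sum_type]
    have h1 : ∀ i, S.gPerpForm x v (ε i x) = 0 := fun i =>
      hT.isSplitForm_gPerpForm.radical' (hε.mem i x hx)
    have h2 : ∀ a, S.gForm T x v (T a x) = 0 := fun a =>
      hT.isSplitForm_gForm.radical' (Submodule.subset_span ⟨a, rfl⟩)
    have h3 : ∀ a, S.gPerpForm x v (T a x) = S.θ a x v := fun a => by
      simp [gPerpForm_apply, gPerp, hT.theta_apply]
    simp only [Sum.elim_inl, Sum.elim_inr, h1, h2, h3, add_zero, zero_add]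
    have h4 := hT.expand_adaptedFrame hε hx (hT.proj_mem x v)
    simp only [hT.isSplitForm_gForm.proj_left] at h4
    rw [← h4, proj_apply, sub_add_cancel]

theorem IsNormalized.sameConnection [T2Space M] (hT : S.IsNormalized T) {D' : Connection n M}
    (h : S.IsAssociated (AlmostHyperCR.planeField T) D)
    (h' : S.IsAssociated (AlmostHyperCR.planeField T) D') : SameConnection D D' := by
  rw [hT.isAssociated_iff] at h h'
  exact hT.isSplitForm_gForm.sameConnection hT.isSplitForm_gPerpForm h.2.1 h.2.2 h'.2.1 h'.2.2

/-- The connection forms of an associated connection, by the Koszul formula. -/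
theorem IsNormalized.omega_apply [T2Space M] (hT : S.IsNormalized T)
    (h : S.IsAssociated (AlmostHyperCR.planeField T) D) {U : Set M}
    {ε : Idx n → ∀ x : M, Tan n x} (hε : S.IsAdaptedFrame U ε) {q : M} (hq : q ∈ U)
    (i j k : Idx n) :
    S.omega D ε q k (i, j) = koszul (S.gForm T) (ε k) (ε j) (ε i) q / 2 := by
  -- The conditions on an associated connection concern global sections of `Q`, so each frame field
  -- is replaced by a global section with the same germ at `q`.
  have hglob : ∀ i, ∃ E : ∀ x : M, Tan n x, IsSection S.Q E ∧ ∀ᶠ y in 𝓝 q, E y = ε i y := by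
    intro i
    obtain ⟨f, hf, hf1, hf0⟩ := (hε.smooth i).exists_global hε.isOpen hq
    refine ⟨_, ⟨hf, fun x => ?_⟩, hf1.mono fun y hy => by rw [hy, one_smul]⟩
    by_cases hx : x ∈ U
    · exact Submodule.smul_mem _ _ (hε.mem i x hx)
    · rw [hf0 x hx, zero_smul]; exact zero_mem _
  obtain ⟨Ei, hEi, hi⟩ := hglob i
  obtain ⟨Ej, hEj, hj⟩ := hglob j
  obtain ⟨Ek, hEk, hk⟩ := hglob k
  have hD : D (ε j) q = D Ej q :=
    D.isCovariantDerivativeOnUniv.congr_of_eventuallyEq ((hε.smooth j).diffAt hε.isOpen hq)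
      (hEj.diffAt q) Filter.univ_mem (hj.mono fun y hy => hy.symm)
  have h1 := hT.isSplitForm_gForm.koszul_eq (hT.isAssociated_iff.1 h).2.1 hEk.1 hEj hEi q
  rw [koszul_congr hk hj hi] at h1
  change S.g q (D (ε j) q (ε k q)) (ε i q) = _
  rw [hD, ← h1, ← hk.self_of_nhds, ← hi.self_of_nhds,
    gForm_of_mem T (h.preserves_Q Ej hEj q _) (hEi.2 q)]
  ring

end HyperPseudohermitian

end HyperCR

namespace HyperCR

/-! ### Quaternionic linear algebra and the projection to `(sp(n) + sp(1))^⊥`. -/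

section QuaternionMatrices

open Matrix
open scoped Kronecker RealInnerProductSpace

theorem unitMat_sq (a : Fin 3) : unitMat a * unitMat a = -1 := by
  fin_cases a <;> ext i j <;> fin_cases i <;> fin_cases j <;>
    simp [unitMat, Matrix.mul_apply, Fin.sum_univ_four]

theorem unitMat_mul (a : Fin 3) : unitMat a * unitMat (a + 1) = unitMat (a + 2) := by
  fin_cases a <;> ext i j <;> fin_cases i <;> fin_cases j <;>
    simp [unitMat, Matrix.mul_apply, Fin.sum_univ_four]

theorem unitMat_transpose (a : Fin 3) : (unitMat a)ᵀ = -unitMat a := by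
  fin_cases a <;> ext i j <;> fin_cases i <;> fin_cases j <;> simp [unitMat]

variable {n : ℕ}

variable (n) in
/-- `I`, `J`, `K` on `ℝ^{4n}`. -/
def quat (a : Fin 3) : Matrix (Idx n) (Idx n) ℝ := toMat (quatMat n a)

theorem quat_eq (a : Fin 3) : quat n a = (1 : Matrix (Fin n) (Fin n) ℝ) ⊗ₖ unitMat a := by
  ext i j
  simp [quat, toMat, quatMat, Matrix.one_apply]

theorem quat_sq (a : Fin 3) : quat n a * quat n a = -1 := by
  rw [quat_eq, ← Matrix.mul_kronecker_mul, unitMat_sq, one_mul]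
  ext i j
  simp [Matrix.one_apply, Prod.ext_iff]
  split_ifs <;> simp_all

theorem quat_mul (a : Fin 3) : quat n a * quat n (a + 1) = quat n (a + 2) := by
  rw [quat_eq, quat_eq, quat_eq, ← Matrix.mul_kronecker_mul, unitMat_mul, one_mul]

theorem quat_transpose (a : Fin 3) : (quat n a)ᵀ = -quat n a := by
  rw [quat_eq]
  ext i j
  have := congrFun (congrFun (unitMat_transpose a) i.2) j.2
  simp only [Matrix.transpose_apply, Matrix.neg_apply] at this
  simp [Matrix.one_apply, this, eq_comm]

theorem quat_mul_rev (a : Fin 3) : quat n (a + 1) * quat n a = -quat n (a + 2) := by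
  have h := congrArg Matrix.transpose (quat_mul (n := n) a)
  rwa [Matrix.transpose_mul, quat_transpose, quat_transpose, quat_transpose, neg_mul_neg] at h

theorem fin3_add (a : Fin 3) : a + 1 + 1 = a + 2 ∧ a + 1 + 2 = a ∧ a + 2 + 1 = a ∧ a + 2 + 2 = a + 1 := by
  revert a; decide

theorem sum_fin3 {N : Type*} [AddCommMonoid N] (f : Fin 3 → N) (a : Fin 3) :
    ∑ b, f b = f a + f (a + 1) + f (a + 2) := by
  rw [Fin.sum_univ_three]
  fin_cases a
  · rfl
  · change f 0 + f 1 + f 2 = f 1 + f 2 + f 0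
    abel
  · change f 0 + f 1 + f 2 = f 2 + f 0 + f 1
    abel

theorem quat_mul_all (a : Fin 3) :
    quat n a * quat n (a + 1) = quat n (a + 2) ∧ quat n (a + 1) * quat n (a + 2) = quat n a ∧
    quat n (a + 2) * quat n a = quat n (a + 1) ∧ quat n (a + 1) * quat n a = -quat n (a + 2) ∧
    quat n (a + 2) * quat n (a + 1) = -quat n a ∧ quat n a * quat n (a + 2) = -quat n (a + 1) := by
  obtain ⟨h1, h2, h3, h4⟩ := fin3_add a
  have k1 := quat_mul (n := n) (a + 1)
  have k2 := quat_mul (n := n) (a + 2)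
  have k3 := quat_mul_rev (n := n) (a + 1)
  have k4 := quat_mul_rev (n := n) (a + 2)
  rw [h1, h2] at k1 k3
  rw [h3, h4] at k2 k4
  exact ⟨quat_mul a, k1, k2, quat_mul_rev a, k3, k4⟩

theorem fin3_eq_of_ne {a b : Fin 3} (h : a ≠ b) : b = a + 1 ∨ b = a + 2 := by
  revert a b; decide

theorem quat_conj (a b : Fin 3) (h : a ≠ b) : quat n a * quat n b * quat n a = quat n b := by
  obtain ⟨h1, h2, h3, h4, h5, h6⟩ := quat_mul_all (n := n) a
  rcases fin3_eq_of_ne h with rfl | rfl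
  · rw [h1, h3]
  · rw [h6, neg_mul, h4, neg_neg]

theorem trace_symm_mul_skew {S R : Matrix (Idx n) (Idx n) ℝ} (hS : Sᵀ = S) (hR : Rᵀ = -R) :
    (S * R).trace = 0 := by
  have h : (S * R).trace = -(S * R).trace := by
    conv_lhs => rw [← Matrix.trace_transpose, Matrix.transpose_mul, hS, hR, neg_mul,
      Matrix.trace_neg, Matrix.trace_mul_comm]
  linarith

theorem trace_one_idx : (1 : Matrix (Idx n) (Idx n) ℝ).trace = 4 * n := by
  rw [Matrix.trace_one]; simp [mul_comm]

theorem trace_quat_mul_quat (a b : Fin 3) :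
    (quat n a * quat n b).trace = if a = b then -(4 * n : ℝ) else 0 := by
  split_ifs with h
  · rw [h, quat_sq, Matrix.trace_neg, trace_one_idx]
  · have h0 : ∀ c, (quat n c).trace = 0 := fun c => by
      have := trace_symm_mul_skew (S := 1) (R := quat n c) Matrix.transpose_one (quat_transpose c)
      rwa [one_mul] at this
    obtain ⟨h1, h2, h3, h4, h5, h6⟩ := quat_mul_all (n := n) a
    rcases fin3_eq_of_ne h with rfl | rfl
    · rw [h1, h0]
    · rw [h6, Matrix.trace_neg, h0, neg_zero]

/-- The projection of `so(4n)` to `(sp(n) + sp(1))^⊥`. -/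
def obsMat (W : Matrix (Idx n) (Idx n) ℝ) : Matrix (Idx n) (Idx n) ℝ :=
  (3 / 4 : ℝ) • W + (1 / 4 : ℝ) • ∑ a, quat n a * W * quat n a
    - ∑ a, ((Wᵀ * quat n a).trace / (4 * n)) • quat n a

theorem obsMat_transpose {W : Matrix (Idx n) (Idx n) ℝ} (hW : Wᵀ = -W) :
    (obsMat W)ᵀ = -obsMat W := by
  simp only [obsMat, Matrix.transpose_sub, Matrix.transpose_add, Matrix.transpose_smul,
    Matrix.transpose_sum, Matrix.transpose_mul, hW, quat_transpose, smul_neg, neg_mul, mul_neg,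
    neg_neg, Finset.sum_neg_distrib, Matrix.mul_assoc]
  abel

/-- Conjugation by the three units reproduces the component along `quat n b` with signs `-1, 1, 1`,
so the terms of `obsMat` contribute `3/4 + 1/4 - 1 = 0`. -/
theorem trace_obsMat_mul_quat (hn : n ≠ 0) {W : Matrix (Idx n) (Idx n) ℝ} (hW : Wᵀ = -W)
    (b : Fin 3) : (obsMat W * quat n b).trace = 0 := by
  have h1 : ∀ a, (quat n a * W * quat n a * quat n b).trace
      = if a = b then -(W * quat n b).trace else (W * quat n b).trace := by
    intro a
    rw [Matrix.mul_assoc, Matrix.mul_assoc, Matrix.trace_mul_comm, Matrix.mul_assoc]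
    split_ifs with h
    · rw [h, quat_sq, neg_one_mul, mul_neg, Matrix.trace_neg]
    · rw [quat_conj a b h]
  have h2 : ∀ a, (Wᵀ * quat n a).trace / (4 * n) * (quat n a * quat n b).trace
      = if a = b then (W * quat n b).trace else 0 := by
    intro a
    have : (n : ℝ) ≠ 0 := Nat.cast_ne_zero.2 hn
    rw [trace_quat_mul_quat, hW, neg_mul, Matrix.trace_neg]
    split_ifs with h
    · rw [h]; field_simp
    · simp
  simp only [obsMat, Matrix.sub_mul, Matrix.add_mul, Matrix.smul_mul, Matrix.sum_mul,
    Matrix.trace_sub, Matrix.trace_add, Matrix.trace_smul, Matrix.trace_sum, smul_eq_mul, h1, h2]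
  have hb : ∀ b : Fin 3, b + 1 ≠ b ∧ b + 2 ≠ b := by decide
  rw [sum_fin3 _ b, sum_fin3 _ b]
  simp [hb b]
  ring

/-- Each unit is the product of the other two, which anticommute; cycling one of them past `R` under
the trace reverses the sign. -/
theorem trace_mul_quat_of_commute {R : Matrix (Idx n) (Idx n) ℝ}
    (hR : ∀ a, R * quat n a = quat n a * R) (a : Fin 3) : (R * quat n a).trace = 0 := by
  obtain ⟨h1, h2, h3, h4, h5, h6⟩ := quat_mul_all (n := n) a
  have h : (R * quat n a).trace = -(R * quat n a).trace := by
    conv_lhs => rw [← h2, ← Matrix.mul_assoc, Matrix.trace_mul_comm, ← Matrix.mul_assoc, ← hR,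
      Matrix.mul_assoc, h5, mul_neg, Matrix.trace_neg]
  linarith

/-- Against a matrix commuting with the units, each of the three conjugations acts as `-1`, so the
first two terms cancel as `3/4 - 3/4`. The last is killed by `trace_mul_quat_of_commute`. -/
theorem trace_obsMat_mul_of_commute (W : Matrix (Idx n) (Idx n) ℝ) {R : Matrix (Idx n) (Idx n) ℝ}
    (hR : ∀ a, R * quat n a = quat n a * R) : (obsMat W * R).trace = 0 := by
  have h1 : ∀ a, (quat n a * W * quat n a * R).trace = -(W * R).trace := by
    intro a
    rw [Matrix.mul_assoc, Matrix.mul_assoc, Matrix.trace_mul_comm, Matrix.mul_assoc, ← hR,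
      Matrix.mul_assoc, quat_sq, mul_neg_one, mul_neg, Matrix.trace_neg]
  have h2 : ∀ a, (quat n a * R).trace = 0 := fun a => by
    rw [← hR, trace_mul_quat_of_commute hR]
  simp only [obsMat, Matrix.sub_mul, Matrix.add_mul, Matrix.smul_mul, Matrix.sum_mul,
    Matrix.trace_sub, Matrix.trace_add, Matrix.trace_smul, Matrix.trace_sum, smul_eq_mul, h1, h2]
  simp
  ring

/-- The projection of `so(4n)` to `sp(n)`, up to a factor. -/
theorem commute_quat (W : Matrix (Idx n) (Idx n) ℝ) (b : Fin 3) :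
    (W - ∑ a, quat n a * W * quat n a) * quat n b
      = quat n b * (W - ∑ a, quat n a * W * quat n a) := by
  obtain ⟨h1, h2, h3, h4, h5, h6⟩ := quat_mul_all (n := n) b
  have e1 : quat n b * W * quat n b * quat n b = -(quat n b * W) := by
    rw [Matrix.mul_assoc, quat_sq, mul_neg_one]
  have e2 : quat n (b + 1) * W * quat n (b + 1) * quat n b
      = -(quat n (b + 1) * W * quat n (b + 2)) := by
    rw [Matrix.mul_assoc, h4, mul_neg]
  have e3 : quat n (b + 2) * W * quat n (b + 2) * quat n b
      = quat n (b + 2) * W * quat n (b + 1) := by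
    rw [Matrix.mul_assoc, h3]
  have f1 : quat n b * (quat n b * W * quat n b) = -(W * quat n b) := by
    rw [← Matrix.mul_assoc, ← Matrix.mul_assoc, quat_sq, neg_one_mul, neg_mul]
  have f2 : quat n b * (quat n (b + 1) * W * quat n (b + 1))
      = quat n (b + 2) * W * quat n (b + 1) := by
    rw [← Matrix.mul_assoc, ← Matrix.mul_assoc, h1]
  have f3 : quat n b * (quat n (b + 2) * W * quat n (b + 2))
      = -(quat n (b + 1) * W * quat n (b + 2)) := by
    rw [← Matrix.mul_assoc, ← Matrix.mul_assoc, h6, neg_mul, neg_mul]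
  rw [sum_fin3 _ b, sub_mul, add_mul, add_mul, mul_sub, mul_add, mul_add, e1, e2, e3, f1, f2, f3]
  abel

theorem inner_eq_trace (A B : Gl n) : ⟪A, B⟫ = ((toMat A)ᵀ * toMat B).trace := by
  rw [PiLp.inner_apply, Fintype.sum_prod_type (α₁ := Idx n) (α₂ := Idx n), Finset.sum_comm]
  refine Finset.sum_congr rfl fun i _ => ?_
  rw [Matrix.diag_apply, Matrix.mul_apply]
  refine Finset.sum_congr rfl fun j _ => ?_
  simp [toMat, mul_comm]

/-- A matrix as an element of `Gl n`. -/
def ofMat (A : Matrix (Idx n) (Idx n) ℝ) : Gl n := WithLp.toLp 2 fun p => A p.1 p.2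

@[simp] theorem toMat_ofMat (A : Matrix (Idx n) (Idx n) ℝ) : toMat (ofMat A) = A := rfl

theorem toMat_injective : Function.Injective (toMat : Gl n → Matrix (Idx n) (Idx n) ℝ) := by
  intro A B h
  ext p
  exact congrFun (congrFun h p.1) p.2

theorem toMat_sub (A B : Gl n) : toMat (A - B) = toMat A - toMat B := rfl

theorem mem_so_iff {A : Gl n} : A ∈ so n ↔ (toMat A)ᵀ = -toMat A := by
  constructor
  · intro h
    ext i j
    exact h j i
  · intro h i j
    exact congrFun (congrFun h j) i

/-- The map `W ↦ W - ∑ q_a W q_a` is multiplication by `4` on matrices commuting with the units, so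
a quarter of it is the `sp(n)`-part. The `sp(1)`-part has coefficients `⟨W, q_a⟩ / |q_a|²` with
`|q_a|² = 4n`. Removing both from `W` leaves `obsMat W`. -/
theorem starProjection_obsSpace (hn : n ≠ 0) {A : Gl n} (hA : A ∈ so n) :
    (obsSpace n).starProjection A = ofMat (obsMat (toMat A)) := by
  rw [mem_so_iff] at hA
  have h1 : ofMat (obsMat (toMat A)) ∈ obsSpace n := by
    refine ⟨mem_so_iff.2 (obsMat_transpose hA), (Submodule.mem_orthogonal _ _).2 fun B hB => ?_⟩
    rw [real_inner_comm, inner_eq_trace, toMat_ofMat, obsMat_transpose hA, neg_mul,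
      Matrix.trace_neg, neg_eq_zero]
    obtain ⟨C, hC, E, hE, rfl⟩ := Submodule.mem_sup.1 hB
    have hadd : ∀ C E : Gl n, toMat (C + E) = toMat C + toMat E := fun _ _ => rfl
    have hsmul : ∀ (c : ℝ) (E : Gl n), toMat (c • E) = c • toMat E := fun _ _ => rfl
    rw [hadd, mul_add, Matrix.trace_add, trace_obsMat_mul_of_commute _ hC.2, zero_add]
    clear hB
    induction hE using Submodule.span_induction with
    | mem E hE => obtain ⟨a, rfl⟩ := hE; exact trace_obsMat_mul_quat hn hA a
    | zero => rw [show toMat (0 : Gl n) = 0 from rfl, mul_zero, Matrix.trace_zero]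
    | add E E' _ _ h h' => rw [hadd, mul_add, Matrix.trace_add, h, h', add_zero]
    | smul c E _ h => rw [hsmul, mul_smul_comm, Matrix.trace_smul, h, smul_zero]
  have h2 : A - ofMat (obsMat (toMat A)) ∈ (obsSpace n)ᗮ := by
    have hle : spn n ⊔ sp1 n ≤ (obsSpace n)ᗮ :=
      (Submodule.le_orthogonal_orthogonal _).trans (Submodule.orthogonal_le inf_le_right)
    refine hle ?_
    have e : A - ofMat (obsMat (toMat A))
        = (1 / 4 : ℝ) • ofMat (toMat A - ∑ a, quat n a * toMat A * quat n a)
          + ∑ a, (((toMat A)ᵀ * quat n a).trace / (4 * n)) • quatMat n a := by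
      have hs : ∀ c : Fin 3 → ℝ, toMat (∑ a, c a • quatMat n a) = ∑ a, c a • quat n a := fun c => by
        simp only [Fin.sum_univ_three]; rfl
      refine toMat_injective ?_
      rw [toMat_sub, toMat_ofMat, show ∀ C E : Gl n, toMat (C + E) = toMat C + toMat E from
        fun _ _ => rfl, hs, show ∀ (c : ℝ) (E : Gl n), toMat (c • E) = c • toMat E from
        fun _ _ => rfl, toMat_ofMat, obsMat]
      module
    rw [e]
    refine Submodule.add_mem_sup (Submodule.smul_mem _ _ ⟨mem_so_iff.2 ?_, commute_quat _⟩)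
      (sum_mem fun a _ => Submodule.smul_mem _ _ (Submodule.subset_span ⟨a, rfl⟩))
    simp only [toMat_ofMat, Matrix.transpose_sub, Matrix.transpose_sum, Matrix.transpose_mul, hA,
      quat_transpose, neg_mul, mul_neg, neg_neg, Finset.sum_neg_distrib, Matrix.mul_assoc]
    abel
  exact Submodule.eq_starProjection_of_mem_orthogonal h1 h2

end QuaternionMatrices
end HyperCR

namespace HyperCR

/-! ### Pairing the variation of the connection with the generators of `E ⊗ H`. -/

section Pairing

open Matrix
open scoped RealInnerProductSpace

variable {n : ℕ}

theorem trace_vecMulVec_transpose_mul {ι : Type*} [Fintype ι] (p q : ι → ℝ) (X : Matrix ι ι ℝ) :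
    ((vecMulVec p q)ᵀ * X).trace = p ⬝ᵥ X *ᵥ q := by
  rw [Matrix.transpose_vecMulVec, Matrix.vecMulVec_mul, Matrix.trace_vecMulVec,
    Matrix.dotProduct_mulVec, dotProduct_comm]

/-- The skew-symmetric matrix `p qᵀ - q pᵀ`. -/
def wedge {ι : Type*} (p q : ι → ℝ) : Matrix ι ι ℝ := vecMulVec p q - vecMulVec q p

theorem wedge_transpose {ι : Type*} (p q : ι → ℝ) : (wedge p q)ᵀ = -wedge p q := by
  rw [wedge, Matrix.transpose_sub, Matrix.transpose_vecMulVec, Matrix.transpose_vecMulVec, neg_sub]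

theorem mul_wedge_mul {ι : Type*} [Fintype ι] (A : Matrix ι ι ℝ) (p q : ι → ℝ) :
    A * wedge p q * Aᵀ = wedge (A *ᵥ p) (A *ᵥ q) := by
  simp only [wedge, Matrix.mul_sub, Matrix.sub_mul, Matrix.mul_vecMulVec, Matrix.vecMulVec_mul,
    Matrix.vecMul_transpose]

theorem trace_wedge_transpose_mul {ι : Type*} [Fintype ι] (p q : ι → ℝ) {X : Matrix ι ι ℝ}
    (hX : Xᵀ = -X) : ((wedge p q)ᵀ * X).trace = 2 * (p ⬝ᵥ X *ᵥ q) := by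
  have h : q ⬝ᵥ X *ᵥ p = -(p ⬝ᵥ X *ᵥ q) := by
    rw [Matrix.dotProduct_mulVec, ← Matrix.mulVec_transpose, hX, Matrix.neg_mulVec, neg_dotProduct,
      dotProduct_comm]
  rw [wedge, Matrix.transpose_sub, Matrix.sub_mul, Matrix.trace_sub,
    trace_vecMulVec_transpose_mul, trace_vecMulVec_transpose_mul, h]
  ring

/-- The change of the connection form under a change of the three-plane field. -/
def deltaMat (Ω : Matrix (Idx n) (Idx n) ℝ) (u : Idx n → ℝ) (k : Idx n) :
    Matrix (Idx n) (Idx n) ℝ := wedge u (Ω.col k) - u k • Ω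

theorem deltaMat_transpose {Ω : Matrix (Idx n) (Idx n) ℝ} (hΩ : Ωᵀ = -Ω) (u : Idx n → ℝ)
    (k : Idx n) : (deltaMat Ω u k)ᵀ = -deltaMat Ω u k := by
  rw [deltaMat, Matrix.transpose_sub, wedge_transpose, Matrix.transpose_smul, hΩ, smul_neg]
  abel

/-- Summing over `k` contracts the columns of `C` with the form index of `deltaMat`, so each of its
three terms becomes a trace or a matrix product. The cases `C = 1` and `C = quat n b` cover the
first two terms of `obsMat`. -/
theorem sum_trace_wedge_mul_deltaMat {Ω : Matrix (Idx n) (Idx n) ℝ} (hΩ : Ωᵀ = -Ω)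
    (C : Matrix (Idx n) (Idx n) ℝ) (y u : Idx n → ℝ) :
    ∑ k, ((wedge y (C.col k))ᵀ * deltaMat Ω u k).trace
      = 2 * ((y ⬝ᵥ u) * (Ωᵀ * C).trace - y ⬝ᵥ (Ω * Cᵀ) *ᵥ u - y ⬝ᵥ (Ω * C) *ᵥ u) := by
  have h1 : ∀ k, y ⬝ᵥ deltaMat Ω u k *ᵥ C.col k
      = (y ⬝ᵥ u) * (Ω.col k ⬝ᵥ C.col k) - (y ᵥ* Ω) k * (u ᵥ* C) k - u k * (y ᵥ* (Ω * C)) k := by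
    intro k
    have e : y ⬝ᵥ Ω *ᵥ C.col k = (y ᵥ* (Ω * C)) k := by
      rw [← Matrix.vecMul_vecMul, Matrix.dotProduct_mulVec]; rfl
    rw [deltaMat, wedge, Matrix.sub_mulVec, Matrix.sub_mulVec, Matrix.smul_mulVec,
      Matrix.vecMulVec_mulVec, Matrix.vecMulVec_mulVec, dotProduct_sub, dotProduct_sub,
      dotProduct_smul]
    simp only [op_smul_eq_smul, dotProduct_smul, smul_eq_mul, e]
    have e2 : y ⬝ᵥ Ω.col k = (y ᵥ* Ω) k := rfl
    have e3 : u ⬝ᵥ C.col k = (u ᵥ* C) k := rfl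
    rw [e2, e3]
    ring
  simp only [trace_wedge_transpose_mul _ _ (deltaMat_transpose hΩ u _), h1]
  rw [← Finset.mul_sum, Finset.sum_sub_distrib, Finset.sum_sub_distrib, ← Finset.mul_sum]
  have s1 : ∑ k, Ω.col k ⬝ᵥ C.col k = (Ωᵀ * C).trace := rfl
  have s2 : ∑ k, (y ᵥ* Ω) k * (u ᵥ* C) k = y ⬝ᵥ (Ω * Cᵀ) *ᵥ u := by
    rw [← Matrix.mulVec_mulVec, Matrix.dotProduct_mulVec, Matrix.mulVec_transpose]
    rfl
  have s3 : ∑ k, u k * (y ᵥ* (Ω * C)) k = y ⬝ᵥ (Ω * C) *ᵥ u := by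
    rw [Matrix.dotProduct_mulVec, dotProduct_comm]
    rfl
  rw [s1, s2, s3]

theorem trace_obsMat_transpose_mul (W X : Matrix (Idx n) (Idx n) ℝ) :
    ((obsMat W)ᵀ * X).trace = 3 / 4 * (Wᵀ * X).trace
      + 1 / 4 * ∑ a, ((quat n a * W * quat n a)ᵀ * X).trace
      - ∑ a, (Wᵀ * quat n a).trace / (4 * n) * ((quat n a)ᵀ * X).trace := by
  simp only [obsMat, Matrix.transpose_sub, Matrix.transpose_add, Matrix.transpose_smul,
    Matrix.transpose_sum, Matrix.sub_mul, Matrix.add_mul, Matrix.smul_mul, Matrix.sum_mul,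
    Matrix.trace_sub, Matrix.trace_add, Matrix.trace_smul, Matrix.trace_sum, smul_eq_mul]

/-- The three terms of `obsMat` are paired separately: `h1` for the identity term, `h2` for the
conjugations, `h3` for the `sp(1)`-part. -/
theorem sum_trace_obsMat_mul_deltaMat {Ω : Matrix (Idx n) (Idx n) ℝ} (hΩ : Ωᵀ = -Ω)
    (w u : Idx n → ℝ) :
    ∑ k, ((obsMat (wedge w (Pi.single k 1)))ᵀ * deltaMat Ω u k).trace
      = -3 * (w ⬝ᵥ Ω *ᵥ u)
        + 1 / 2 * ∑ b, (w ⬝ᵥ quat n b *ᵥ u) * (Ωᵀ * quat n b).trace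
        - ∑ b, (1 / (4 * n) : ℝ) * (4 * (w ⬝ᵥ (quat n b * Ω * quat n b) *ᵥ u)
            - 2 * (Ωᵀ * quat n b).trace * (w ⬝ᵥ quat n b *ᵥ u)) := by
  have hskew : ∀ b (p q : Idx n → ℝ), p ⬝ᵥ quat n b *ᵥ q = -(quat n b *ᵥ p ⬝ᵥ q) := fun b p q => by
    rw [Matrix.dotProduct_mulVec, ← Matrix.mulVec_transpose, quat_transpose, Matrix.neg_mulVec,
      neg_dotProduct]
  have htr : Ω.trace = 0 := by
    have := trace_symm_mul_skew (S := 1) (R := Ω) Matrix.transpose_one hΩ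
    rwa [one_mul] at this
  have h1 : ∑ k, ((wedge w (Pi.single k 1))ᵀ * deltaMat Ω u k).trace = -4 * (w ⬝ᵥ Ω *ᵥ u) := by
    have h := sum_trace_wedge_mul_deltaMat hΩ 1 w u
    simp only [Matrix.mul_one, Matrix.transpose_one, Matrix.trace_transpose, htr] at h
    have e : ∀ k, (1 : Matrix (Idx n) (Idx n) ℝ).col k = Pi.single k 1 := fun k => by
      rw [← Matrix.mulVec_single_one, Matrix.one_mulVec]
    simp only [e] at h
    rw [h]; ring
  have h2 : ∀ b, ∑ k, ((quat n b * wedge w (Pi.single k 1) * quat n b)ᵀ * deltaMat Ω u k).trace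
      = 2 * (w ⬝ᵥ quat n b *ᵥ u) * (Ωᵀ * quat n b).trace := by
    intro b
    -- The units are skew, so `q (w ∧ e_k) q = -q (w ∧ e_k) qᵀ = -(q w ∧ q e_k)`.
    have e : ∀ k, quat n b * wedge w (Pi.single k 1) * quat n b
        = wedge (-(quat n b *ᵥ w)) ((quat n b).col k) := fun k => by
      have h := mul_wedge_mul (quat n b) w (Pi.single k 1)
      rw [quat_transpose, mul_neg, Matrix.mulVec_single_one] at h
      rw [← neg_neg (quat n b * _ * _), h]
      rw [wedge, wedge, Matrix.neg_vecMulVec, Matrix.vecMulVec_neg]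
      abel
    simp only [e]
    rw [sum_trace_wedge_mul_deltaMat hΩ, quat_transpose, mul_neg, Matrix.neg_mulVec,
      dotProduct_neg, neg_dotProduct, hskew]
    ring
  have h3 : ∀ b, ∑ k, ((wedge w (Pi.single k 1))ᵀ * quat n b).trace
        * ((quat n b)ᵀ * deltaMat Ω u k).trace
      = 4 * (w ⬝ᵥ (quat n b * Ω * quat n b) *ᵥ u)
        - 2 * (Ωᵀ * quat n b).trace * (w ⬝ᵥ quat n b *ᵥ u) := by
    intro b
    have e1 : ∀ k, ((wedge w (Pi.single k 1))ᵀ * quat n b).trace = -2 * (quat n b *ᵥ w) k :=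
      fun k => by
      rw [trace_wedge_transpose_mul _ _ (quat_transpose b), hskew, dotProduct_single_one]
      ring
    have e2 : ∀ k, ((quat n b)ᵀ * deltaMat Ω u k).trace
        = 2 * (u ᵥ* (quat n b * Ω)) k - u k * (Ωᵀ * quat n b).trace := fun k => by
      rw [deltaMat, mul_sub, Matrix.trace_sub, Matrix.mul_smul, Matrix.trace_smul, smul_eq_mul]
      congr 1
      · rw [← Matrix.trace_transpose, Matrix.transpose_mul, Matrix.transpose_transpose,
          trace_wedge_transpose_mul _ _ (quat_transpose b), ← Matrix.vecMul_vecMul,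
          Matrix.dotProduct_mulVec]
        rfl
      · rw [← Matrix.trace_transpose, Matrix.transpose_mul, Matrix.transpose_transpose]
    have e3 : ∑ k, (quat n b *ᵥ w) k * (u ᵥ* (quat n b * Ω)) k
        = -(w ⬝ᵥ (quat n b * Ω * quat n b) *ᵥ u) := by
      change (quat n b *ᵥ w) ⬝ᵥ (u ᵥ* (quat n b * Ω)) = _
      rw [← Matrix.mulVec_transpose, Matrix.transpose_mul, hΩ, quat_transpose, neg_mul_neg,
        ← neg_eq_iff_eq_neg, ← hskew, Matrix.mulVec_mulVec, Matrix.mul_assoc]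
    have e4 : ∑ k, (quat n b *ᵥ w) k * u k = -(w ⬝ᵥ quat n b *ᵥ u) := by
      rw [hskew, neg_neg]; rfl
    calc _ = -4 * ∑ k, (quat n b *ᵥ w) k * (u ᵥ* (quat n b * Ω)) k
          + 2 * (Ωᵀ * quat n b).trace * ∑ k, (quat n b *ᵥ w) k * u k := by
          rw [Finset.mul_sum, Finset.mul_sum, ← Finset.sum_add_distrib]
          refine Finset.sum_congr rfl fun k _ => ?_
          rw [e1, e2]; ring
      _ = _ := by rw [e3, e4]; ring
  simp only [trace_obsMat_transpose_mul, Finset.sum_sub_distrib, Finset.sum_add_distrib,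
    ← Finset.mul_sum]
  rw [h1, Finset.sum_comm, Finset.sum_comm (s := Finset.univ (α := Idx n)) (t := Finset.univ (α := Fin 3))]
  have h3' : ∀ b, ∑ k, ((wedge w (Pi.single k 1))ᵀ * quat n b).trace / (4 * n)
        * ((quat n b)ᵀ * deltaMat Ω u k).trace
      = (1 / (4 * n) : ℝ) * (4 * (w ⬝ᵥ (quat n b * Ω * quat n b) *ᵥ u)
        - 2 * (Ωᵀ * quat n b).trace * (w ⬝ᵥ quat n b *ᵥ u)) := fun b => by
    rw [← h3, Finset.mul_sum]
    refine Finset.sum_congr rfl fun k _ => ?_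
    ring
  simp only [h2, h3', Fin.sum_univ_three]
  ring

/-- The pairing of the obstruction of a change of the three-plane field with the generators of
the summand `E ⊗ H`. -/
theorem sum_trace_obsMat_mul_deltaMat_quat (hn : n ≠ 0) (a : Fin 3)
    {S : Matrix (Idx n) (Idx n) ℝ} (hS : Sᵀ = S) (hSa : S * quat n a = quat n a * S)
    (hSb : ∀ b, b ≠ a → S - quat n b * S * quat n b = (2 : ℝ) • 1) (w z : Idx n → ℝ) :
    ∑ k, ((obsMat (wedge w (Pi.single k 1)))ᵀ * deltaMat (S * quat n a) (quat n a *ᵥ z) k).trace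
      = 3 * (1 - 1 / n) * (w ⬝ᵥ S *ᵥ z) - (2 * n + 2 - 4 / n) * (w ⬝ᵥ z) := by
  have hn' : (n : ℝ) ≠ 0 := Nat.cast_ne_zero.2 hn
  have hΩ : (S * quat n a)ᵀ = -(S * quat n a) := by
    rw [Matrix.transpose_mul, hS, quat_transpose, neg_mul, hSa]
  have ha : ∀ a : Fin 3, a + 1 ≠ a ∧ a + 2 ≠ a := by decide
  -- Taking traces in `S - q_b S q_b = 2` gives `2 tr S = 2 · 4n`.
  have htrS : S.trace = 4 * n := by
    have h := congrArg Matrix.trace (hSb _ (ha a).1)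
    rw [Matrix.trace_sub, Matrix.trace_mul_comm, ← Matrix.mul_assoc, quat_sq, neg_one_mul,
      Matrix.trace_neg, Matrix.trace_smul, trace_one_idx, smul_eq_mul] at h
    linarith
  have ht : ∀ b, ((S * quat n a)ᵀ * quat n b).trace = if b = a then 4 * (n : ℝ) else 0 := by
    intro b
    rw [hΩ, neg_mul, Matrix.trace_neg, Matrix.mul_assoc]
    split_ifs with h
    · rw [h, quat_sq, mul_neg_one, Matrix.trace_neg, htrS, neg_neg]
    · obtain ⟨h1, h2, h3, h4, h5, h6⟩ := quat_mul_all (n := n) a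
      rcases fin3_eq_of_ne (Ne.symm h) with rfl | rfl
      · rw [h1, trace_symm_mul_skew hS (quat_transpose _), neg_zero]
      · rw [h6, mul_neg, Matrix.trace_neg, trace_symm_mul_skew hS (quat_transpose _)]
        simp
  have e0 : w ⬝ᵥ (S * quat n a) *ᵥ quat n a *ᵥ z = -(w ⬝ᵥ S *ᵥ z) := by
    rw [Matrix.mulVec_mulVec, Matrix.mul_assoc, quat_sq, mul_neg_one, Matrix.neg_mulVec,
      dotProduct_neg]
  have e1 : w ⬝ᵥ quat n a *ᵥ quat n a *ᵥ z = -(w ⬝ᵥ z) := by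
    rw [Matrix.mulVec_mulVec, quat_sq, Matrix.neg_mulVec, Matrix.one_mulVec, dotProduct_neg]
  have e2 : w ⬝ᵥ (quat n a * (S * quat n a) * quat n a) *ᵥ quat n a *ᵥ z = w ⬝ᵥ S *ᵥ z := by
    rw [Matrix.mulVec_mulVec, ← Matrix.mul_assoc, ← hSa, Matrix.mul_assoc S, quat_sq, mul_neg_one,
      neg_mul, neg_mul, Matrix.mul_assoc, quat_sq, mul_neg_one, neg_neg]
  have e3 : ∀ b, b ≠ a → w ⬝ᵥ (quat n b * (S * quat n a) * quat n b) *ᵥ quat n a *ᵥ z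
      = w ⬝ᵥ S *ᵥ z - 2 * (w ⬝ᵥ z) := by
    intro b hb
    -- Here `q_a q_b q_a = q_b` for `a ≠ b`. The remaining `q_b S q_b` is `S - 2` by hypothesis;
    -- this is how the Levi form enters.
    have h1 : quat n b * (S * quat n a) * quat n b * quat n a = quat n b * S * quat n b := by
      rw [← Matrix.mul_assoc, Matrix.mul_assoc, Matrix.mul_assoc, ← Matrix.mul_assoc (quat n a),
        quat_conj a b hb.symm]
    have h2 : quat n b * S * quat n b = S - (2 : ℝ) • 1 := by rw [← hSb b hb]; abel
    rw [Matrix.mulVec_mulVec, h1, h2, Matrix.sub_mulVec, Matrix.smul_mulVec, Matrix.one_mulVec,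
      dotProduct_sub, dotProduct_smul, smul_eq_mul]
  rw [sum_trace_obsMat_mul_deltaMat hΩ, sum_fin3 _ a, sum_fin3 _ a]
  simp only [ht, e0, e1, e2, e3 _ (ha a).1, e3 _ (ha a).2, (ha a).1, (ha a).2, if_true, if_false]
  field_simp
  ring

end Pairing
end HyperCR

namespace HyperCR

/-! ### The `E ⊗ H` component as a covector, and its equivariance. -/

section PairEH

open Matrix
open scoped RealInnerProductSpace

variable {n : ℕ}

/-- The pairing of a form with the generators of the summand `E ⊗ H`. -/
def pairEH (α : FormGl n) (w : Idx n → ℝ) : ℝ := ⟪obsPart (wedgeForm (WithLp.toLp 2 w)), α⟫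

theorem obsPart_add (α β : FormGl n) : obsPart (α + β) = obsPart α + obsPart β := by
  ext i : 1
  exact map_add ((obsSpace n).starProjection) (α i) (β i)

theorem obsPart_smul (c : ℝ) (α : FormGl n) : obsPart (c • α) = c • obsPart α := by
  ext i : 1
  exact map_smul ((obsSpace n).starProjection) c (α i)

theorem wedgeForm_add (v w : EuclideanSpace ℝ (Idx n)) :
    wedgeForm (v + w) = wedgeForm v + wedgeForm w := by
  ext i p
  simp only [wedgeForm, PiLp.add_apply]
  split_ifs <;> ring

theorem wedgeForm_smul (c : ℝ) (w : EuclideanSpace ℝ (Idx n)) :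
    wedgeForm (c • w) = c • wedgeForm w := by
  ext i p
  simp only [wedgeForm, PiLp.smul_apply, smul_eq_mul]
  split_ifs <;> ring

theorem wedgeForm_apply (w : Idx n → ℝ) (k : Idx n) :
    wedgeForm (WithLp.toLp 2 w) k = ofMat (wedge w (Pi.single k 1)) := by
  ext p
  simp [wedgeForm, ofMat, wedge, Matrix.vecMulVec_apply, Pi.single_apply]

/-- `pairEH α` as a linear form. -/
def pairEHLin (α : FormGl n) : (Idx n → ℝ) →ₗ[ℝ] ℝ where
  toFun := pairEH α
  map_add' v w := by
    rw [pairEH, WithLp.toLp_add, wedgeForm_add, obsPart_add, inner_add_left]; rfl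
  map_smul' c w := by
    rw [pairEH, WithLp.toLp_smul, wedgeForm_smul, obsPart_smul, real_inner_smul_left]; rfl

theorem pairEH_eq_dotProduct (α : FormGl n) (w : Idx n → ℝ) :
    pairEH α w = w ⬝ᵥ fun i => pairEH α (Pi.single i 1) := by
  change pairEHLin α w = _
  conv_lhs => rw [pi_eq_sum_univ' w]
  rw [map_sum]
  refine Finset.sum_congr rfl fun i _ => ?_
  rw [map_smul]
  rfl

/-- Turns the pairing into a sum of matrix traces. The explicit projection is applied to the
generators, which are skew, so no skewness of `α` is needed. -/
theorem pairEH_eq_sum (hn : n ≠ 0) (α : FormGl n) (w : Idx n → ℝ) :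
    pairEH α w = ∑ k, ((obsMat (wedge w (Pi.single k 1)))ᵀ * toMat (α k)).trace := by
  rw [pairEH, PiLp.inner_apply]
  refine Finset.sum_congr rfl fun k _ => ?_
  have h : wedgeForm (WithLp.toLp 2 w) k ∈ so n := by
    rw [wedgeForm_apply, mem_so_iff, toMat_ofMat, wedge_transpose]
  have e : obsPart (wedgeForm (WithLp.toLp 2 w)) k
      = (obsSpace n).starProjection (wedgeForm (WithLp.toLp 2 w) k) := rfl
  rw [e, starProjection_obsSpace hn h, inner_eq_trace, toMat_ofMat, wedgeForm_apply, toMat_ofMat]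

/-- The projection to `(sp(n) + sp(1))^⊥` is self-adjoint and idempotent and is already applied to
the generators; so `α` may be tested in place of its obstruction part. -/
theorem starProjection_summandEH_eq_zero (α : FormGl n) :
    (summandEH n).starProjection (obsPart α) = 0 ↔ ∀ w, pairEH α w = 0 := by
  have h : ∀ w, ⟪obsPart (wedgeForm (WithLp.toLp 2 w)), obsPart α⟫ = pairEH α w := by
    intro w
    rw [pairEH, PiLp.inner_apply, PiLp.inner_apply]
    refine Finset.sum_congr rfl fun k _ => ?_
    have hm := Submodule.starProjection_apply_mem (obsSpace n) (wedgeForm (WithLp.toLp 2 w) k)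
    change ⟪(obsSpace n).starProjection (wedgeForm (WithLp.toLp 2 w) k),
      (obsSpace n).starProjection (α k)⟫ = ⟪(obsSpace n).starProjection _, _⟫
    rw [← Submodule.inner_starProjection_left_eq_right, Submodule.starProjection_eq_self_iff.2 hm]
  rw [Submodule.starProjection_apply_eq_zero_iff, Submodule.mem_orthogonal]
  constructor
  · intro h0 w
    rw [← h w]
    exact h0 _ (Submodule.subset_span ⟨_, rfl⟩)
  · intro h0 u hu
    induction hu using Submodule.span_induction with
    | mem u hu => obtain ⟨w, rfl⟩ := hu; rw [← h0 w, ← h w]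
    | zero => exact inner_zero_left _
    | add u v _ _ hu hv => rw [inner_add_left, hu, hv, add_zero]
    | smul c u _ hu => rw [real_inner_smul_left, hu, mul_zero]

theorem obsMat_sum {ι : Type*} (s : Finset ι) (c : ι → ℝ) (W : ι → Matrix (Idx n) (Idx n) ℝ) :
    obsMat (∑ i ∈ s, c i • W i) = ∑ i ∈ s, c i • obsMat (W i) := by
  let f : Matrix (Idx n) (Idx n) ℝ →ₗ[ℝ] Matrix (Idx n) (Idx n) ℝ :=
    { toFun := obsMat
      map_add' := fun V W => by
        simp only [obsMat, Matrix.mul_add, Matrix.add_mul, Matrix.transpose_add, Matrix.trace_add,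
          Finset.sum_add_distrib, add_div, add_smul, smul_add]
        abel
      map_smul' := fun c W => by
        simp only [obsMat, Matrix.mul_smul, Matrix.smul_mul, Matrix.transpose_smul,
          Matrix.trace_smul, smul_eq_mul, mul_div_assoc, mul_smul, ← Finset.smul_sum, smul_sub,
          smul_add, RingHom.id_apply]
        rw [smul_comm c, smul_comm c] }
  exact (map_sum f _ s).trans (Finset.sum_congr rfl fun i _ => map_smul f _ _)

/-- Equivariance of the projection under `Sp(n)`: an orthogonal `A` commuting with the units fixes
each of them under conjugation. -/
theorem obsMat_conj {A : Matrix (Idx n) (Idx n) ℝ} (hA : Aᵀ * A = 1)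
    (hAq : ∀ a, A * quat n a = quat n a * A) (W : Matrix (Idx n) (Idx n) ℝ) :
    A * obsMat W * Aᵀ = obsMat (A * W * Aᵀ) := by
  have hAq' : ∀ a, Aᵀ * quat n a = quat n a * Aᵀ := fun a => by
    have := congrArg Matrix.transpose (hAq a)
    rw [Matrix.transpose_mul, Matrix.transpose_mul, quat_transpose, neg_mul, mul_neg, neg_inj] at this
    exact this.symm
  have hA' : A * Aᵀ = 1 := mul_eq_one_comm.1 hA
  have h1 : ∀ a, A * (quat n a * W * quat n a) * Aᵀ = quat n a * (A * W * Aᵀ) * quat n a := by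
    intro a
    simp only [← Matrix.mul_assoc]
    rw [hAq, Matrix.mul_assoc _ (quat n a) Aᵀ, ← hAq', ← Matrix.mul_assoc]
  have h2 : ∀ a, A * quat n a * Aᵀ = quat n a := fun a => by
    rw [hAq, Matrix.mul_assoc, hA', mul_one]
  have h3 : ∀ a, ((A * W * Aᵀ)ᵀ * quat n a).trace = (Wᵀ * quat n a).trace := by
    intro a
    rw [Matrix.transpose_mul, Matrix.transpose_mul, Matrix.transpose_transpose, Matrix.mul_assoc,
      Matrix.mul_assoc, hAq', Matrix.trace_mul_comm, Matrix.mul_assoc, Matrix.mul_assoc, hA, mul_one]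
  simp only [obsMat, Matrix.mul_sub, Matrix.mul_add, Matrix.sub_mul, Matrix.add_mul, Matrix.mul_smul,
    Matrix.smul_mul, Matrix.mul_sum, Matrix.sum_mul, h1, h2, h3]

/-- The behaviour of `pairEH` under a change of adapted frame. -/
theorem pairEH_frame_change (hn : n ≠ 0) {A : Matrix (Idx n) (Idx n) ℝ} (hA : Aᵀ * A = 1)
    (hAq : ∀ a, A * quat n a = quat n a * A) {α α' : FormGl n}
    {s : Idx n → Matrix (Idx n) (Idx n) ℝ} (hs : ∀ k a, s k * quat n a = quat n a * s k)
    (hα : ∀ i, toMat (α' i) = Aᵀ * (∑ k, A k i • toMat (α k)) * A + s i) (w : Idx n → ℝ) :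
    pairEH α' w = pairEH α (A *ᵥ w) := by
  have hA' : A * Aᵀ = 1 := mul_eq_one_comm.1 hA
  -- The inhomogeneous term commutes with the units and is orthogonal to every obstruction part.
  have h0 : ∀ i, ((obsMat (wedge w (Pi.single i 1)))ᵀ * s i).trace = 0 := fun i => by
    rw [obsMat_transpose (wedge_transpose _ _), neg_mul, Matrix.trace_neg,
      trace_obsMat_mul_of_commute _ (hs i), neg_zero]
  have h1 : ∀ i k, ((obsMat (wedge w (Pi.single i 1)))ᵀ * (Aᵀ * toMat (α k) * A)).trace
      = ((obsMat (wedge (A *ᵥ w) (A.col i)))ᵀ * toMat (α k)).trace := by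
    intro i k
    have h := obsMat_conj hA hAq (wedge w (Pi.single i 1))
    rw [mul_wedge_mul, Matrix.mulVec_single_one] at h
    rw [← h, Matrix.transpose_mul, Matrix.transpose_mul, Matrix.transpose_transpose,
      ← Matrix.mul_assoc, Matrix.trace_mul_comm]
    simp only [Matrix.mul_assoc]
  -- Orthogonality of the rows of `A` undoes the change of basis in the form index.
  have h2 : ∀ k, ∑ i, A k i • wedge (A *ᵥ w) (A.col i) = wedge (A *ᵥ w) (Pi.single k 1) := by
    intro k
    have e : ∑ i, A k i • A.col i = Pi.single k 1 := by
      ext j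
      have := congrFun (congrFun hA' j) k
      simp only [Matrix.mul_apply, Matrix.transpose_apply, Matrix.one_apply] at this
      simp only [Finset.sum_apply, Pi.smul_apply, smul_eq_mul, Matrix.col_apply, Pi.single_apply]
      rw [← this]
      exact Finset.sum_congr rfl fun i _ => mul_comm _ _
    rw [← e]
    ext i j
    simp [wedge, Matrix.sum_apply, Matrix.vecMulVec_apply, Finset.mul_sum, Finset.sum_mul,
      mul_sub]
    congr 1 <;> exact Finset.sum_congr rfl fun _ _ => by ring
  rw [pairEH_eq_sum hn, pairEH_eq_sum hn]
  simp only [hα, Matrix.mul_add, Matrix.trace_add, h0, add_zero, Matrix.mul_sum, Matrix.sum_mul,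
    Matrix.mul_smul, Matrix.smul_mul, Matrix.trace_sum, Matrix.trace_smul, h1, smul_eq_mul]
  rw [Finset.sum_comm]
  refine Finset.sum_congr rfl fun k _ => ?_
  rw [← h2 k, obsMat_sum]
  simp only [Matrix.transpose_sum, Matrix.transpose_smul, Matrix.sum_mul, Matrix.smul_mul,
    Matrix.trace_sum, Matrix.trace_smul, smul_eq_mul]

end PairEH
end HyperCR

/-! ### Variation of the connection forms with the three-plane field. -/

namespace HyperCR

open Matrix

/-- The matrix of a bilinear form with respect to a family of vectors. -/
def bilinMat {V ι : Type*} [AddCommGroup V] [Module ℝ V] (F : V →ₗ[ℝ] V →ₗ[ℝ] ℝ) (e : ι → V) :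
    Matrix ι ι ℝ := Matrix.of fun i j => F (e i) (e j)

theorem bilinMat_sum {V ι : Type*} [Fintype ι] [AddCommGroup V] [Module ℝ V]
    (F : V →ₗ[ℝ] V →ₗ[ℝ] ℝ) (e : ι → V) (z w : ι → ℝ) :
    F (∑ i, z i • e i) (∑ j, w j • e j) = z ⬝ᵥ bilinMat F e *ᵥ w := by
  simp only [map_sum, LinearMap.sum_apply, map_smul, LinearMap.smul_apply, smul_eq_mul, bilinMat,
    dotProduct, Matrix.mulVec, Finset.mul_sum, Matrix.of_apply]
  rw [Finset.sum_comm]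
  exact Finset.sum_congr rfl fun i _ => Finset.sum_congr rfl fun j _ => by ring

theorem bilinMat_mul {V ι : Type*} [Fintype ι] [AddCommGroup V] [Module ℝ V]
    (F : V →ₗ[ℝ] V →ₗ[ℝ] ℝ) {e e' : ι → V} {A : Matrix ι ι ℝ}
    (he : ∀ j, e' j = ∑ l, A l j • e l) : bilinMat F e' = Aᵀ * bilinMat F e * A := by
  ext i j
  rw [bilinMat, Matrix.of_apply, he i, he j, bilinMat_sum, Matrix.dotProduct_mulVec]
  simp only [Matrix.mul_apply, dotProduct, Matrix.vecMul, Matrix.transpose_apply]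

namespace HyperPseudohermitian

variable {n : ℕ} {M : Type*} [TopologicalSpace M] [ChartedSpace (ModelE n) M]
  [IsManifold (𝓡 (4 * n + 3)) ∞ M] {S : HyperPseudohermitian n M}
  {T T' : Fin 3 → ∀ x : M, Tan n x} {U : Set M} {ε : Idx n → ∀ x : M, Tan n x} {x : M}

theorem IsAdaptedFrame.I_apply (hε : S.IsAdaptedFrame U ε)
    (hx : x ∈ U) (a : Fin 3) (j : Idx n) :
    S.I a x (ε j x) = ∑ l, quat n a l j • ε l x := by
  obtain ⟨k, c⟩ := j
  have h1 : ∑ l, quat n a l (k, c) • ε l x = ∑ d, unitMat a d c • ε (k, d) x := by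
    rw [Fintype.sum_prod_type, Finset.sum_eq_single k]
    · simp [quat_eq]
    · intro b _ hb
      simp [quat_eq, Matrix.one_apply, hb]
    · simp
  have hm := hε.mem (k, 0) x hx
  have h0 := hε.adapted k 0 x hx
  have h1' := hε.adapted k 1 x hx
  have h2 := hε.adapted k 2 x hx
  have s := fun a => S.I_sq a hm
  have m0 := S.I_mul 0 hm
  have m1 := S.I_mul 1 hm
  have m2 := S.I_mul 2 hm
  have r0 := S.I_mul_rev 0 hm
  have r1 := S.I_mul_rev 1 hm
  have r2 := S.I_mul_rev 2 hm
  rw [h1, Fin.sum_univ_four]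
  simp at h0 h1' h2 m0 m1 m2 r0 r1 r2
  fin_cases a <;> fin_cases c <;> simp [unitMat, h0, h1', h2, s, m0, m1, m2, r0, r1, r2]

theorem IsAdaptedFrame.I_sum (hε : S.IsAdaptedFrame U ε) (hx : x ∈ U) (a : Fin 3)
    (z : Idx n → ℝ) : S.I a x (∑ i, z i • ε i x) = ∑ i, (quat n a *ᵥ z) i • ε i x := by
  rw [map_sum]
  simp only [map_smul, hε.I_apply hx, Finset.smul_sum, Matrix.mulVec, dotProduct, Finset.sum_smul,
    smul_smul]
  rw [Finset.sum_comm]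
  simp only [mul_comm]

theorem IsAdaptedFrame.sum_mem (hε : S.IsAdaptedFrame U ε) (hx : x ∈ U) (z : Idx n → ℝ) :
    ∑ i, z i • ε i x ∈ S.Q x :=
  Submodule.sum_mem _ fun i _ => Submodule.smul_mem _ _ (hε.mem i x hx)

theorem IsAdaptedFrame.bilinMat_gForm (hε : S.IsAdaptedFrame U ε) (hx : x ∈ U) :
    bilinMat (S.gForm T x) (fun i => ε i x) = 1 := by
  ext i j
  rw [bilinMat, Matrix.of_apply, gForm_of_mem T (hε.mem i x hx) (hε.mem j x hx),
    hε.orthonormal i j x hx, Matrix.one_apply]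

variable (S) in
/-- The form `dθ_a(v, I_a w)` as a bilinear form. -/
def betaForm (a : Fin 3) (x : M) : Tan n x →ₗ[ℝ] Tan n x →ₗ[ℝ] ℝ :=
  (dlin (S.compatible.smooth a) x).compl₁₂ LinearMap.id (S.I a x)

theorem betaForm_apply (a : Fin 3) (x : M) (v w : Tan n x) :
    S.betaForm a x v w = S.beta a x v w := rfl

variable (S) in
/-- The matrix of `dθ_a(v, I_a w)` with respect to a frame. -/
def betaMat (a : Fin 3) (ε : Idx n → ∀ x : M, Tan n x) (x : M) : Matrix (Idx n) (Idx n) ℝ :=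
  bilinMat (S.betaForm a x) fun i => ε i x

theorem IsNormalized.betaMat_transpose [T2Space M] (hT : S.IsNormalized T)
    (hε : S.IsAdaptedFrame U ε) (hx : x ∈ U) (a : Fin 3) :
    (S.betaMat a ε x)ᵀ = S.betaMat a ε x := by
  ext i j
  exact hT.beta_symm a (hε.mem j x hx) (hε.mem i x hx)

theorem IsAdaptedFrame.betaMat_conj (hε : S.IsAdaptedFrame U ε) (hx : x ∈ U) (a b : Fin 3)
    (i j : Idx n) : S.beta a x (S.I b x (ε i x)) (S.I b x (ε j x))
      = -(quat n b * S.betaMat a ε x * quat n b) i j := by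
  have h := bilinMat_mul (S.betaForm a x) (e := fun i => ε i x)
    (e' := fun j => S.I b x (ε j x)) (A := quat n b) fun j => hε.I_apply hx b j
  rw [quat_transpose, neg_mul, neg_mul] at h
  exact congrFun (congrFun h i) j

theorem IsNormalized.betaMat_mul_quat [T2Space M] (hT : S.IsNormalized T)
    (hε : S.IsAdaptedFrame U ε) (hx : x ∈ U) (a : Fin 3) :
    S.betaMat a ε x * quat n a = quat n a * S.betaMat a ε x := by
  have h : S.betaMat a ε x = -(quat n a * S.betaMat a ε x * quat n a) := by
    ext i j
    rw [Matrix.neg_apply, ← hε.betaMat_conj hx a a,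
      hT.beta_I a (hε.mem i x hx) (hε.mem j x hx)]
    rfl
  conv_rhs => rw [h]
  rw [mul_neg, ← Matrix.mul_assoc, ← Matrix.mul_assoc, quat_sq, neg_one_mul, neg_mul, neg_neg]

/-- In an orthonormal frame the Levi form is the identity matrix, and pullback of a form by the skew
matrix `q_b` reads `-q_b S q_b`. So this is the description of the Levi form as an invariant part.
-/
theorem IsNormalized.betaMat_sub [T2Space M] (hT : S.IsNormalized T)
    (hε : S.IsAdaptedFrame U ε) (hx : x ∈ U) {a b : Fin 3} (h : b ≠ a) :
    S.betaMat a ε x - quat n b * S.betaMat a ε x * quat n b = (2 : ℝ) • 1 := by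
  ext i j
  rw [sub_eq_add_neg, Matrix.add_apply, Matrix.neg_apply, ← hε.betaMat_conj hx a b,
    Matrix.smul_apply, Matrix.one_apply, ← hε.orthonormal i j x hx]
  have hi := hε.mem i x hx
  have hj := hε.mem j x hx
  rcases fin3_eq_of_ne h.symm with rfl | rfl
  · exact (hT.levi_eq_add_one a hi hj).symm
  · exact (hT.levi_eq_add_two a hi hj).symm

variable (S) in
/-- The matrix of the form `h` with respect to an adapted frame. -/
def hMat (ε : Idx n → ∀ x : M, Tan n x) (x : M) : Matrix (Idx n) (Idx n) ℝ :=
  (2 * (n : ℝ) + 4) • 1 - ∑ a, S.betaMat a ε x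

theorem IsAdaptedFrame.hForm_sum (hε : S.IsAdaptedFrame U ε) (hx : x ∈ U) (z w : Idx n → ℝ) :
    S.hForm S.θ x (∑ i, z i • ε i x) (∑ i, w i • ε i x) = z ⬝ᵥ S.hMat ε x *ᵥ w := by
  have h1 : S.levi S.θ x (∑ i, z i • ε i x) (∑ i, w i • ε i x) = z ⬝ᵥ w := by
    have h := bilinMat_sum (S.gForm (fun _ _ => 0) x) (fun i => ε i x) z w
    rw [hε.bilinMat_gForm hx, Matrix.one_mulVec,
      gForm_of_mem _ (hε.sum_mem hx z) (hε.sum_mem hx w)] at h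
    exact h
  have h2 : ∀ a, dform (S.θ a) x (∑ i, z i • ε i x) (S.I a x (∑ i, w i • ε i x))
      = z ⬝ᵥ S.betaMat a ε x *ᵥ w := fun a =>
    bilinMat_sum (S.betaForm a x) (fun i => ε i x) z w
  rw [AlmostHyperCR.hForm, h1]
  simp only [h2]
  rw [hMat, Matrix.sub_mulVec, dotProduct_sub, Matrix.smul_mulVec, Matrix.one_mulVec,
    dotProduct_smul, smul_eq_mul]
  congr 1
  simp only [Fin.sum_univ_three, Matrix.add_mulVec, dotProduct_add]

theorem dform_of_mem (a : Fin 3) (hU : IsOpen U) {X Y : ∀ x : M, Tan n x} (hX : SmoothOn X U)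
    (hY : SmoothOn Y U) (hXQ : ∀ y ∈ U, X y ∈ S.Q y) (hYQ : ∀ y ∈ U, Y y ∈ S.Q y) (hx : x ∈ U) :
    dform (S.θ a) x (X x) (Y x) = -S.θ a x (brak X Y x) := by
  have h : ∀ {X : ∀ x : M, Tan n x}, (∀ y ∈ U, X y ∈ S.Q y) → ∀ v : Tan n x,
      dir (fun y => S.θ a y (X y)) x v = 0 := fun {X} h v => dir_eq_zero (c := 0) (by
    filter_upwards [hU.mem_nhds hx] with y hy using S.mem_Q_iff.1 (h y hy) a) v
  have h1 := h hXQ (Y x)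
  have h2 := h hYQ (X x)
  rw [dform_apply (S.compatible.smooth a) (hX.diffAt hU hx) (hY.diffAt hU hx), cartan]
  change dir _ x _ - dir _ x _ - _ = _
  rw [h1, h2]
  ring

/-- The Koszul expression of an adapted frame. -/
theorem IsAdaptedFrame.koszul_eq (hε : S.IsAdaptedFrame U ε) (hx : x ∈ U) (i j k : Idx n) :
    koszul (S.gForm T) (ε k) (ε j) (ε i) x = S.gForm T x (brak (ε k) (ε j) x) (ε i x)
      - S.gForm T x (brak (ε k) (ε i) x) (ε j x) - S.gForm T x (brak (ε j) (ε i) x) (ε k x) := by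
  have h : ∀ (i j) (v : Tan n x), dir (fun y => S.gForm T y (ε i y) (ε j y)) x v = 0 := fun i j v =>
    dir_eq_zero (c := if i = j then 1 else 0) (by
      filter_upwards [hε.isOpen.mem_nhds hx] with y hy
      rw [gForm_of_mem T (hε.mem i y hy) (hε.mem j y hy), hε.orthonormal i j y hy]) v
  rw [koszul, h, h, h]
  ring

/-- Replacing `T_a` by `T_a + I_a z` changes the `Q`-component of `v` by `-∑ θ_a(v) I_a z`. -/
theorem IsNormalized.gForm_change [T2Space M] (hT : S.IsNormalized T) (hT' : S.IsNormalized T')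
    {z v w : Tan n x} (hz : ∀ a, T' a x = T a x + S.I a x z) (hw : w ∈ S.Q x) :
    S.gForm T' x v w = S.gForm T x v w - ∑ a, S.θ a x v * S.gForm T x (S.I a x z) w := by
  have h1 : S.proj T' x v = S.proj T x v - ∑ a, S.θ a x v • S.I a x z := by
    simp only [proj_apply, hz, smul_add, Finset.sum_add_distrib]
    abel
  rw [← hT'.isSplitForm_gForm.proj_left x v, gForm_of_mem T' (hT'.proj_mem x v) hw,
    ← gForm_of_mem T (hT'.proj_mem x v) hw, h1, map_sub, LinearMap.sub_apply,
    hT.isSplitForm_gForm.proj_left, map_sum, LinearMap.sum_apply]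
  simp only [map_smul, LinearMap.smul_apply, smul_eq_mul]

/-- The change of the connection forms under a change of the three-plane field. -/
theorem IsNormalized.omega_change [T2Space M] (hT : S.IsNormalized T) (hT' : S.IsNormalized T')
    {D D' : Connection n M} (hD : S.IsAssociated (AlmostHyperCR.planeField T) D)
    (hD' : S.IsAssociated (AlmostHyperCR.planeField T') D') (hε : S.IsAdaptedFrame U ε)
    (hx : x ∈ U) {z : Idx n → ℝ}
    (hz : ∀ a, T' a x = T a x + S.I a x (∑ i, z i • ε i x)) (k : Idx n) :
    toMat (S.omega D' ε x k) = toMat (S.omega D ε x k)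
      + (1 / 2 : ℝ) • ∑ a, deltaMat (S.betaMat a ε x * quat n a) (quat n a *ᵥ z) k := by
  ext i j
  have hb : ∀ a i j, (S.betaMat a ε x * quat n a) i j = dform (S.θ a) x (ε j x) (ε i x) := by
    intro a i j
    have h1 : (S.betaMat a ε x * quat n a) i j = S.betaForm a x (ε i x) (S.I a x (ε j x)) := by
      rw [hε.I_apply hx, map_sum, Matrix.mul_apply]
      refine Finset.sum_congr rfl fun l _ => ?_
      rw [map_smul, smul_eq_mul, mul_comm]
      rfl
    rw [h1, betaForm_apply, beta, S.I_sq a (hε.mem j x hx), dform_neg_right, ← dform_swap]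
  have hθ : ∀ a i j, S.θ a x (brak (ε i) (ε j) x) = -(S.betaMat a ε x * quat n a) j i := by
    intro a i j
    rw [hb, dform_of_mem a hε.isOpen (hε.smooth i) (hε.smooth j) (hε.mem i) (hε.mem j) hx, neg_neg]
  have hu : ∀ a i, S.gForm T x (S.I a x (∑ i, z i • ε i x)) (ε i x) = (quat n a *ᵥ z) i := by
    intro a i
    have h : ∀ j, S.gForm T x (ε j x) (ε i x) = if j = i then 1 else 0 := fun j => by
      rw [gForm_of_mem T (hε.mem j x hx) (hε.mem i x hx), hε.orthonormal j i x hx]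
    rw [hε.I_sum hx, map_sum, LinearMap.sum_apply]
    simp [h]
  change S.omega D' ε x k (i, j) = S.omega D ε x k (i, j) + _
  -- The frame is orthonormal for both plane fields, so only bracket terms survive. The three
  -- brackets produce the two parts of the wedge and the multiple of `Ω` in `deltaMat`.
  rw [hT'.omega_apply hD' hε hx, hT.omega_apply hD hε hx, hε.koszul_eq hx, hε.koszul_eq hx,
    hT.gForm_change hT' hz (hε.mem i x hx), hT.gForm_change hT' hz (hε.mem j x hx),
    hT.gForm_change hT' hz (hε.mem k x hx)]
  simp only [hθ, hu, Fin.sum_univ_three, deltaMat, wedge, Matrix.smul_apply, Matrix.add_apply,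
    Matrix.sub_apply, Matrix.vecMulVec_apply, smul_eq_mul, Matrix.col_apply]
  ring

/-- The change of the obstruction under a change of the three-plane field. -/
theorem IsNormalized.pairEH_change [T2Space M] (hn : n ≠ 0) (hT : S.IsNormalized T)
    (hT' : S.IsNormalized T') {D D' : Connection n M}
    (hD : S.IsAssociated (AlmostHyperCR.planeField T) D)
    (hD' : S.IsAssociated (AlmostHyperCR.planeField T') D') (hε : S.IsAdaptedFrame U ε)
    (hx : x ∈ U) {z : Idx n → ℝ}
    (hz : ∀ a, T' a x = T a x + S.I a x (∑ i, z i • ε i x)) (w : Idx n → ℝ) :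
    pairEH (S.omega D' ε x) w = pairEH (S.omega D ε x) w
      - 3 / 2 * (1 - 1 / n) * (w ⬝ᵥ S.hMat ε x *ᵥ z) := by
  have hn' : (n : ℝ) ≠ 0 := Nat.cast_ne_zero.2 hn
  rw [pairEH_eq_sum hn, pairEH_eq_sum hn]
  simp only [hT.omega_change hT' hD hD' hε hx hz, Matrix.mul_add, Matrix.trace_add,
    Finset.sum_add_distrib, Matrix.mul_smul, Matrix.trace_smul, Matrix.mul_sum, Matrix.trace_sum,
    smul_eq_mul]
  rw [← Finset.mul_sum, Finset.sum_comm]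
  have h := fun a => sum_trace_obsMat_mul_deltaMat_quat hn a (hT.betaMat_transpose hε hx a)
    (hT.betaMat_mul_quat hε hx a) (fun b hb => hT.betaMat_sub hε hx hb) w z
  -- The three contributions assemble into `h` because `2n + 2 - 4/n = (1 - 1/n)(2n + 4)`; this is
  -- the origin of the constant `2n + 4` in its definition.
  simp only [h, hMat, Fin.sum_univ_three, Matrix.sub_mulVec, Matrix.smul_mulVec, Matrix.one_mulVec,
    Matrix.add_mulVec, dotProduct_sub, dotProduct_add, dotProduct_smul, smul_eq_mul]
  field_simp
  ring

end HyperPseudohermitian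
end HyperCR

/-! ### Changes of adapted frame. -/

namespace HyperCR

open Matrix

section Sums

variable {n : ℕ} {M : Type*} [TopologicalSpace M] [ChartedSpace (ModelE n) M]
  [IsManifold (𝓡 (4 * n + 3)) ∞ M] {x : M}

theorem dir_sum {ι : Type*} (s : Finset ι) (c : ι → ℝ) {f : ι → M → ℝ}
    (hf : ∀ i, DiffFunAt n (f i) x) (v : Tan n x) :
    dir (fun y => ∑ i ∈ s, c i * f i y) x v = ∑ i ∈ s, c i * dir (f i) x v := by
  classical
  induction s using Finset.induction_on with
  | empty => simp [dir, mvfderiv_const]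
  | insert i s hi h =>
    have h1 : DiffFunAt n (fun y => c i * f i y) x := (mdifferentiableAt_const).mul (hf i)
    have h2 : DiffFunAt n (fun y => ∑ j ∈ s, c j * f j y) x :=
      DiffFunAt.sum fun j _ => (mdifferentiableAt_const).mul (hf j)
    simp only [Finset.sum_insert hi]
    rw [← h, dir, mvfderiv_fun_add h1 h2, mvfderiv_fun_mul mdifferentiableAt_const (hf i)]
    simp [mvfderiv_const]

theorem connection_sum (D : Connection n M) {ι : Type*} (s : Finset ι) {f : ι → M → ℝ}
    {X : ι → ∀ x : M, Tan n x} (hf : ∀ i, DiffFunAt n (f i) x) (hX : ∀ i, DiffAt (X i) x)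
    (v : Tan n x) : D (fun y => ∑ i ∈ s, f i y • X i y) x v
      = ∑ i ∈ s, (f i x • D (X i) x v + dir (f i) x v • X i x) := by
  classical
  induction s using Finset.induction_on with
  | empty =>
    simp only [Finset.sum_empty]
    have := congrFun (CovariantDerivative.zero D) x
    change D 0 x v = 0
    rw [this]
    rfl
  | insert i s hi h =>
    have h1 : DiffAt (f i • X i) x := MDifferentiableAt.smul_section (hf i) (hX i)
    have h2 : DiffAt (fun y => ∑ j ∈ s, f j y • X j y) x :=
      MDifferentiableAt.sum_section fun j _ => (hf j).smul_section (hX j)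
    have e : (fun y => ∑ j ∈ insert i s, f j y • X j y)
        = f i • X i + fun y => ∑ j ∈ s, f j y • X j y := by
      funext y
      simp [Finset.sum_insert hi]
    rw [e, D.isCovariantDerivativeOnUniv.add h1 h2, D.isCovariantDerivativeOnUniv.leibniz (hX i) (hf i),
      Finset.sum_insert hi, ← h]
    rfl

end Sums

namespace HyperPseudohermitian

variable {n : ℕ} {M : Type*} [TopologicalSpace M] [ChartedSpace (ModelE n) M]
  [IsManifold (𝓡 (4 * n + 3)) ∞ M] {S : HyperPseudohermitian n M}
  {T T' : Fin 3 → ∀ x : M, Tan n x} {U U' : Set M} {ε ε' : Idx n → ∀ x : M, Tan n x} {x : M}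
  {D D' : Connection n M}

theorem IsAdaptedFrame.gForm_sum (hε : S.IsAdaptedFrame U ε) (hx : x ∈ U) (c : Idx n → ℝ)
    (k : Idx n) : S.gForm T x (∑ i, c i • ε i x) (ε k x) = c k := by
  have h : ∀ j, S.gForm T x (ε j x) (ε k x) = if j = k then 1 else 0 := fun j => by
    rw [gForm_of_mem T (hε.mem j x hx) (hε.mem k x hx), hε.orthonormal j k x hx]
  rw [map_sum, LinearMap.sum_apply]
  simp [h]

theorem IsAdaptedFrame.coeff_unique (hε : S.IsAdaptedFrame U ε) (hx : x ∈ U) {c c' : Idx n → ℝ}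
    (h : ∑ i, c i • ε i x = ∑ i, c' i • ε i x) : c = c' := by
  funext k
  rw [← hε.gForm_sum (T := fun _ _ => 0) hx c k, h, hε.gForm_sum hx]

theorem IsAdaptedFrame.exists_section [T2Space M] (hε : S.IsAdaptedFrame U ε) (hx : x ∈ U)
    (i : Idx n) : ∃ E : ∀ x : M, Tan n x, IsSection S.Q E ∧ ∀ᶠ y in 𝓝 x, E y = ε i y := by
  obtain ⟨f, hf, hf1, hf0⟩ := (hε.smooth i).exists_global hε.isOpen hx
  refine ⟨_, ⟨hf, fun y => ?_⟩, hf1.mono fun y hy => by rw [hy, one_smul]⟩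
  by_cases hy : y ∈ U
  · exact Submodule.smul_mem _ _ (hε.mem i y hy)
  · rw [hf0 y hy, zero_smul]; exact zero_mem _

/-- Locality of the connection carries the condition on global sections over to frame fields defined
only on `U`. -/
theorem IsAdaptedFrame.connection_mem [T2Space M] (hε : S.IsAdaptedFrame U ε) (hx : x ∈ U)
    {P : ∀ x : M, Submodule ℝ (Tan n x)} (hD : S.IsAssociated P D) (i : Idx n) (v : Tan n x) :
    D (ε i) x v ∈ S.Q x := by
  obtain ⟨E, hE, h⟩ := hε.exists_section hx i
  rw [D.isCovariantDerivativeOnUniv.congr_of_eventuallyEq ((hε.smooth i).diffAt hε.isOpen hx)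
      (hE.diffAt x) Filter.univ_mem (h.mono fun y hy => hy.symm)]
  exact hD.preserves_Q E hE x v

variable (S) in
/-- The transition matrix between two families of vector fields. -/
def transition (T : Fin 3 → ∀ x : M, Tan n x) (ε ε' : Idx n → ∀ x : M, Tan n x) (x : M) :
    Matrix (Idx n) (Idx n) ℝ := Matrix.of fun k j => S.gForm T x (ε' j x) (ε k x)

theorem IsNormalized.eq_sum_transition (hT : S.IsNormalized T) (hε : S.IsAdaptedFrame U ε)
    (hε' : S.IsAdaptedFrame U' ε') (hx : x ∈ U) (hx' : x ∈ U') (j : Idx n) :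
    ε' j x = ∑ k, S.transition T ε ε' x k j • ε k x :=
  hT.expand_adaptedFrame hε hx (hε'.mem j x hx')

theorem IsNormalized.sum_frame_eq (hT : S.IsNormalized T) (hε : S.IsAdaptedFrame U ε)
    (hε' : S.IsAdaptedFrame U' ε') (hx : x ∈ U) (hx' : x ∈ U') (w : Idx n → ℝ) :
    ∑ i, w i • ε' i x = ∑ i, (S.transition T ε ε' x *ᵥ w) i • ε i x := by
  simp only [hT.eq_sum_transition hε hε' hx hx', Finset.smul_sum, Matrix.mulVec, dotProduct,
    Finset.sum_smul, smul_smul]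
  rw [Finset.sum_comm]
  simp only [mul_comm]

theorem IsNormalized.transition_transpose_mul (hT : S.IsNormalized T)
    (hε : S.IsAdaptedFrame U ε) (hε' : S.IsAdaptedFrame U' ε') (hx : x ∈ U) (hx' : x ∈ U') :
    (S.transition T ε ε' x)ᵀ * S.transition T ε ε' x = 1 := by
  have h := bilinMat_mul (S.gForm T x) (e := fun i => ε i x) (e' := fun i => ε' i x)
    (hT.eq_sum_transition hε hε' hx hx')
  rw [hε.bilinMat_gForm hx, hε'.bilinMat_gForm hx', mul_one] at h
  exact h.symm

theorem IsNormalized.transition_mul_quat (hT : S.IsNormalized T)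
    (hε : S.IsAdaptedFrame U ε) (hε' : S.IsAdaptedFrame U' ε') (hx : x ∈ U) (hx' : x ∈ U')
    (a : Fin 3) : S.transition T ε ε' x * quat n a = quat n a * S.transition T ε ε' x := by
  have h : ∀ j, (S.transition T ε ε' x * quat n a).col j
      = (quat n a * S.transition T ε ε' x).col j := by
    intro j
    refine hε.coeff_unique hx ?_
    have h1 := hε'.I_apply hx' a j
    rw [hT.eq_sum_transition hε hε' hx hx' j, hε.I_sum hx, hT.sum_frame_eq hε hε' hx hx'] at h1
    exact h1.symm
  ext i j
  exact congrFun (h j) i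

theorem IsNormalized.transition_smooth [T2Space M] (hT : S.IsNormalized T)
    (hε : S.IsAdaptedFrame U ε) (hε' : S.IsAdaptedFrame U' ε') (k j : Idx n) :
    SmoothFun n (fun x => S.transition T ε ε' x k j) (U ∩ U') :=
  hT.gForm_smooth _ (hε.isOpen.inter hε'.isOpen) _ _
    ((hε'.smooth j).mono Set.inter_subset_right) ((hε.smooth k).mono Set.inter_subset_left)

variable (S) in
/-- The derivative of the transition matrix. -/
def dirTransition (T : Fin 3 → ∀ x : M, Tan n x) (ε ε' : Idx n → ∀ x : M, Tan n x) (x : M)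
    (v : Tan n x) : Matrix (Idx n) (Idx n) ℝ :=
  Matrix.of fun k j => dir (fun y => S.transition T ε ε' y k j) x v

/-- The units have constant matrices in adapted frames, so the commutation relation for the
transition matrix can be differentiated. -/
theorem IsNormalized.dirTransition_mul_quat [T2Space M] (hT : S.IsNormalized T)
    (hε : S.IsAdaptedFrame U ε) (hε' : S.IsAdaptedFrame U' ε') (hx : x ∈ U) (hx' : x ∈ U')
    (v : Tan n x) (a : Fin 3) :
    S.dirTransition T ε ε' x v * quat n a = quat n a * S.dirTransition T ε ε' x v := by
  have hUU := hε.isOpen.inter hε'.isOpen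
  have hd : ∀ k j, DiffFunAt n (fun y => S.transition T ε ε' y k j) x := fun k j =>
    (hT.transition_smooth hε hε' k j).diffAt hUU ⟨hx, hx'⟩
  ext i j
  have h1 := dir_sum (x := x) Finset.univ (fun m => quat n a m j) (fun m => hd i m) v
  have h2 := dir_sum (x := x) Finset.univ (fun m => quat n a i m) (fun m => hd m j) v
  have h3 : ∀ᶠ y in 𝓝 x, ∑ m, quat n a m j * S.transition T ε ε' y i m
      = ∑ m, quat n a i m * S.transition T ε ε' y m j := by
    filter_upwards [hUU.mem_nhds ⟨hx, hx'⟩] with y hy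
    have h := congrFun (congrFun (hT.transition_mul_quat hε hε' hy.1 hy.2 a) i) j
    rw [Matrix.mul_apply, Matrix.mul_apply] at h
    rw [← h]
    exact Finset.sum_congr rfl fun m _ => mul_comm _ _
  have h4 := dir_congr h3 v
  rw [h1, h2] at h4
  rw [Matrix.mul_apply, Matrix.mul_apply]
  refine Eq.trans (Finset.sum_congr rfl fun m _ => ?_) h4
  exact mul_comm _ _

theorem IsNormalized.connection_frame [T2Space M] (hT : S.IsNormalized T)
    (hε : S.IsAdaptedFrame U ε) (hε' : S.IsAdaptedFrame U' ε') (hx : x ∈ U) (hx' : x ∈ U')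
    (j : Idx n) (v : Tan n x) :
    D (ε' j) x v = ∑ m, (S.transition T ε ε' x m j • D (ε m) x v
        + S.dirTransition T ε ε' x v m j • ε m x) := by
  have hUU := hε.isOpen.inter hε'.isOpen
  have hd : ∀ k j, DiffFunAt n (fun y => S.transition T ε ε' y k j) x := fun k j =>
    (hT.transition_smooth hε hε' k j).diffAt hUU ⟨hx, hx'⟩
  have hεd : ∀ k, DiffAt (ε k) x := fun k => (hε.smooth k).diffAt hε.isOpen hx
  have h0 : DiffAt (fun y => ∑ m, S.transition T ε ε' y m j • ε m y) x :=
    MDifferentiableAt.sum_section fun m _ => (hd m j).smul_section (hεd m)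
  have h1 : ∀ᶠ y in 𝓝 x, ε' j y = ∑ m, S.transition T ε ε' y m j • ε m y := by
    filter_upwards [hUU.mem_nhds ⟨hx, hx'⟩] with y hy
    exact hT.eq_sum_transition hε hε' hy.1 hy.2 j
  rw [D.isCovariantDerivativeOnUniv.congr_of_eventuallyEq
    ((hε'.smooth j).diffAt hε'.isOpen hx') h0 Filter.univ_mem h1]
  exact connection_sum D Finset.univ (fun m => hd m j) hεd v

/-- The gauge formula `ω' = Aᵀ ω A + Aᵀ dA`, where the form index is also transformed by `A` because
`ω` is evaluated on frame vectors. -/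
theorem IsNormalized.omega_frame [T2Space M] (hT : S.IsNormalized T)
    (hD : S.IsAssociated (AlmostHyperCR.planeField T) D) (hε : S.IsAdaptedFrame U ε)
    (hε' : S.IsAdaptedFrame U' ε') (hx : x ∈ U) (hx' : x ∈ U') (l : Idx n) :
    toMat (S.omega D ε' x l) = (S.transition T ε ε' x)ᵀ
        * (∑ k, S.transition T ε ε' x k l • toMat (S.omega D ε x k)) * S.transition T ε ε' x
      + (S.transition T ε ε' x)ᵀ * S.dirTransition T ε ε' x (ε' l x) := by
  ext i j
  have h2 : ∀ m r, S.gForm T x (D (ε m) x (ε' l x)) (ε r x)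
      = (∑ p, S.transition T ε ε' x p l • toMat (S.omega D ε x p)) r m := by
    intro m r
    rw [hT.eq_sum_transition hε hε' hx hx' l, map_sum, map_sum, LinearMap.sum_apply,
      Matrix.sum_apply]
    refine Finset.sum_congr rfl fun p _ => ?_
    rw [map_smul, map_smul, LinearMap.smul_apply, Matrix.smul_apply,
      gForm_of_mem T (hε.connection_mem hx hD m _) (hε.mem r x hx)]
    rfl
  have h3 : ∀ v, S.gForm T x v (ε' i x)
      = ∑ r, S.transition T ε ε' x r i * S.gForm T x v (ε r x) := fun v => by
    rw [hT.eq_sum_transition hε hε' hx hx' i, map_sum]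
    simp only [map_smul, smul_eq_mul]
  have h4 : ∀ m, S.gForm T x (ε m x) (ε' i x) = S.transition T ε ε' x m i := fun m =>
    hT.gForm_symm x _ _
  have h5 : toMat (S.omega D ε' x l) i j = S.g x (D (ε' j) x (ε' l x)) (ε' i x) := rfl
  rw [h5, ← gForm_of_mem T (hε'.connection_mem hx' hD j _) (hε'.mem i x hx'),
    hT.connection_frame hε hε' hx hx', map_sum,
    LinearMap.sum_apply, Matrix.add_apply, Matrix.mul_apply, Matrix.mul_apply,
    ← Finset.sum_add_distrib]
  refine Finset.sum_congr rfl fun m _ => ?_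
  rw [map_add, LinearMap.add_apply, map_smul, map_smul, LinearMap.smul_apply,
    LinearMap.smul_apply, h4, h3, Matrix.mul_apply]
  simp only [h2, smul_eq_mul, Matrix.transpose_apply]
  ring

/-- The behaviour of the obstruction under a change of adapted frame. -/
theorem IsNormalized.pairEH_frame [T2Space M] (hn : n ≠ 0) (hT : S.IsNormalized T)
    (hD : S.IsAssociated (AlmostHyperCR.planeField T) D) (hε : S.IsAdaptedFrame U ε)
    (hε' : S.IsAdaptedFrame U' ε') (hx : x ∈ U) (hx' : x ∈ U') (w : Idx n → ℝ) :
    pairEH (S.omega D ε' x) w = pairEH (S.omega D ε x) (S.transition T ε ε' x *ᵥ w) := by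
  have hAq' : ∀ a, (S.transition T ε ε' x)ᵀ * quat n a
      = quat n a * (S.transition T ε ε' x)ᵀ := fun a => by
    have := congrArg Matrix.transpose (hT.transition_mul_quat hε hε' hx hx' a)
    rw [Matrix.transpose_mul, Matrix.transpose_mul, quat_transpose, neg_mul, mul_neg, neg_inj] at this
    exact this.symm
  refine pairEH_frame_change hn (hT.transition_transpose_mul hε hε' hx hx')
    (hT.transition_mul_quat hε hε' hx hx')
    (s := fun l => (S.transition T ε ε' x)ᵀ * S.dirTransition T ε ε' x (ε' l x)) (fun l a => ?_)
    (hT.omega_frame hD hε hε' hx hx') w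
  rw [Matrix.mul_assoc, hT.dirTransition_mul_quat hε hε' hx hx', ← Matrix.mul_assoc, hAq',
    Matrix.mul_assoc]

/-- The Koszul formula exhibits the pairing as a constant-coefficient combination of smooth
expressions in the frame. -/
theorem IsNormalized.pairEH_smooth [T2Space M] (hn : n ≠ 0) (hT : S.IsNormalized T)
    (hD : S.IsAssociated (AlmostHyperCR.planeField T) D) (hε : S.IsAdaptedFrame U ε)
    (w : Idx n → ℝ) : SmoothFun n (fun x => pairEH (S.omega D ε x) w) U := by
  have h : SmoothFun n (fun x => ∑ k, ∑ i, ∑ j, (obsMat (wedge w (Pi.single k 1)))ᵀ i j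
      * (koszul (S.gForm T) (ε k) (ε i) (ε j) x * (1 / 2))) U :=
    SmoothFun.sum fun k _ => SmoothFun.sum fun i _ => SmoothFun.sum fun j _ =>
      (SmoothFun.const _).mul ((koszul_smooth hT.gForm_smooth hε.isOpen (hε.smooth k)
        (hε.smooth i) (hε.smooth j)).mul (SmoothFun.const _))
  refine h.congr fun x hx => ?_
  rw [pairEH_eq_sum hn]
  refine Finset.sum_congr rfl fun k _ => ?_
  simp only [Matrix.trace, Matrix.diag_apply, Matrix.mul_apply]
  refine Finset.sum_congr rfl fun i _ => Finset.sum_congr rfl fun j _ => ?_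
  have := hT.omega_apply hD hε hx j i k
  change _ * S.omega D ε x k (j, i) = _
  rw [this, div_eq_mul_one_div]

end HyperPseudohermitian
end HyperCR

/-! ### Solving for the canonical triple. -/

namespace HyperCR

section MatrixSmoothness

variable {n : ℕ} {M : Type*} [TopologicalSpace M] [ChartedSpace (ModelE n) M] {U : Set M}

theorem SmoothFun.det {ι : Type*} [Fintype ι] [DecidableEq ι] {A : M → Matrix ι ι ℝ}
    (hA : ∀ i j, SmoothFun n (fun x => A x i j) U) : SmoothFun n (fun x => (A x).det) U := by
  simp only [Matrix.det_apply']
  exact SmoothFun.sum fun σ _ => (SmoothFun.const _).mul (SmoothFun.prod fun i _ => hA _ _)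

/-- Cramer's rule: the entries of the inverse are quotients of determinants. -/
theorem SmoothFun.matrix_inv {ι : Type*} [Fintype ι] [DecidableEq ι] {A : M → Matrix ι ι ℝ}
    (hA : ∀ i j, SmoothFun n (fun x => A x i j) U) (h0 : ∀ x ∈ U, IsUnit (A x).det) (i j : ι) :
    SmoothFun n (fun x => (A x)⁻¹ i j) U := by
  have h : SmoothFun n (fun x => (A x).det⁻¹ * (A x).adjugate i j) U := by
    refine ((SmoothFun.det hA).inv fun x hx => (h0 x hx).ne_zero).mul ?_
    simp only [Matrix.adjugate_apply]
    refine SmoothFun.det fun k l => ?_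
    by_cases hk : k = j
    · subst hk
      simp only [Matrix.updateRow_self]
      exact SmoothFun.const _
    · simp only [Matrix.updateRow_ne hk]
      exact hA k l
  refine h.congr fun x hx => ?_
  rw [Matrix.inv_def, Matrix.smul_apply, Ring.inverse_eq_inv', smul_eq_mul]

end MatrixSmoothness

namespace HyperPseudohermitian

open Matrix

variable {n : ℕ} {M : Type*} [TopologicalSpace M] [ChartedSpace (ModelE n) M]
  [IsManifold (𝓡 (4 * n + 3)) ∞ M] {S : HyperPseudohermitian n M}
  {T T' : Fin 3 → ∀ x : M, Tan n x} {U U' : Set M} {ε ε' : Idx n → ∀ x : M, Tan n x} {x : M}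
  {D D' : Connection n M}

theorem omegaEHVanishes_iff : S.OmegaEHVanishes D ↔
    ∀ U ε, S.IsAdaptedFrame U ε → ∀ x ∈ U, ∀ w, pairEH (S.omega D ε x) w = 0 := by
  simp only [OmegaEHVanishes, omegaEH, omegaObs, starProjection_summandEH_eq_zero]

/-- A definite form of either sign has no kernel. -/
theorem IsAdaptedFrame.isUnit_det_hMat (hS : S.UltraPseudoconvex) (hε : S.IsAdaptedFrame U ε)
    (hx : x ∈ U) : IsUnit (S.hMat ε x).det := by
  rw [isUnit_iff_ne_zero]
  intro h
  obtain ⟨z, hz0, hz⟩ := Matrix.exists_mulVec_eq_zero_iff.2 h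
  have h1 := hε.hForm_sum hx z z
  rw [hz, dotProduct_zero] at h1
  have h2 : ∑ i, z i • ε i x ≠ 0 := fun h0 => hz0 (hε.coeff_unique hx (by simp [h0]))
  rcases hS with hS | hS
  · exact (hS x _ (hε.sum_mem hx z) h2).ne' h1
  · exact (hS x _ (hε.sum_mem hx z) h2).ne h1

variable (S) in
/-- The coordinates, in an adapted frame, of the vector `Z` of `Q` that solves the equation
`(3/2) (1 - 1/n) h(Z, w) = pairEH ω w`. -/
def correctionCoord (D : Connection n M) (ε : Idx n → ∀ x : M, Tan n x) (x : M) : Idx n → ℝ :=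
  (S.hMat ε x)⁻¹ *ᵥ fun i => (3 / 2 * (1 - 1 / (n : ℝ)))⁻¹ * pairEH (S.omega D ε x) (Pi.single i 1)

/-- Here `n > 1` is essential: for `n = 1` the factor `1 - 1/n` vanishes. -/
theorem IsAdaptedFrame.correctionCoord_spec (hn : 1 < n) (hS : S.UltraPseudoconvex)
    (hε : S.IsAdaptedFrame U ε) (hx : x ∈ U) (w : Idx n → ℝ) :
    3 / 2 * (1 - 1 / (n : ℝ)) * (w ⬝ᵥ S.hMat ε x *ᵥ S.correctionCoord D ε x)
      = pairEH (S.omega D ε x) w := by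
  have hn' : (1 : ℝ) < n := by exact_mod_cast hn
  have hc : 3 / 2 * (1 - 1 / (n : ℝ)) ≠ 0 := by
    have : 1 / (n : ℝ) < 1 := (div_lt_one (by linarith)).2 hn'
    have : 0 < 1 - 1 / (n : ℝ) := by linarith
    positivity
  rw [correctionCoord, Matrix.mulVec_mulVec, Matrix.mul_nonsing_inv _ (hε.isUnit_det_hMat hS hx),
    Matrix.one_mulVec, pairEH_eq_dotProduct _ w]
  simp only [dotProduct, Finset.mul_sum]
  refine Finset.sum_congr rfl fun i _ => ?_
  rw [mul_left_comm, mul_inv_cancel_left₀ hc]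

theorem IsAdaptedFrame.eq_correctionCoord (hn : 1 < n) (hS : S.UltraPseudoconvex)
    (hε : S.IsAdaptedFrame U ε) (hx : x ∈ U) {z : Idx n → ℝ}
    (hz : ∀ w, 3 / 2 * (1 - 1 / (n : ℝ)) * (w ⬝ᵥ S.hMat ε x *ᵥ z) = pairEH (S.omega D ε x) w) :
    z = S.correctionCoord D ε x := by
  have hn' : (1 : ℝ) < n := by exact_mod_cast hn
  have hc : 3 / 2 * (1 - 1 / (n : ℝ)) ≠ 0 := by
    have : 1 / (n : ℝ) < 1 := (div_lt_one (by linarith)).2 hn'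
    have : 0 < 1 - 1 / (n : ℝ) := by linarith
    positivity
  have h1 : S.hMat ε x *ᵥ z = S.hMat ε x *ᵥ S.correctionCoord D ε x := by
    funext i
    have h := (hz (Pi.single i 1)).trans (hε.correctionCoord_spec hn hS hx (Pi.single i 1)).symm
    have h' := mul_left_cancel₀ hc h
    rwa [single_one_dotProduct, single_one_dotProduct] at h'
  have h2 := congrArg ((S.hMat ε x)⁻¹ *ᵥ ·) h1
  have hu := hε.isUnit_det_hMat hS hx
  simpa [Matrix.mulVec_mulVec, Matrix.nonsing_inv_mul _ hu] using h2

theorem IsNormalized.hMat_smooth [T2Space M] (hT : S.IsNormalized T) (hε : S.IsAdaptedFrame U ε)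
    (i j : Idx n) : SmoothFun n (fun x => S.hMat ε x i j) U := by
  have hb : ∀ a, SmoothFun n (fun x => S.betaMat a ε x i j) U := fun a => by
    have h : SmoothOn (fun x => S.I a x (ε j x)) U :=
      (hT.I_proj_smooth a U hε.isOpen _ (hε.smooth j)).congr fun x hx => by
        rw [LinearMap.comp_apply, proj_of_mem T (hε.mem j x hx)]
    exact (S.compatible.smooth a).dform_smooth hε.isOpen (hε.smooth i) h
  have h := (SmoothFun.const (n := n) (U := U)
    ((2 * (n : ℝ) + 4) * (1 : Matrix (Idx n) (Idx n) ℝ) i j)).sub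
    (SmoothFun.sum (s := Finset.univ) fun a _ => hb a)
  refine h.congr fun x _ => ?_
  rw [hMat, Matrix.sub_apply, Matrix.smul_apply, Matrix.sum_apply, smul_eq_mul]

theorem IsNormalized.correction_smooth [T2Space M] (hn : n ≠ 0) (hS : S.UltraPseudoconvex)
    (hT : S.IsNormalized T) (hD : S.IsAssociated (AlmostHyperCR.planeField T) D)
    (hε : S.IsAdaptedFrame U ε) :
    SmoothOn (fun x => ∑ i, S.correctionCoord D ε x i • ε i x) U := by
  refine SmoothOn.sum fun i _ => SmoothOn.smul ?_ (hε.smooth i)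
  simp only [correctionCoord, Matrix.mulVec, dotProduct]
  exact SmoothFun.sum fun j _ => (SmoothFun.matrix_inv (fun i j => hT.hMat_smooth hε i j)
    (fun x hx => hε.isUnit_det_hMat hS hx) i j).mul
    ((SmoothFun.const _).mul (hT.pairEH_smooth hn hD hε _))

/-- The defining equation is frame independent: `h` is a form on `Q`, the pairing transforms as a
covector, and the solution is unique. -/
theorem IsNormalized.correction_eq [T2Space M] (hn : 1 < n) (hS : S.UltraPseudoconvex)
    (hT : S.IsNormalized T) (hD : S.IsAssociated (AlmostHyperCR.planeField T) D)
    (hε : S.IsAdaptedFrame U ε) (hε' : S.IsAdaptedFrame U' ε') (hx : x ∈ U) (hx' : x ∈ U') :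
    ∑ i, S.correctionCoord D ε' x i • ε' i x = ∑ i, S.correctionCoord D ε x i • ε i x := by
  obtain ⟨z, hz⟩ : ∃ z : Idx n → ℝ,
      ∑ i, S.correctionCoord D ε x i • ε i x = ∑ i, z i • ε' i x :=
    ⟨_, hT.expand_adaptedFrame hε' hx' (hε.sum_mem hx _)⟩
  rw [hz, hε'.eq_correctionCoord hn hS hx' (z := z) fun w => ?_]
  rw [← hε'.hForm_sum hx', ← hz, hT.sum_frame_eq hε hε' hx hx', hε.hForm_sum hx,
    hε.correctionCoord_spec hn hS hx, hT.pairEH_frame (by omega) hD hε hε' hx hx']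

/-- The translation of a normalized triple by a section of `Q`. -/
theorem IsNormalized.translate (hT : S.IsNormalized T) {Z : ∀ x : M, Tan n x}
    (hZ : IsSection S.Q Z) : S.IsNormalized fun a x => T a x + S.I a x (Z x) := by
  have hθ : ∀ a b x, S.θ a x (S.I b x (Z x)) = 0 := fun a b x =>
    S.mem_Q_iff.1 (S.I_mem b (hZ.2 x)) a
  have hnorm : ∀ a x, S.θ a x (T a x + S.I a x (Z x)) = 1 := fun a x => by
    rw [map_add, hT.norm, hθ, add_zero]
  refine ⟨⟨fun a => (hT.triple.smooth a).add (S.I_section a hZ).1, fun a x h => ?_,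
    fun a x => ⟨?_, ?_⟩, fun a x => ?_⟩, hnorm⟩
  · have h1 := hnorm a x
    rw [S.mem_Q_iff.1 h a] at h1
    exact zero_ne_one h1
  · exact add_mem (hT.triple.mem a x).1 (S.Q_le _ x (S.I_mem a (hZ.2 x)))
  · exact add_mem (hT.triple.mem a x).2 (S.Q_le _ x (S.I_mem a (hZ.2 x)))
  · rw [map_add, hT.triple.cyclic, S.I_mul a (hZ.2 x)]

/-- Two normalized triples differ by a translation. -/
theorem IsNormalized.exists_translate (hT : S.IsNormalized T) (hT' : S.IsNormalized T') (x : M) :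
    ∃ z ∈ S.Q x, ∀ a, T' a x = T a x + S.I a x z := by
  have hd : ∀ a, T' a x - T a x ∈ S.Q x := fun a => by
    rw [S.mem_Q_iff]
    intro b
    rw [map_sub, hT.theta_apply, hT'.theta_apply, sub_self]
  have hc : ∀ a, S.I a x (T' (a + 1) x - T (a + 1) x) = T' (a + 2) x - T (a + 2) x := fun a => by
    rw [map_sub, hT.triple.cyclic, hT'.triple.cyclic]
  have h0 : S.I 0 x (T' 1 x - T 1 x) = T' 2 x - T 2 x := hc 0
  have h1 : S.I 1 x (T' 2 x - T 2 x) = T' 0 x - T 0 x := hc 1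
  have m0 : S.I 0 x (S.I 2 x (T' 2 x - T 2 x)) = -S.I 1 x (T' 2 x - T 2 x) := S.I_mul_rev 2 (hd 2)
  have m1 : S.I 1 x (S.I 2 x (T' 2 x - T 2 x)) = S.I 0 x (T' 2 x - T 2 x) := S.I_mul 1 (hd 2)
  have m2 := S.I_sq 0 (hd 1)
  -- Solving `T'₃ - T₃ = K z` forces `z = -K(T'₃ - T₃)`; the other two equations follow from the
  -- cyclic relations for both triples.
  refine ⟨-S.I 2 x (T' 2 x - T 2 x), neg_mem (S.I_mem 2 (hd 2)), fun a => ?_⟩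
  rw [map_neg, ← sub_eq_iff_eq_add']
  fin_cases a
  · change T' 0 x - T 0 x = -S.I 0 x _
    rw [m0, neg_neg, h1]
  · change T' 1 x - T 1 x = -S.I 1 x _
    rw [m1, ← h0, m2, neg_neg]
  · change T' 2 x - T 2 x = -S.I 2 x _
    rw [S.I_sq 2 (hd 2), neg_neg]

/-- Existence of the canonical triple. -/
theorem exists_canonical [T2Space M] [SecondCountableTopology M] (hn : 1 < n)
    (hS : S.UltraPseudoconvex) : ∃ T, S.IsNormalized T ∧
      ∃ D, S.IsAssociated (AlmostHyperCR.planeField T) D ∧ S.OmegaEHVanishes D := by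
  obtain ⟨T, hT⟩ := S.exists_isNormalized
  obtain ⟨D, hD⟩ := hT.exists_isAssociated
  choose V e he hV using fun q : M => hT.exists_adaptedFrame q
  -- A different frame may be chosen at each point. By `correction_eq` the resulting field agrees
  -- near each point with the one given by a single frame, hence is smooth.
  let Z : ∀ x : M, Tan n x := fun x => ∑ i, S.correctionCoord D (e x) x i • e x i x
  have hZ : ∀ {U ε}, S.IsAdaptedFrame U ε → ∀ x ∈ U,
      Z x = ∑ i, S.correctionCoord D ε x i • ε i x := fun hε x hx =>
    hT.correction_eq hn hS hD hε (he x) hx (hV x)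
  have hZs : IsSection S.Q Z := by
    refine ⟨SmoothOn.of_locally fun q _ => ⟨V q, (he q).isOpen, hV q, ?_⟩,
      fun x => (he x).sum_mem (hV x) _⟩
    exact (hT.correction_smooth (by omega) hS hD (he q)).congr (hZ (he q))
  have hT' := hT.translate hZs
  obtain ⟨D', hD'⟩ := hT'.exists_isAssociated
  refine ⟨_, hT', D', hD', omegaEHVanishes_iff.2 fun U ε hε x hx w => ?_⟩
  rw [hT.pairEH_change (by omega) hT' hD hD' hε hx (z := S.correctionCoord D ε x)
    (fun a => by rw [← hZ hε x hx]) w, hε.correctionCoord_spec hn hS hx, sub_self]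

/-- Uniqueness of the canonical triple. -/
theorem IsNormalized.eq_of_omegaEHVanishes [T2Space M] (hn : 1 < n) (hS : S.UltraPseudoconvex)
    (hT : S.IsNormalized T) (hT' : S.IsNormalized T')
    (hD : S.IsAssociated (AlmostHyperCR.planeField T) D) (hDv : S.OmegaEHVanishes D)
    (hD' : S.IsAssociated (AlmostHyperCR.planeField T') D') (hDv' : S.OmegaEHVanishes D') :
    T = T' := by
  rw [omegaEHVanishes_iff] at hDv hDv'
  funext a x
  obtain ⟨z, hz, h⟩ := hT.exists_translate hT' x
  obtain ⟨U, ε, hε, hx⟩ := hT.exists_adaptedFrame x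
  obtain ⟨c, hc⟩ : ∃ c : Idx n → ℝ, z = ∑ i, c i • ε i x := ⟨_, hT.expand_adaptedFrame hε hx hz⟩
  -- Both obstructions vanish, so the difference of the triples solves the homogeneous equation,
  -- which zero solves as well.
  have key : ∀ w, 3 / 2 * (1 - 1 / (n : ℝ)) * (w ⬝ᵥ S.hMat ε x *ᵥ c) = 0 := fun w => by
    have := hT.pairEH_change (by omega) hT' hD hD' hε hx (fun a => by rw [h, hc]) w
    rw [hDv U ε hε x hx, hDv' U ε hε x hx] at this
    linarith
  have h1 : c = S.correctionCoord D ε x := hε.eq_correctionCoord hn hS hx fun w => by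
    rw [key, hDv U ε hε x hx]
  have h2 : (0 : Idx n → ℝ) = S.correctionCoord D ε x := hε.eq_correctionCoord hn hS hx fun w => by
    rw [Matrix.mulVec_zero, dotProduct_zero, mul_zero, hDv U ε hε x hx]
  rw [h, hc, h1, ← h2]
  simp

end HyperPseudohermitian
end HyperCR

end

theorem theorem3p2 {n : ℕ} (hn : 7 < 4 * n + 3)
    {M : Type*} [TopologicalSpace M] [T2Space M] [SecondCountableTopology M]
    [ChartedSpace (HyperCR.ModelE n) M] [IsManifold (𝓡 (4 * n + 3)) ∞ M]
    (S : HyperCR.HyperPseudohermitian n M) (hS : S.UltraPseudoconvex) :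
    -- every admissible three-plane field has exactly one associated connection
    (∀ P, S.IsAdmissible P →
      (∃ D, S.IsAssociated P D) ∧
      ∀ D D', S.IsAssociated P D → S.IsAssociated P D' → HyperCR.SameConnection D D') ∧
    -- the canonical three-plane field
    (∃! P : ∀ x : M, Submodule ℝ (HyperCR.Tan n x), S.IsAdmissible P ∧
      ∃ D, S.IsAssociated P D ∧ S.OmegaEHVanishes D) ∧
    -- the canonical triple
    (∃! T : Fin 3 → ∀ x : M, HyperCR.Tan n x,
      S.IsAdmissibleTriple T ∧ (∀ a x, S.θ a x (T a x) = 1) ∧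
      ∃ D, S.IsAssociated (HyperCR.AlmostHyperCR.planeField T) D ∧ S.OmegaEHVanishes D) := by
  have hn1 : 1 < n := by omega
  obtain ⟨T, hT, D, hD, hDv⟩ := HyperCR.HyperPseudohermitian.exists_canonical hn1 hS
  refine ⟨fun P hP => ?_,
    -- A competing plane field is first represented by a normalized triple, so uniqueness of the
    -- plane field reduces to uniqueness of the triple.
    ⟨_, ⟨⟨T, hT.triple, rfl⟩, D, hD, hDv⟩, ?_⟩, ⟨T, ⟨hT.triple, hT.norm, D, hD, hDv⟩, ?_⟩⟩
  · obtain ⟨T', hT', rfl⟩ :=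
      HyperCR.HyperPseudohermitian.exists_isNormalized_of_isAdmissible hP
    exact ⟨hT'.exists_isAssociated, fun D D' h h' => hT'.sameConnection h h'⟩
  · rintro P ⟨hP, D', hD', hDv'⟩
    obtain ⟨T', hT', rfl⟩ :=
      HyperCR.HyperPseudohermitian.exists_isNormalized_of_isAdmissible hP
    rw [hT.eq_of_omegaEHVanishes hn1 hS hT' hD hDv hD' hDv']
  · rintro T' ⟨h, hnorm, D', hD', hDv'⟩
    exact (hT.eq_of_omegaEHVanishes hn1 hS ⟨h, hnorm⟩ hD hDv hD' hDv').symm
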